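/- Let $d\ge 1$ and let $p\in C^\infty(\mathbb R^{2d},\mathbb C)$ be bounded together with each of its derivatives. Assume that $\operatorname{Re}p\ge 0$, $(\operatorname{Re}p)^{-1}(\{0\})=\{0\}$, $\liminf_{|(x,\xi)|\to\infty}\operatorname{Re}p>0$, $p(0)=0$, $p'(0)=0$, and that the quadratic part $q(X)=\tfrac12p''(0)(X,X)$ of $p$ at $0$ has elliptic real part, i.e. $\operatorname{Re}q(X)=0$ only for $X=0$. For $0<h\le1$ and $x\in\mathbb C^d$ let $\Phi_0(x)=\tfrac12(\operatorname{Im}x)^2$ and $\xi(x)=\tfrac2i\partial_x\Phi_0(x)=-\operatorname{Im}x$, let $L^2_{\Phi_0}(\mathbb C^d;h)=L^2(\mathbb C^d,e^{-2\Phi_0/h}\,dL)$ with norm $\|\cdot\|$, where $dL$ is Lebesgue measure, and let $H_{\Phi_0}(\mathbb C^d;h)$ be the subspace of entire functions in it. Let $\mathfrak p=p\circ\kappa_T^{-1}$ on $\Lambda_{\Phi_0}=\{(x,\xi(x))\}=\kappa_T(\mathbb R^{2d})$, where $\kappa_T(y,\eta)=(y-i\eta,\eta)$. Let $\mathfrak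 p^w=\mathfrak p^w(x,hD_x)$ be the bounded linear operator on $H_{\Phi_0}(\mathbb C^d;h)$ given, for those $u\in H_{\Phi_0}(\mathbb C^d;h)$ with $(1+|x|)^Nu\in L^2_{\Phi_0}(\mathbb C^d;h)$ for all $N$, by $$\mathfrak p^wu(x)=\frac1{(2\pi h)^d}\iint_{\theta=\xi\left(\frac{x+y}2\right)}e^{\frac ih(x-y)\cdot\theta}\,\mathfrak p\!\left(\tfrac{x+y}2,\theta\right)u(y)\,dy\,d\theta,$$ where $dy\,d\theta=2^{-d}\,dL(y)$ on the contour. For a constant $C_\gamma>0$ let $$f(h)=\frac1{C_\gamma}\left(\frac{\log\frac1h}{\log\log\frac1h}\right)^{1/d}.$$ Let $\chi\in C^\infty(\mathbb C^d)$ take values in $[0,1]$, vanish in a neighborhood of $0$, and equal $1$ for all sufficiently large $|x|$, and let $0\le\rho<1$. Then there are constants $C>0$ and $h_0>0$, depending only on $d,p,\chi,\rho$ and $C_\gamma$, such that for all $0<h\le h_0$ the operator $\mathfrak p^w$ exists and is uniquely determined by the above description, and, for all $z\in\mathbb C$ with $|z|\le hf(h)$ and all $u\in H_{\Phi_0}(\mathbb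 C^d;h)$, $$\int_{\mathbb C^d}\chi(h^{-\rho/2}x)|u(x)|^2e^{-2\Phi_0(x)/h}\,dL(x)\le C\,h^{-\rho}\,\|(\mathfrak p^w-z)u\|\,\|u\|+C\,h^{1-\rho}\|u\|^2.$$ -/

import Mathlib

open MeasureTheory Filter Topology
open scoped ContDiff

namespace Exterior

noncomputable section

/-- Real phase space `ℝ^d_x × ℝ^d_ξ`. The norms on it and on `ℂ^d = Fin d → ℂ` are sup norms; they
only enter below through conditions that are the same for all equivalent norms. -/
abbrev PhaseSpace (d : ℕ) : Type := (Fin d → ℝ) × (Fin d → ℝ)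

/-- The quadratic part `q` of `p` at the origin: `q(X) = p''(0)(X, X) / 2`. -/
def quadPart {d : ℕ} (p : PhaseSpace d → ℂ) (X : PhaseSpace d) : ℂ :=
  (1 / 2) * iteratedFDeriv ℝ 2 p 0 (fun _ => X)

/-- The hypotheses on the symbol `p` of the operator. -/
structure SymbolHypotheses {d : ℕ} (p : PhaseSpace d → ℂ) : Prop where
  /-- `p ∈ S(1)`: `p` is smooth, -/
  smooth : ContDiff ℝ ∞ p
  /-- and bounded together with each of its derivatives. -/
  bounded : ∀ k : ℕ, ∃ M : ℝ, ∀ X, ‖iteratedFDeriv ℝ k p X‖ ≤ M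
  /-- `Re p ≥ 0`. -/
  re_nonneg : ∀ X, 0 ≤ (p X).re
  /-- `Re p` vanishes precisely at the origin. -/
  re_eq_zero_iff : ∀ X, (p X).re = 0 ↔ X = 0
  /-- The lower limit of `Re p` at infinity is positive. -/
  liminf_pos : ∃ c : ℝ, 0 < c ∧ ∀ᶠ X in cocompact (PhaseSpace d), c ≤ (p X).re
  /-- The origin is doubly characteristic: `p(0) = 0` -/
  map_zero : p 0 = 0
  /-- and `p'(0) = 0`. -/
  fderiv_zero : fderiv ℝ p 0 = 0
  /-- The quadratic form `Re q` is elliptic, `q` being the quadratic part of `p` at the origin.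
  (The other half of ellipticity, that the form does not take all complex values, is automatic
  for a real-valued form.) -/
  elliptic : ∀ X, (quadPart p X).re = 0 ↔ X = 0

/-- The growth function `f(h) = (1/C_γ) (log(1/h) / log log(1/h))^{1/d}`. -/
def growth (d : ℕ) (Cγ h : ℝ) : ℝ :=
  (1 / Cγ) * (Real.log (1 / h) / Real.log (Real.log (1 / h))) ^ (1 / (d : ℝ))

/-- The weight `Φ₀(x) = (Im x)² / 2`. -/
def Phi0 {d : ℕ} (x : Fin d → ℂ) : ℝ := (1 / 2) * ∑ j, (x j).im ^ 2

/-- `ξ(x) = (2/i) ∂Φ₀/∂x (x) = - Im x`. -/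
def xi0 {d : ℕ} (x : Fin d → ℂ) : Fin d → ℂ := fun j => ((-(x j).im : ℝ) : ℂ)

/-- The manifold `Λ_{Φ₀} = {(x, ξ(x))}`. -/
def Lambda0 (d : ℕ) : Set ((Fin d → ℂ) × (Fin d → ℂ)) := Set.range fun x => (x, xi0 x)

/-- The canonical transformation `κ_T(y, η) = (y - iη, η)`, on real points. -/
def kappaT {d : ℕ} (Y : PhaseSpace d) : (Fin d → ℂ) × (Fin d → ℂ) :=
  (fun j => (Y.1 j : ℂ) - Complex.I * (Y.2 j : ℂ), fun j => (Y.2 j : ℂ))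

/-- The inverse `(x, ξ) ↦ (x + iξ, ξ)` of `κ_T`. On `Λ_{Φ₀}` both components are real, so that
taking real parts changes nothing there. -/
def kappaTInv {d : ℕ} (x ξ : Fin d → ℂ) : PhaseSpace d :=
  (fun j => (x j + Complex.I * ξ j).re, fun j => (ξ j).re)

theorem range_kappaT (d : ℕ) : Set.range (kappaT (d := d)) = Lambda0 d := by
  ext ⟨x, ξ⟩
  constructor
  · rintro ⟨Y, hY⟩
    refine ⟨fun j => (Y.1 j : ℂ) - Complex.I * (Y.2 j : ℂ), ?_⟩
    rw [← hY]
    refine Prod.ext rfl ?_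
    funext j
    simp [kappaT, xi0]
  · rintro ⟨y, hy⟩
    refine ⟨(fun j => (y j).re, fun j => -(y j).im), ?_⟩
    rw [← hy]
    refine Prod.ext ?_ ?_ <;> funext j
    · apply Complex.ext <;> simp [kappaT]
    · simp only [kappaT, xi0]

theorem kappaTInv_kappaT {d : ℕ} (Y : PhaseSpace d) :
    kappaTInv (kappaT Y).1 (kappaT Y).2 = Y := by
  refine Prod.ext ?_ ?_ <;> funext j <;> simp [kappaT, kappaTInv]

/-- The symbol `𝔭 = p ∘ κ_T⁻¹` on `Λ_{Φ₀}` (its values off `Λ_{Φ₀}` are never used). -/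
def frakSymbol {d : ℕ} (p : PhaseSpace d → ℂ) (x ξ : Fin d → ℂ) : ℂ := p (kappaTInv x ξ)

/-- The norm of `L²_{Φ₀}(ℂ^d; h) = L²(ℂ^d, e^{-2Φ₀/h} dL)`. -/
def normPhi (d : ℕ) (h : ℝ) (u : (Fin d → ℂ) → ℂ) : ℝ :=
  Real.sqrt (∫ x, ‖u x‖ ^ 2 * Real.exp (-(2 / h) * Phi0 x))

/-- The space `H_{Φ₀}(ℂ^d; h)` of the entire functions of finite `L²_{Φ₀}(ℂ^d; h)` norm. -/
def HPhi (d : ℕ) (h : ℝ) : Submodule ℂ ((Fin d → ℂ) → ℂ) where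
  carrier := {u | Differentiable ℂ u ∧
    Integrable fun x => ‖u x‖ ^ 2 * Real.exp (-(2 / h) * Phi0 x)}
  zero_mem' := ⟨differentiable_const 0, by simp⟩
  add_mem' := by
    rintro u v ⟨hu, hu'⟩ ⟨hv, hv'⟩
    refine ⟨hu.add hv, ((hu'.const_mul 2).add (hv'.const_mul 2)).mono' ?_ ?_⟩
    · refine Continuous.aestronglyMeasurable ?_
      have h1 : Continuous (u + v) := (hu.add hv).continuous
      unfold Phi0
      fun_prop
    · refine Eventually.of_forall fun x => ?_
      have h1 : ‖u x + v x‖ ^ 2 ≤ 2 * ‖u x‖ ^ 2 + 2 * ‖v x‖ ^ 2 := by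
        have := norm_add_le (u x) (v x)
        nlinarith [norm_nonneg (u x + v x), sq_nonneg (‖u x‖ - ‖v x‖)]
      have h2 := Real.exp_pos (-(2 / h) * Phi0 x)
      rw [Real.norm_of_nonneg (by positivity)]
      simp only [Pi.add_apply]
      nlinarith
  smul_mem' := by
    rintro c u ⟨hu, hu'⟩
    refine ⟨hu.const_smul c, ?_⟩
    have := hu'.const_mul (‖c‖ ^ 2)
    refine this.congr (Eventually.of_forall fun x => ?_)
    simp [mul_pow, mul_assoc]

/-- Functions `u` with `(1 + |x|)^N u ∈ L²_{Φ₀}(ℂ^d; h)` for all `N`. Those in `H_{Φ₀}(ℂ^d; h)` form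
a dense subspace of it, the image of the Schwartz space under the FBI-Bargmann transform. -/
def RapidlyDecreasing {d : ℕ} (h : ℝ) (u : (Fin d → ℂ) → ℂ) : Prop :=
  ∀ N : ℕ, Integrable fun x => (1 + ‖x‖) ^ N * (‖u x‖ ^ 2 * Real.exp (-(2 / h) * Phi0 x))

/-- The Weyl quantization formula
`(2πh)^{-d} ∬_{Γ₀(x)} e^{i(x-y)·θ/h} 𝔞((x+y)/2, θ) u(y) dy dθ`, with the contour
`Γ₀(x) = {θ = (2/i) ∂Φ₀/∂x ((x+y)/2)}`, along which `dy dθ = 2^{-d} dL(y)`, because there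
`θ_j = - Im (x_j+y_j)/2`. The integrand has absolute value at most a constant (depending on `x`)
times `|u(y)| e^{-Φ₀(y)/h}` when `𝔞` is bounded. -/
def weylIntegral {d : ℕ} (h : ℝ) (a : (Fin d → ℂ) → (Fin d → ℂ) → ℂ)
    (u : (Fin d → ℂ) → ℂ) (x : Fin d → ℂ) : ℂ :=
  (((2 * Real.pi * h) ^ d)⁻¹ * (2 ^ d)⁻¹ : ℝ) *
    ∫ y : Fin d → ℂ,
      Complex.exp (Complex.I / h * ∑ j, (x j - y j) * xi0 ((2 : ℂ)⁻¹ • (x + y)) j) *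
        a ((2 : ℂ)⁻¹ • (x + y)) (xi0 ((2 : ℂ)⁻¹ • (x + y))) * u y

/-- `A` is the operator `𝔞^w(x, hD_x)` on `H_{Φ₀}(ℂ^d; h)`: the bounded linear operator that is given
by the Weyl quantization formula on the dense subspace of rapidly decreasing functions, where the
integral converges absolutely. -/
structure IsWeylQuantization {d : ℕ} (h : ℝ) (a : (Fin d → ℂ) → (Fin d → ℂ) → ℂ)
    (A : HPhi d h →ₗ[ℂ] HPhi d h) : Prop where
  bounded : ∃ M : ℝ, ∀ u : HPhi d h, normPhi d h (A u) ≤ M * normPhi d h u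
  formula : ∀ u : HPhi d h, RapidlyDecreasing h (u : (Fin d → ℂ) → ℂ) →
    ∀ x, (A u : (Fin d → ℂ) → ℂ) x = weylIntegral h a u x

end

end Exterior

/-!
The operator is realized by an integral kernel. The coherent states `coherent h x w` form, up to
normalization, the reproducing kernel of `H_{Φ₀}`, and the Weyl quantization of a symbol `P` on
`ℂ^d` (with `P x = p (Re x, -Im x)`) has the kernel `coherent h x w * weylAverage h P x w`, where
the second factor is a complex Gaussian average of `P`. After a shift to the midpoint of `x` and
`w` and a scaling by `√h`, this average is the Fourier transform, at the frequency `(x - w) /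
(2√h)`, of a Gaussian times the rescaled symbol, whose derivatives are bounded uniformly in `h`;
hence, with the weights included, the kernel is dominated by a rapidly decreasing function of `(x -
w) / √h` (`exists_norm_kernel_le`). Schur's lemma makes the operator bounded, uniformly in `h`, and
Fubini's theorem together with the reproducing formula identifies it with the Weyl integral on
rapidly decreasing functions (`IsBoundedSymbol.kernelOp_eq_weylIntegral`). The latter are dense, as
the Bergman projections of truncations show (`exists_rapidlyDecreasing_approx`), so that the
operator is unique.

For the estimate, expand the symbol in the kernel to first order at the point `x` where the
operator is evaluated (`IsBoundedSymbol.kernelOp_weylKernel_eq`). The Taylor remainder is quadratic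
in quantities of size `√h` and gives an operator of norm `O(h)`. The holomorphic first order term
vanishes by the mean value property. The antiholomorphic one has the kernel `conj (w - x)ⱼ` times
the reproducing kernel, and its coefficient is `∂P/∂x̄ⱼ`. Paired with a cutoff `θ` and with `u`
itself, it would vanish if `b = θ ∂P/∂x̄ⱼ` were frozen at `w`, by the reproducing property in `x`;
so only the differences `b x - b w` count, and they gain another `√h` if `b` is Lipschitz
continuous (`exists_norm_integral_linear_le`). For the cutoff `θ x = χ (h^{-ρ/2} x)` the Lipschitz
constant of `b` is bounded uniformly in `h`, although that of `θ` is not: `∂P/∂x̄ⱼ` vanishes at the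
doubly characteristic point `0`, and `θ` varies only where `|x| = O(h^{ρ/2})`
(`norm_rescaled_mul_sub_le`).

Therefore the pairing of `θ 𝔭^w u` with `u` is the integral of `θ P |u|² e^{-2Φ₀/h}` up to `O(h)
‖u‖²`. By ellipticity of the quadratic part, `Re P` is at least a multiple of `h^ρ` on the support
of `θ`, whereas `|z| ≤ h f(h) = o(h^ρ)`. Taking real parts gives the theorem.
-/

namespace Exterior

noncomputable section

open scoped ComplexConjugate
open Complex (I)

variable {d : ℕ}

/-! ### Gaussian kernels and coherent states -/

/-- The Hermitian product `∑ xⱼ conj yⱼ` on `ℂ^d`, linear in the first variable. -/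
def herm (x y : Fin d → ℂ) : ℂ := ∑ j, x j * conj (y j)

/-- The square of the Hermitian norm on `ℂ^d` (the norm of `Fin d → ℂ` itself is the sup norm). -/
def sqNorm (x : Fin d → ℂ) : ℝ := ∑ j, ‖x j‖ ^ 2

theorem herm_self (x : Fin d → ℂ) : herm x x = (sqNorm x : ℂ) := by
  simp [herm, sqNorm, Complex.mul_conj, Complex.normSq_eq_norm_sq]

theorem continuous_sqNorm : Continuous (sqNorm (d := d)) := by
  unfold sqNorm; fun_prop

theorem continuous_Phi0 : Continuous (Phi0 (d := d)) := by
  unfold Phi0; fun_prop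

theorem sqNorm_nonneg (x : Fin d → ℂ) : 0 ≤ sqNorm x := by unfold sqNorm; positivity

theorem sqNorm_real_smul (r : ℝ) (x : Fin d → ℂ) : sqNorm (r • x) = r ^ 2 * sqNorm x := by
  simp [sqNorm, Finset.mul_sum, mul_pow]

theorem norm_sq_le_sqNorm (x : Fin d → ℂ) : ‖x‖ ^ 2 ≤ sqNorm x := by
  have h : ‖x‖ ≤ Real.sqrt (sqNorm x) := by
    refine (pi_norm_le_iff_of_nonneg (Real.sqrt_nonneg _)).2 fun j => Real.le_sqrt_of_sq_le ?_
    exact Finset.single_le_sum (f := fun j => ‖x j‖ ^ 2) (fun _ _ => by positivity)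
      (Finset.mem_univ j)
  calc ‖x‖ ^ 2 ≤ Real.sqrt (sqNorm x) ^ 2 := by gcongr
    _ = sqNorm x := Real.sq_sqrt (sqNorm_nonneg x)

theorem sqNorm_le (x : Fin d → ℂ) : sqNorm x ≤ d * ‖x‖ ^ 2 := by
  calc sqNorm x ≤ ∑ _j : Fin d, ‖x‖ ^ 2 := by
        refine Finset.sum_le_sum fun j _ => ?_
        gcongr
        exact norm_le_pi_norm x j
    _ = d * ‖x‖ ^ 2 := by simp

/-- The coherent state centred at `w`: the kernel `exp (-(x - w̄)² / 4h)`, holomorphic in `x` and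
antiholomorphic in `w`. Up to the factor `(2πh)^{-d}` it is the reproducing kernel of
`H_{Φ₀}(ℂ^d; h)`. -/
def coherent (h : ℝ) (x w : Fin d → ℂ) : ℂ :=
  Complex.exp (-(1 / (4 * h)) * ∑ j, (x j - conj (w j)) ^ 2)

theorem norm_coherent (h : ℝ) (x w : Fin d → ℂ) :
    ‖coherent h x w‖ * (Real.exp (-(1 / h) * Phi0 x) * Real.exp (-(1 / h) * Phi0 w)) =
      Real.exp (-(1 / (4 * h)) * sqNorm (x - w)) := by
  rw [coherent, Complex.norm_exp, ← Real.exp_add, ← Real.exp_add]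
  congr 1
  have : (-(1 / (4 * (h : ℂ))) * ∑ j, (x j - conj (w j)) ^ 2).re
      = -(1 / (4 * h)) * ∑ j, (((x j).re - (w j).re) ^ 2 - ((x j).im + (w j).im) ^ 2) := by
    have e : (-(1 / (4 * (h : ℂ)))) = ((-(1 / (4 * h)) : ℝ) : ℂ) := by push_cast; ring
    rw [e, Complex.re_ofReal_mul, Complex.re_sum]
    congr 1
    refine Finset.sum_congr rfl fun j _ => ?_
    simp [pow_two]
  rw [this]
  simp only [Phi0, sqNorm, Finset.mul_sum, ← Finset.sum_add_distrib]
  refine Finset.sum_congr rfl fun j _ => ?_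
  rw [← Complex.normSq_eq_norm_sq, Complex.normSq_apply]
  simp
  ring

theorem conj_coherent (h : ℝ) (x w : Fin d → ℂ) : conj (coherent h x w) = coherent h w x := by
  rw [coherent, coherent, ← Complex.exp_conj]
  congr 1
  simp only [map_mul, map_neg, map_div₀, map_one, map_sum, map_pow, map_sub, Complex.conj_conj,
    Complex.conj_ofReal, map_ofNat]
  congr 1
  exact Finset.sum_congr rfl fun j _ => by ring

/-- Seen from its centre, the reproducing kernel is a Gaussian times a function that is holomorphic
in the variable of integration and equal to `1` at the centre. -/
theorem coherent_mul_weight (h : ℝ) (x w : Fin d → ℂ) :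
    coherent h x w * (Real.exp (-(2 / h) * Phi0 w) : ℂ) =
      Complex.exp ((1 / (4 * h)) * ∑ j, ((w j - x j) ^ 2 + 2 * (w j - x j) * (x j - conj (x j)))) *
        (Real.exp (-(1 / (2 * h)) * sqNorm (w - x)) : ℂ) := by
  rw [coherent, Complex.ofReal_exp, Complex.ofReal_exp, ← Complex.exp_add, ← Complex.exp_add]
  congr 1
  simp only [Phi0, sqNorm, Complex.ofReal_mul, Complex.ofReal_sum, Finset.mul_sum,
    ← Finset.sum_add_distrib]
  refine Finset.sum_congr rfl fun j _ => ?_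
  have h1 : ((‖(w - x) j‖ ^ 2 : ℝ) : ℂ) = (w j - x j) * (conj (w j) - conj (x j)) := by
    rw [← Complex.normSq_eq_norm_sq, Complex.normSq_eq_conj_mul_self]
    simp; ring
  have h2 : ((((w j).im) ^ 2 : ℝ) : ℂ) = -(w j - conj (w j)) ^ 2 / 4 := by
    rw [Complex.sub_conj]; push_cast; ring_nf; simp
  rw [h1, h2]
  push_cast
  ring

/-- The factor of the phase space reflection at the point over `m`:
`exp ((2i/h) (x - m) · ξ(m))`. -/
def reflFactor (h : ℝ) (x m : Fin d → ℂ) : ℂ :=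
  Complex.exp (2 * I / h * ∑ j, (x j - m j) * xi0 m j)

theorem reflFactor_mul_coherent (h : ℝ) (x m w : Fin d → ℂ) :
    reflFactor h x m * coherent h (2 * m - x) w =
      coherent h x w * Complex.exp (-(1 / h) * herm (m - x) (m - w)) := by
  rw [reflFactor, coherent, coherent, ← Complex.exp_add, ← Complex.exp_add]
  congr 1
  simp only [herm, Finset.mul_sum, ← Finset.sum_add_distrib]
  refine Finset.sum_congr rfl fun j _ => ?_
  have h2 : xi0 m j = I * (m j - conj (m j)) / 2 := by
    rw [Complex.sub_conj, xi0]; push_cast; ring_nf; simp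
  rw [h2]
  simp only [Pi.sub_apply, Pi.mul_apply, map_sub, Pi.ofNat_apply]
  linear_combination (x j - m j) * (m j - conj (m j)) / h * Complex.I_sq

/-! ### The Gaussian mean value property and the reproducing kernel -/

theorem integral_exp_neg_sqNorm {b : ℝ} (hb : 0 < b) :
    ∫ x : Fin d → ℂ, Real.exp (-b * sqNorm x) = (Real.pi / b) ^ d := by
  have h1 : ∀ x : Fin d → ℂ, Real.exp (-b * sqNorm x) = ∏ j, Real.exp (-b * ‖x j‖ ^ 2) := by
    intro x
    rw [sqNorm, Finset.mul_sum, Real.exp_sum]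
  simp_rw [h1]
  rw [integral_fintype_prod_volume_eq_pow (fun z : ℂ => Real.exp (-b * ‖z‖ ^ 2)),
    GaussianFourier.integral_rexp_neg_mul_sq_norm hb]
  simp

theorem integrable_exp_neg_sqNorm {b : ℝ} (hb : 0 < b) :
    Integrable fun x : Fin d → ℂ => Real.exp (-b * sqNorm x) := by
  refine Integrable.of_integral_ne_zero ?_
  rw [integral_exp_neg_sqNorm hb]
  have := Real.pi_pos
  positivity

theorem measurePreserving_smul_of_norm_eq_one {c : ℂ} (hc : ‖c‖ = 1) :
    MeasurePreserving (fun x : Fin d → ℂ => c • x) volume volume := by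
  have h1 : MeasurePreserving (fun z : ℂ => c * z) volume volume :=
    (rotation ⟨c, by simpa [Submonoid.unitSphere] using hc⟩).measurePreserving
  exact volume_preserving_pi (fun _ : Fin d => h1)

theorem integral_circleMap_smul {F : (Fin d → ℂ) → ℂ} (hF : Differentiable ℂ F) (x : Fin d → ℂ) :
    ∫ θ in (0 : ℝ)..2 * Real.pi, F (circleMap 0 1 θ • x) = 2 * Real.pi * F 0 := by
  have h1 : Differentiable ℂ fun ζ : ℂ => F (ζ • x) :=
    hF.comp (differentiable_id.smul_const x)
  have h2 := (h1.diffContOnCl (s := Metric.ball 0 |1|)).circleAverage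
  rw [Real.circleAverage] at h2
  simp only [zero_smul] at h2
  rw [← h2, Complex.real_smul, ← mul_assoc]
  have : (2 * Real.pi : ℂ) ≠ 0 := by simp [Real.pi_ne_zero]
  push_cast
  rw [mul_inv_cancel₀ this, one_mul]

/-- The mean value property for a centred Gaussian. The Gaussian is invariant under `x ↦ e^{iθ}x`,
and the average of `θ ↦ F (e^{iθ}x)` is `F 0`. -/
theorem integral_mul_gaussian_zero {b : ℝ} (hb : 0 < b) {F : (Fin d → ℂ) → ℂ}
    (hF : Differentiable ℂ F)
    (hint : Integrable fun x => F x * (Real.exp (-b * sqNorm x) : ℂ)) :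
    ∫ x, F x * (Real.exp (-b * sqNorm x) : ℂ) = (Real.pi / b : ℝ) ^ d * F 0 := by
  set G : (Fin d → ℂ) → ℂ := fun x => F x * (Real.exp (-b * sqNorm x) : ℂ) with hG
  have hGc : Continuous G := by
    have := hF.continuous
    have := continuous_sqNorm (d := d)
    fun_prop
  have hc : ∀ θ : ℝ, ‖circleMap 0 1 θ‖ = 1 := by simp
  have hemb : ∀ θ : ℝ, MeasurableEmbedding (fun x : Fin d → ℂ => circleMap 0 1 θ • x) := fun θ =>
    (Homeomorph.smulOfNeZero (circleMap 0 1 θ) (by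
      rw [← norm_ne_zero_iff, hc]; exact one_ne_zero)).measurableEmbedding
  have hrot : ∀ θ : ℝ, ∫ x, G (circleMap 0 1 θ • x) = ∫ x, G x := fun θ =>
    (measurePreserving_smul_of_norm_eq_one (hc θ)).integral_comp (hemb θ) G
  have hrotn : ∀ θ : ℝ, ∫ x, ‖G (circleMap 0 1 θ • x)‖ = ∫ x, ‖G x‖ := fun θ =>
    (measurePreserving_smul_of_norm_eq_one (hc θ)).integral_comp (hemb θ) fun x => ‖G x‖
  have hprod : Integrable (Function.uncurry fun (θ : ℝ) (x : Fin d → ℂ) => G (circleMap 0 1 θ • x))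
      ((volume.restrict (Set.uIoc 0 (2 * Real.pi))).prod volume) := by
    rw [integrable_prod_iff]
    · refine ⟨Eventually.of_forall fun θ => ?_, ?_⟩
      · exact ((measurePreserving_smul_of_norm_eq_one (hc θ)).integrable_comp_emb (hemb θ)).2 hint
      · simp only [Function.uncurry, hrotn]
        have : IsFiniteMeasure (volume.restrict (Set.uIoc 0 (2 * Real.pi))) := by
          rw [Set.uIoc]; infer_instance
        exact integrable_const _
    · refine Continuous.aestronglyMeasurable ?_
      unfold Function.uncurry
      fun_prop
  have hswap := intervalIntegral_integral_swap hprod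
  have hsq : ∀ (θ : ℝ) (x : Fin d → ℂ), sqNorm (circleMap 0 1 θ • x) = sqNorm x := by
    intro θ x; simp [sqNorm]
  have hinner : ∀ x : Fin d → ℂ, ∫ θ in (0 : ℝ)..2 * Real.pi, G (circleMap 0 1 θ • x)
      = 2 * Real.pi * F 0 * (Real.exp (-b * sqNorm x) : ℂ) := by
    intro x
    simp only [hG, hsq]
    rw [intervalIntegral.integral_mul_const, integral_circleMap_smul hF]
  simp_rw [hrot, hinner] at hswap
  rw [intervalIntegral.integral_const, integral_const_mul, integral_complex_ofReal,
    integral_exp_neg_sqNorm hb, sub_zero, Complex.real_smul] at hswap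
  have h2 : (2 * Real.pi : ℂ) ≠ 0 := by simp [Real.pi_ne_zero]
  apply mul_left_cancel₀ h2
  push_cast at hswap ⊢
  rw [hswap]
  ring

theorem integral_mul_gaussian {b : ℝ} (hb : 0 < b) {F : (Fin d → ℂ) → ℂ}
    (hF : Differentiable ℂ F) (c : Fin d → ℂ)
    (hint : Integrable fun x => F x * (Real.exp (-b * sqNorm (x - c)) : ℂ)) :
    ∫ x, F x * (Real.exp (-b * sqNorm (x - c)) : ℂ) = (Real.pi / b : ℝ) ^ d * F c := by
  have h1 := integral_mul_gaussian_zero hb (F := fun x => F (x + c))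
    (hF.comp (differentiable_id.add_const c))
    (by simpa using hint.comp_add_right c)
  rw [zero_add] at h1
  rw [← h1, ← integral_add_right_eq_self _ c]
  simp

theorem integral_conj_mul_gaussian {b : ℝ} (hb : 0 < b) {F : (Fin d → ℂ) → ℂ}
    (hF : Differentiable ℂ F) (c : Fin d → ℂ)
    (hint : Integrable fun x => conj (F x) * (Real.exp (-b * sqNorm (x - c)) : ℂ)) :
    ∫ x, conj (F x) * (Real.exp (-b * sqNorm (x - c)) : ℂ) =
      (Real.pi / b : ℝ) ^ d * conj (F c) := by
  have e : ∀ x, conj (F x) * (Real.exp (-b * sqNorm (x - c)) : ℂ) =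
      conj (F x * (Real.exp (-b * sqNorm (x - c)) : ℂ)) := by
    intro x; rw [map_mul, Complex.conj_ofReal]
  simp_rw [e] at hint ⊢
  have h0 : Integrable fun x => F x * (Real.exp (-b * sqNorm (x - c)) : ℂ) := by
    have h00 := (Complex.conjCLE : ℂ →L[ℝ] ℂ).integrable_comp hint
    refine h00.congr (Eventually.of_forall fun x => ?_)
    simp
  rw [integral_conj, integral_mul_gaussian hb hF c h0]
  simp

/-- The reproducing property of the coherent states. -/
theorem integral_coherent_mul {h : ℝ} (hh : 0 < h) {F : (Fin d → ℂ) → ℂ}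
    (hF : Differentiable ℂ F) (x : Fin d → ℂ)
    (hint : Integrable fun w => coherent h x w * (F w * (Real.exp (-(2 / h) * Phi0 w) : ℂ))) :
    ∫ w, coherent h x w * (F w * (Real.exp (-(2 / h) * Phi0 w) : ℂ)) =
      (2 * Real.pi * h : ℝ) ^ d * F x := by
  have e : ∀ w, coherent h x w * (F w * (Real.exp (-(2 / h) * Phi0 w) : ℂ)) =
      (F w * Complex.exp ((1 / (4 * h)) * ∑ j, ((w j - x j) ^ 2 +
        2 * (w j - x j) * (x j - conj (x j))))) *
        (Real.exp (-(1 / (2 * h)) * sqNorm (w - x)) : ℂ) := by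
    intro w
    rw [mul_left_comm, coherent_mul_weight]
    ring
  simp_rw [e] at hint ⊢
  rw [integral_mul_gaussian (by positivity) _ x hint]
  · have : Real.pi / (1 / (2 * h)) = 2 * Real.pi * h := by field_simp
    rw [this]
    simp
  · fun_prop

/-! ### Integrals depending on a parameter: holomorphy and Schur bounds -/

/-- The Cauchy estimate, along complex lines. -/
theorem norm_fderiv_le_of_norm_le {F : (Fin d → ℂ) → ℂ} (hF : Differentiable ℂ F)
    {x : Fin d → ℂ} {M : ℝ} (hM : 0 ≤ M) (h : ∀ y ∈ Metric.ball x 2, ‖F y‖ ≤ M) :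
    ‖fderiv ℂ F x‖ ≤ M := by
  refine ContinuousLinearMap.opNorm_le_bound _ hM fun v => ?_
  rcases eq_or_ne v 0 with rfl | hv
  · simp
  have hv' : 0 < ‖v‖ := norm_pos_iff.2 hv
  have h1 : HasDerivAt (fun t : ℂ => F (x + t • v)) (fderiv ℂ F x v) 0 := by
    have h2 : HasFDerivAt F (fderiv ℂ F x) (x + (0 : ℂ) • v) := by
      simpa using (hF x).hasFDerivAt
    have h3 : HasDerivAt (fun t : ℂ => x + t • v) v 0 := by
      simpa using ((hasDerivAt_id (0 : ℂ)).smul_const v).const_add x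
    exact h2.comp_hasDerivAt 0 h3
  have h4 : ‖deriv (fun t : ℂ => F (x + t • v)) 0‖ ≤ M / (1 / ‖v‖) := by
    refine Complex.norm_deriv_le_of_forall_mem_sphere_norm_le (by positivity) ?_ ?_
    · exact (hF.comp ((differentiable_id.smul_const v).const_add x)).diffContOnCl
    · intro z hz
      refine h _ ?_
      have : ‖z‖ = 1 / ‖v‖ := by simpa using hz
      rw [mem_ball_iff_norm, add_sub_cancel_left, norm_smul, this]
      field_simp
      norm_num
  rw [h1.deriv] at h4
  rwa [div_div_eq_mul_div, div_one] at h4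

/-- An integral of entire functions with a locally uniform integrable bound is entire; the bounds on
the derivatives come from the Cauchy estimates. -/
theorem differentiable_integral_of_dominated {α : Type*} [MeasurableSpace α] {μ : Measure α}
    {G : (Fin d → ℂ) → α → ℂ} (hmeas : ∀ x, AEStronglyMeasurable (G x) μ)
    (hdiff : ∀ a, Differentiable ℂ fun x => G x a)
    (hbound : ∀ x₀ : Fin d → ℂ, ∃ g : α → ℝ, Integrable g μ ∧
      ∀ x ∈ Metric.ball x₀ 3, ∀ a, ‖G x a‖ ≤ g a) :
    Differentiable ℂ fun x => ∫ a, G x a ∂μ := by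
  intro x₀
  obtain ⟨g, hg, hgb⟩ := hbound x₀
  have hg0 : ∀ a, 0 ≤ g a := fun a =>
    (norm_nonneg _).trans (hgb x₀ (Metric.mem_ball_self (by norm_num)) a)
  have hline : ∀ (v : Fin d → ℂ), AEStronglyMeasurable
      (fun a => fderiv ℂ (fun x => G x a) x₀ v) μ := by
    intro v
    have hu : ∀ n : ℕ, AEStronglyMeasurable
        (fun a => ((n : ℂ) + 1) * (G (x₀ + ((n : ℂ) + 1)⁻¹ • v) a - G x₀ a)) μ := fun n =>
      ((hmeas _).sub (hmeas _)).const_mul _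
    refine aestronglyMeasurable_of_tendsto_ae atTop hu (Eventually.of_forall fun a => ?_)
    have h1 := (hdiff a x₀).hasFDerivAt
    refine h1.lim v ?_
    have e : ∀ n : ℕ, ‖(n : ℂ) + 1‖ = (n : ℝ) + 1 := by
      intro n
      rw [← Nat.cast_add_one, Complex.norm_natCast, Nat.cast_add_one]
    simp_rw [e]
    exact tendsto_atTop_add_const_right _ _ tendsto_natCast_atTop_atTop
  refine (hasFDerivAt_integral_of_dominated_of_fderiv_le (𝕜 := ℂ)
    (F' := fun x a => fderiv ℂ (fun x => G x a) x) (bound := g)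
    (Metric.ball_mem_nhds x₀ one_pos) (Eventually.of_forall hmeas) ?_ ?_ ?_ hg ?_).differentiableAt
  · exact hg.mono' (hmeas x₀) (Eventually.of_forall fun a =>
      hgb x₀ (Metric.mem_ball_self (by norm_num)) a)
  · have e : (fun a => fderiv ℂ (fun x => G x a) x₀) = fun a => ∑ j,
        fderiv ℂ (fun x => G x a) x₀ (Pi.single j 1) •
          (ContinuousLinearMap.proj j : (Fin d → ℂ) →L[ℂ] ℂ) := by
      funext a
      ext v
      simp only [sum_apply, smul_apply,
        ContinuousLinearMap.proj_apply, smul_eq_mul]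
      conv_lhs => rw [pi_eq_sum_univ' v]
      rw [map_sum]
      refine Finset.sum_congr rfl fun j _ => ?_
      rw [map_smul, smul_eq_mul, mul_comm]
    rw [e]
    exact Finset.aestronglyMeasurable_fun_sum _ fun j _ => (hline _).smul_const _
  · refine Eventually.of_forall fun a x hx => norm_fderiv_le_of_norm_le (hdiff a) (hg0 a) ?_
    intro y hy
    refine hgb y ?_ a
    rw [Metric.mem_ball] at *
    linarith [dist_triangle y x x₀]
  · exact Eventually.of_forall fun a x _ => (hdiff a x).hasFDerivAt

/-- The Cauchy-Schwarz inequality with a weight `κ`. -/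
theorem sq_integral_mul_le {α : Type*} [MeasurableSpace α] {μ : Measure α} {κ f : α → ℝ}
    (hκ0 : ∀ a, 0 ≤ κ a) (hκ : Integrable κ μ) (hf : Integrable (fun a => κ a * f a) μ)
    (hf2 : Integrable (fun a => κ a * f a ^ 2) μ) :
    (∫ a, κ a * f a ∂μ) ^ 2 ≤ (∫ a, κ a ∂μ) * ∫ a, κ a * f a ^ 2 ∂μ := by
  have h1 : ∀ s : ℝ, 0 ≤ (∫ a, κ a ∂μ) * (s * s) + (-2 * ∫ a, κ a * f a ∂μ) * s +
      ∫ a, κ a * f a ^ 2 ∂μ := by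
    intro s
    have h2 : 0 ≤ ∫ a, κ a * (f a - s) ^ 2 ∂μ :=
      integral_nonneg fun a => mul_nonneg (hκ0 a) (sq_nonneg _)
    have h3 : ∀ a, κ a * (f a - s) ^ 2 = κ a * (s * s) + (κ a * f a) * (-2 * s) + κ a * f a ^ 2 :=
      fun a => by ring
    simp_rw [h3] at h2
    have e1 : Integrable (fun a => κ a * (s * s) + (κ a * f a) * (-2 * s)) μ :=
      (hκ.mul_const _).add (hf.mul_const _)
    rw [integral_add e1 hf2, integral_add (hκ.mul_const _) (hf.mul_const _), integral_mul_const,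
      integral_mul_const] at h2
    linarith
  have h2 := discrim_le_zero h1
  rw [discrim] at h2
  nlinarith

section Schur

variable {κ : (Fin d → ℂ) → ℝ} {f : (Fin d → ℂ) → ℂ}

theorem integrable_schur_sq (hκc : Continuous κ) {M : ℝ} (hκM : ∀ t, |κ t| ≤ M)
    (hf2 : Integrable fun w => ‖f w‖ ^ 2) (x : Fin d → ℂ) :
    Integrable fun w => κ (x - w) * ‖f w‖ ^ 2 := by
  refine hf2.bdd_mul (c := M) ?_ ?_
  · exact (by fun_prop : Continuous fun w => κ (x - w)).aestronglyMeasurable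
  · exact Eventually.of_forall fun w => hκM _

theorem integrable_schur (hκc : Continuous κ) (hκ : Integrable κ) {M : ℝ} (hκM : ∀ t, |κ t| ≤ M)
    (hf : AEStronglyMeasurable f)
    (hf2 : Integrable fun w => ‖f w‖ ^ 2) (x : Fin d → ℂ) :
    Integrable fun w => κ (x - w) * ‖f w‖ := by
  have h1 : Integrable fun w => |κ (x - w)| := (hκ.comp_sub_left x).abs
  have h2 := (integrable_schur_sq hκc hκM hf2 x).abs
  refine (h1.add h2).mono' ?_ (Eventually.of_forall fun w => ?_)
  · exact ((by fun_prop : Continuous fun w => κ (x - w)).aestronglyMeasurable).mul hf.norm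
  · simp only [Pi.add_apply, norm_mul, Real.norm_eq_abs, abs_mul, abs_norm, abs_pow]
    nlinarith [abs_nonneg (κ (x - w)), sq_nonneg (‖f w‖ - 1), norm_nonneg (f w)]

theorem integrable_schur_prod (hκ : Integrable κ) (hf2 : Integrable fun w => ‖f w‖ ^ 2) :
    Integrable fun p : (Fin d → ℂ) × (Fin d → ℂ) => κ (p.1 - p.2) * ‖f p.2‖ ^ 2 := by
  have := Integrable.convolution_integrand (ContinuousLinearMap.mul ℝ ℝ) hf2 hκ
  refine this.congr (Eventually.of_forall fun p => ?_)
  simp [mul_comm]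

theorem integral_schur_sq (hκ : Integrable κ) (hf2 : Integrable fun w => ‖f w‖ ^ 2) :
    ∫ x, ∫ w, κ (x - w) * ‖f w‖ ^ 2 = (∫ t, κ t) * ∫ w, ‖f w‖ ^ 2 := by
  rw [integral_integral_swap (f := fun x w => κ (x - w) * ‖f w‖ ^ 2) (integrable_schur_prod hκ hf2)]
  simp_rw [integral_mul_const, integral_sub_right_eq_self (fun x => κ x)]
  rw [integral_const_mul]

/-- Schur's lemma for a kernel dominated by a convolution kernel. -/
theorem schur_bound (hκ0 : ∀ t, 0 ≤ κ t) (hκc : Continuous κ) (hκ : Integrable κ) {M : ℝ}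
    (hκM : ∀ t, |κ t| ≤ M) (hf : AEStronglyMeasurable f) (hf2 : Integrable fun w => ‖f w‖ ^ 2)
    {g : (Fin d → ℂ) → ℂ} (hg : AEStronglyMeasurable g) {c : ℝ}
    (hgb : ∀ x, ‖g x‖ ≤ c * ∫ w, κ (x - w) * ‖f w‖) :
    Integrable (fun x => ‖g x‖ ^ 2) ∧
      ∫ x, ‖g x‖ ^ 2 ≤ (c * ∫ t, κ t) ^ 2 * ∫ w, ‖f w‖ ^ 2 := by
  have h1 : ∀ x, ‖g x‖ ^ 2 ≤ c ^ 2 * (∫ t, κ t) * ∫ w, κ (x - w) * ‖f w‖ ^ 2 := by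
    intro x
    have h2 := sq_integral_mul_le (fun w => hκ0 (x - w)) (hκ.comp_sub_left x)
      (integrable_schur hκc hκ hκM hf hf2 x) (integrable_schur_sq hκc hκM hf2 x)
    rw [integral_sub_left_eq_self (fun t => κ t)] at h2
    calc ‖g x‖ ^ 2 ≤ (c * ∫ w, κ (x - w) * ‖f w‖) ^ 2 := by
          have := hgb x
          gcongr
      _ = c ^ 2 * (∫ w, κ (x - w) * ‖f w‖) ^ 2 := by ring
      _ ≤ c ^ 2 * ((∫ t, κ t) * ∫ w, κ (x - w) * ‖f w‖ ^ 2) := by gcongr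
      _ = _ := by ring
  have h3 : Integrable fun x => c ^ 2 * (∫ t, κ t) * ∫ w, κ (x - w) * ‖f w‖ ^ 2 :=
    (integrable_schur_prod hκ hf2).integral_prod_left.const_mul _
  have h4 : Integrable (fun x => ‖g x‖ ^ 2) :=
    h3.mono' (hg.norm.pow 2) (Eventually.of_forall fun x => by simpa using h1 x)
  refine ⟨h4, (integral_mono h4 h3 h1).trans_eq ?_⟩
  rw [integral_const_mul, integral_schur_sq hκ hf2]
  ring

/-- The sesquilinear version of `schur_bound`, by `2ab ≤ a² + b²`. -/
theorem integrable_schur_form (hκ0 : ∀ t, 0 ≤ κ t) (hκ : Integrable κ)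
    (hκs : ∀ t, κ (-t) = κ t) (hf : AEStronglyMeasurable f)
    (hf2 : Integrable fun w => ‖f w‖ ^ 2) :
    Integrable (fun p : (Fin d → ℂ) × (Fin d → ℂ) => κ (p.1 - p.2) * (‖f p.2‖ * ‖f p.1‖)) ∧
      ∫ p : (Fin d → ℂ) × (Fin d → ℂ), κ (p.1 - p.2) * (‖f p.2‖ * ‖f p.1‖)
        ≤ (∫ t, κ t) * ∫ w, ‖f w‖ ^ 2 := by
  have h1 := integrable_schur_prod hκ hf2
  have h2 : Integrable fun p : (Fin d → ℂ) × (Fin d → ℂ) => κ (p.1 - p.2) * ‖f p.1‖ ^ 2 := by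
    refine h1.swap.congr (Eventually.of_forall fun p => ?_)
    simp only [Function.comp, Prod.fst_swap, Prod.snd_swap]
    rw [← hκs, neg_sub]
  have h3 : Integrable fun p : (Fin d → ℂ) × (Fin d → ℂ) =>
      (1 / 2) * (κ (p.1 - p.2) * ‖f p.2‖ ^ 2 + κ (p.1 - p.2) * ‖f p.1‖ ^ 2) :=
    (h1.add h2).const_mul _
  have h4 : ∀ p : (Fin d → ℂ) × (Fin d → ℂ), κ (p.1 - p.2) * (‖f p.2‖ * ‖f p.1‖) ≤
      (1 / 2) * (κ (p.1 - p.2) * ‖f p.2‖ ^ 2 + κ (p.1 - p.2) * ‖f p.1‖ ^ 2) := by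
    intro p
    nlinarith [mul_nonneg (hκ0 (p.1 - p.2)) (sq_nonneg (‖f p.2‖ - ‖f p.1‖))]
  have h5 : Integrable
      (fun p : (Fin d → ℂ) × (Fin d → ℂ) => κ (p.1 - p.2) * (‖f p.2‖ * ‖f p.1‖)) := by
    refine h3.mono' ?_ (Eventually.of_forall fun p => ?_)
    · have hk : AEStronglyMeasurable (fun p : (Fin d → ℂ) × (Fin d → ℂ) => κ (p.1 - p.2))
          (volume.prod volume) :=
        hκ.aestronglyMeasurable.comp_quasiMeasurePreserving
          (quasiMeasurePreserving_sub_of_right_invariant volume volume)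
      exact hk.mul (hf.comp_snd.norm.mul hf.comp_fst.norm)
    · rw [Real.norm_of_nonneg (mul_nonneg (hκ0 _) (by positivity))]
      exact h4 p
  refine ⟨h5, (integral_mono h5 h3 h4).trans_eq ?_⟩
  have h6 : ∫ p : (Fin d → ℂ) × (Fin d → ℂ), κ (p.1 - p.2) * ‖f p.2‖ ^ 2 =
      (∫ t, κ t) * ∫ w, ‖f w‖ ^ 2 := by
    rw [Measure.volume_eq_prod, integral_prod _ h1, integral_schur_sq hκ hf2]
  have h7 : ∫ p : (Fin d → ℂ) × (Fin d → ℂ), κ (p.1 - p.2) * ‖f p.1‖ ^ 2 =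
      (∫ t, κ t) * ∫ w, ‖f w‖ ^ 2 := by
    rw [Measure.volume_eq_prod, integral_prod _ h2]
    simp_rw [integral_mul_const, integral_sub_left_eq_self (fun x => κ x)]
    rw [integral_const_mul]
  rw [integral_const_mul, integral_add h1 h2, h6, h7]
  ring

end Schur

/-! ### The model kernel -/

/-- The integrable convolution kernel `(1 + |t| / √h)^{-(2d+1)}`, which dominates the
kernels of all operators below. -/
def decay (h : ℝ) (t : Fin d → ℂ) : ℝ := ((1 + ‖(Real.sqrt h)⁻¹ • t‖) ^ (2 * d + 1))⁻¹

theorem decay_pos (h : ℝ) (t : Fin d → ℂ) : 0 < decay h t := by unfold decay; positivity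

theorem continuous_decay (h : ℝ) : Continuous (decay (d := d) h) := by
  unfold decay
  exact Continuous.inv₀ (by fun_prop) fun t => by positivity

theorem abs_decay_le (h : ℝ) (t : Fin d → ℂ) : |decay h t| ≤ 1 := by
  rw [abs_of_pos (decay_pos h t), decay]
  exact inv_le_one_of_one_le₀ (one_le_pow₀ (by linarith [norm_nonneg ((Real.sqrt h)⁻¹ • t)]))

theorem decay_neg (h : ℝ) (t : Fin d → ℂ) : decay h (-t) = decay h t := by
  simp [decay]

theorem finrank_real_pi_complex : Module.finrank ℝ (Fin d → ℂ) = 2 * d := by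
  rw [Module.finrank_pi_fintype]
  simp [mul_comm]

theorem integrable_inv_one_add_norm_pow :
    Integrable fun t : Fin d → ℂ => ((1 + ‖t‖) ^ (2 * d + 1))⁻¹ := by
  have h1 := integrable_one_add_norm (E := Fin d → ℂ) (μ := volume) (r := (2 * d + 1 : ℕ))
    (by rw [finrank_real_pi_complex]; push_cast; linarith)
  refine h1.congr (Eventually.of_forall fun t => ?_)
  simp only
  rw [Real.rpow_neg (by positivity), Real.rpow_natCast]

theorem integrable_decay {h : ℝ} (hh : 0 < h) : Integrable (decay (d := d) h) :=
  integrable_inv_one_add_norm_pow.comp_smul (inv_ne_zero (Real.sqrt_pos.2 hh).ne')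

theorem integral_decay {h : ℝ} (hh : 0 < h) :
    ∫ t, decay (d := d) h t = h ^ d * ∫ t, decay (d := d) 1 t := by
  have h1 := Measure.integral_comp_inv_smul_of_nonneg (volume : Measure (Fin d → ℂ))
    (fun t => decay (d := d) 1 t) (Real.sqrt_nonneg h)
  rw [finrank_real_pi_complex, pow_mul, Real.sq_sqrt hh.le] at h1
  rw [← smul_eq_mul, ← h1]
  simp [decay]

theorem integral_decay_one_pos : 0 < ∫ t, decay (d := d) 1 t :=
  integral_pos_of_integrable_nonneg_nonzero (continuous_decay 1) (integrable_decay one_pos)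
    (fun t => (decay_pos 1 t).le) (decay_pos 1 (0 : Fin d → ℂ)).ne'

/-! ### Decay of Fourier integrals against a Gaussian -/

theorem exists_one_add_pow_mul_exp_le (M : ℕ) {a : ℝ} (ha : 0 < a) :
    ∃ C : ℝ, 0 < C ∧ ∀ r : ℝ, 0 ≤ r → (1 + r) ^ M * Real.exp (-a * r ^ 2) ≤ C := by
  refine ⟨M.factorial * Real.exp (1 + 1 / (4 * a)), by positivity, fun r hr => ?_⟩
  have h1 := Real.pow_div_factorial_le_exp (1 + r) (by positivity) M
  rw [div_le_iff₀ (by positivity)] at h1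
  calc (1 + r) ^ M * Real.exp (-a * r ^ 2)
      ≤ Real.exp (1 + r) * M.factorial * Real.exp (-a * r ^ 2) := by gcongr
    _ = M.factorial * Real.exp (1 + r + -a * r ^ 2) := by rw [Real.exp_add (1 + r)]; ring
    _ ≤ M.factorial * Real.exp (1 + 1 / (4 * a)) := by
        refine mul_le_mul_of_nonneg_left (Real.exp_le_exp.2 ?_) (by positivity)
        have : 1 / (4 * a) - r + a * r ^ 2 = (2 * a * r - 1) ^ 2 / (4 * a) := by field_simp; ring
        have h2 : 0 ≤ (2 * a * r - 1) ^ 2 / (4 * a) := by positivity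
        linarith

theorem exists_one_add_norm_pow_mul_exp_neg_sqNorm_le (M : ℕ) {a : ℝ} (ha : 0 < a) :
    ∃ C : ℝ, 0 < C ∧ ∀ t : Fin d → ℂ, (1 + ‖t‖) ^ M * Real.exp (-a * sqNorm t) ≤ C := by
  obtain ⟨C, hC, h⟩ := exists_one_add_pow_mul_exp_le M ha
  refine ⟨C, hC, fun t => le_trans ?_ (h ‖t‖ (norm_nonneg t))⟩
  have := norm_sq_le_sqNorm t
  exact mul_le_mul_of_nonneg_left (Real.exp_le_exp.2 (by nlinarith)) (by positivity)

theorem hasTemperateGrowth_neg_sqNorm :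
    Function.HasTemperateGrowth fun t : Fin d → ℂ => -sqNorm t := by
  have h1 : ∀ j : Fin d, Function.HasTemperateGrowth fun t : Fin d → ℂ => ‖t j‖ ^ 2 := fun j =>
    (Function.hasTemperateGrowth_norm_sq ℂ).comp
      (ContinuousLinearMap.proj (R := ℝ) (φ := fun _ : Fin d => ℂ) j).hasTemperateGrowth
  exact (Function.HasTemperateGrowth.sum (s := Finset.univ) fun j _ => h1 j).neg

theorem contDiff_exp_neg_sqNorm : ContDiff ℝ ∞ fun t : Fin d → ℂ => Real.exp (-sqNorm t) :=
  Real.contDiff_exp.comp hasTemperateGrowth_neg_sqNorm.1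

/-- All derivatives of the Gaussian decay faster than any power. -/
theorem exists_iteratedFDeriv_gaussian_le (N M : ℕ) : ∃ C : ℝ, 0 < C ∧ ∀ q ≤ N,
    ∀ t : Fin d → ℂ, ‖iteratedFDeriv ℝ q (fun t : Fin d → ℂ => Real.exp (-sqNorm t)) t‖ ≤
      C * ((1 + ‖t‖) ^ M)⁻¹ := by
  obtain ⟨k, C, hC, hD⟩ :=
    (hasTemperateGrowth_neg_sqNorm (d := d)).norm_iteratedFDeriv_le_uniform N
  obtain ⟨C', hC', hg⟩ :=
    exists_one_add_norm_pow_mul_exp_neg_sqNorm_le (d := d) (k * N + M) one_pos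
  refine ⟨N.factorial * (C + 1) ^ N * C', by positivity, fun q hq t => ?_⟩
  have h1 : 1 ≤ (1 + ‖t‖) ^ k := one_le_pow₀ (by linarith [norm_nonneg t])
  have h2 : 1 ≤ (C + 1) * (1 + ‖t‖) ^ k := by nlinarith
  have h3 := norm_iteratedFDeriv_comp_le (𝕜 := ℝ) (g := Real.exp)
    (f := fun t : Fin d → ℂ => -sqNorm t) (n := q) (N := ∞) (Real.contDiff_exp)
    hasTemperateGrowth_neg_sqNorm.1 (mod_cast le_top) t (C := Real.exp (-sqNorm t))
    (D := (C + 1) * (1 + ‖t‖) ^ k) ?_ ?_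
  · have h4 : ((C + 1) * (1 + ‖t‖) ^ k) ^ q ≤ ((C + 1) * (1 + ‖t‖) ^ k) ^ N :=
      pow_le_pow_right₀ h2 hq
    have h5 : (q.factorial : ℝ) ≤ N.factorial := by exact_mod_cast Nat.factorial_le hq
    refine h3.trans ?_
    rw [← div_eq_mul_inv, le_div_iff₀ (by positivity)]
    have h6 := hg t
    rw [pow_add, pow_mul, neg_one_mul] at h6
    calc (q.factorial : ℝ) * Real.exp (-sqNorm t) * ((C + 1) * (1 + ‖t‖) ^ k) ^ q * (1 + ‖t‖) ^ M
        ≤ N.factorial * Real.exp (-sqNorm t) * ((C + 1) * (1 + ‖t‖) ^ k) ^ N * (1 + ‖t‖) ^ M := by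
          gcongr
      _ = N.factorial * (C + 1) ^ N *
          (((1 + ‖t‖) ^ k) ^ N * (1 + ‖t‖) ^ M * Real.exp (-sqNorm t)) := by
          rw [mul_pow]; ring
      _ ≤ N.factorial * (C + 1) ^ N * C' := by gcongr
  · intro i _
    rw [norm_iteratedFDeriv_eq_norm_iteratedDeriv, iteratedDeriv_eq_iterate, Real.iter_deriv_exp,
      Real.norm_of_nonneg (Real.exp_pos _).le]
  · intro i hi hiq
    calc _ ≤ C * (1 + ‖t‖) ^ k := hD i (hiq.trans hq) t
      _ ≤ (C + 1) * (1 + ‖t‖) ^ k := by gcongr; linarith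
      _ ≤ _ := le_self_pow₀ h2 (by omega)

/-- The real bilinear form `Im ∑ tⱼ conj ηⱼ`, the symplectic form on `ℂ^d = ℝ^{2d}`, normalized so
that the Fourier kernel `exp (-2πi ⬝)` becomes `exp (-2i Im herm t η)`. -/
def symplecticForm (d : ℕ) : (Fin d → ℂ) →L[ℝ] (Fin d → ℂ) →L[ℝ] ℝ :=
  LinearMap.toContinuousBilinearMap <| LinearMap.mk₂ ℝ
    (fun t η : Fin d → ℂ => (herm t η).im / Real.pi)
    (fun a b c => by simp [herm, add_mul, Finset.sum_add_distrib]; ring)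
    (fun r a b => by
      simp only [herm, Pi.smul_apply, smul_mul_assoc, ← Finset.smul_sum, Complex.smul_im,
        smul_eq_mul, mul_div_assoc])
    (fun a b c => by simp [herm, mul_add, Finset.sum_add_distrib]; ring)
    (fun r a b => by
      have : ∀ j, a j * conj ((r • b) j) = r • (a j * conj (b j)) := by
        intro j; simp [Complex.real_smul]; ring
      simp only [herm, this, ← Finset.smul_sum, Complex.smul_im, smul_eq_mul, mul_div_assoc])

theorem symplecticForm_apply (t η : Fin d → ℂ) :
    symplecticForm d t η = (herm t η).im / Real.pi := rfl

/-- Quantitative decay of the Fourier transform of a Gaussian times a smooth amplitude with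
derivatives of at most quadratic growth. -/
theorem exists_fourier_gaussian_le (N : ℕ) : ∃ C : ℝ, 0 < C ∧ ∀ Λ : ℝ, ∀ b : (Fin d → ℂ) → ℂ,
    ContDiff ℝ ∞ b → (∀ q ≤ N, ∀ t, ‖iteratedFDeriv ℝ q b t‖ ≤ Λ * (1 + ‖t‖) ^ 2) →
    ∀ η : Fin d → ℂ, ‖∫ t, Complex.exp (-2 * I * (herm t η).im) *
        ((Real.exp (-sqNorm t) : ℂ) * b t)‖ ≤ C * Λ * ((1 + ‖η‖) ^ N)⁻¹ := by
  obtain ⟨Cg, hCg, hg⟩ := exists_iteratedFDeriv_gaussian_le (d := d) N (2 * d + 1 + 2)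
  set A : ℝ := ∫ t : Fin d → ℂ, ((1 + ‖t‖) ^ (2 * d + 1))⁻¹ with hA
  have hA0 : 0 ≤ A := integral_nonneg fun t => by positivity
  set C₁ : ℝ := (N + 1) * (2 ^ N * Cg * A) with hC₁
  have hC₁0 : 0 ≤ C₁ := by positivity
  refine ⟨2 ^ (N - 1) * (1 + (2 * Real.pi) ^ N) * C₁ + 1, by positivity, ?_⟩
  intro Λ b hb hbΛ η
  have hΛ : 0 ≤ Λ := by
    have := (norm_nonneg _).trans (hbΛ 0 (Nat.zero_le _) 0)
    simpa using this
  set f : (Fin d → ℂ) → ℂ := fun t => Real.exp (-sqNorm t) • b t with hf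
  have hfc : ContDiff ℝ ∞ f := contDiff_exp_neg_sqNorm.smul hb
  have hfq : ∀ q ≤ N, ∀ t, ‖iteratedFDeriv ℝ q f t‖ ≤
      2 ^ N * Cg * Λ * ((1 + ‖t‖) ^ (2 * d + 1))⁻¹ := by
    intro q hq t
    have h1 := norm_iteratedFDeriv_smul_le contDiff_exp_neg_sqNorm hb t (n := q)
      (mod_cast le_top)
    refine h1.trans ?_
    have hpos : (0 : ℝ) < 1 + ‖t‖ := by positivity
    calc _ ≤ ∑ i ∈ Finset.range (q + 1), (q.choose i : ℝ) *
            (Cg * Λ * ((1 + ‖t‖) ^ (2 * d + 1))⁻¹) := by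
          refine Finset.sum_le_sum fun i hi => ?_
          rw [mul_assoc]
          have hi' : i ≤ N := (Finset.mem_range_succ_iff.1 hi).trans hq
          calc _ ≤ (q.choose i : ℝ) * ((Cg * ((1 + ‖t‖) ^ (2 * d + 1 + 2))⁻¹) *
                (Λ * (1 + ‖t‖) ^ 2)) := by
                gcongr
                · exact hg i hi' t
                · exact hbΛ _ ((Nat.sub_le _ _).trans hq) t
            _ = _ := by
                rw [pow_add]
                field_simp
      _ = 2 ^ q * (Cg * Λ * ((1 + ‖t‖) ^ (2 * d + 1))⁻¹) := by
          rw [← Finset.sum_mul, ← Nat.cast_sum, Nat.sum_range_choose]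
          push_cast
          ring
      _ ≤ 2 ^ N * (Cg * Λ * ((1 + ‖t‖) ^ (2 * d + 1))⁻¹) := by
          gcongr
          norm_num
      _ = _ := by ring
  have hint : ∀ q ≤ N, Integrable (fun t => ‖iteratedFDeriv ℝ q f t‖) := by
    intro q hq
    refine (integrable_inv_one_add_norm_pow.const_mul (2 ^ N * Cg * Λ)).mono' ?_
      (Eventually.of_forall fun t => by simpa using hfq q hq t)
    exact (hfc.continuous_iteratedFDeriv (mod_cast le_top)).norm.aestronglyMeasurable
  have hsum : ∀ n ≤ N, ∑ q ∈ Finset.range (n + 1), ∫ t, ‖iteratedFDeriv ℝ q f t‖ ≤ C₁ * Λ := by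
    intro n hn
    calc _ ≤ ∑ q ∈ Finset.range (n + 1), 2 ^ N * Cg * Λ * A := by
          refine Finset.sum_le_sum fun q hq => ?_
          have hq' : q ≤ N := (Finset.mem_range_succ_iff.1 hq).trans hn
          rw [hA, ← integral_const_mul]
          exact integral_mono (hint q hq') (integrable_inv_one_add_norm_pow.const_mul _)
            (hfq q hq')
      _ = (n + 1) * (2 ^ N * Cg * A) * Λ := by
          rw [Finset.sum_const, Finset.card_range, nsmul_eq_mul]; push_cast; ring
      _ ≤ C₁ * Λ := by
          rw [hC₁]
          gcongr
  set F := ∫ t, Complex.exp (-2 * I * (herm t η).im) * ((Real.exp (-sqNorm t) : ℂ) * b t) with hF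
  have hFeq : VectorFourier.fourierIntegral Real.fourierChar volume
      (ContinuousLinearMap.toLinearMap₁₂ (symplecticForm d)) f η = F := by
    rw [VectorFourier.fourierIntegral, hF]
    congr 1
    funext t
    change Real.fourierChar (-(symplecticForm d t η)) • f t = _
    rw [Circle.smul_def, Real.fourierChar_apply, symplecticForm_apply, smul_eq_mul, hf]
    beta_reduce
    rw [Complex.real_smul]
    congr 2
    have := Real.pi_ne_zero
    have e : 2 * Real.pi * -((herm t η).im / Real.pi) = -2 * (herm t η).im := by field_simp
    rw [e]
    push_cast
    ring
  have hmain : ∀ n ≤ N, ‖η‖ ^ n * ‖F‖ ≤ (2 * Real.pi) ^ n * (C₁ * Λ) := by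
    intro n hn
    rcases eq_or_ne η 0 with h0 | h0
    · rcases Nat.eq_zero_or_pos n with rfl | hn0
      · have h1 := VectorFourier.pow_mul_norm_iteratedFDeriv_fourierIntegral_le (symplecticForm d)
          (μ := volume) (K := 0) (N := N) (hfc.of_le (mod_cast le_top)) (fun k q hk hq => by
            have hk0 : k = 0 := by simpa using hk
            simpa [hk0] using hint q (by exact_mod_cast hq)) (k := 0) (n := 0) le_rfl
            (by simp) (0 : Fin d → ℂ) η
        rw [norm_iteratedFDeriv_zero, hFeq] at h1
        have h2 := hsum 0 hn
        simp only [pow_zero, one_mul, zero_add, Finset.range_one, Finset.singleton_product_singleton,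
          Finset.sum_singleton] at h1 h2 ⊢
        exact h1.trans h2
      · rw [h0, norm_zero, zero_pow hn0.ne', zero_mul]
        positivity
    · have hη : 0 < ‖η‖ := norm_pos_iff.2 h0
      have h1 := VectorFourier.pow_mul_norm_iteratedFDeriv_fourierIntegral_le (symplecticForm d)
          (μ := volume) (K := 0) (N := N) (hfc.of_le (mod_cast le_top)) (fun k q hk hq => by
            have hk0 : k = 0 := by simpa using hk
            simpa [hk0] using hint q (by exact_mod_cast hq)) (k := 0) (n := n) le_rfl
            (by exact_mod_cast hn) (I • η) η
      rw [norm_iteratedFDeriv_zero, hFeq] at h1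
      have h3 : symplecticForm d (I • η) η = sqNorm η / Real.pi := by
        rw [symplecticForm_apply]
        have : herm (I • η) η = I * herm η η := by simp [herm, Finset.mul_sum, mul_assoc]
        rw [this, herm_self]
        simp
      have h4 : ‖η‖ ^ 2 / Real.pi ≤ |symplecticForm d (I • η) η| := by
        rw [h3]
        refine le_trans ?_ (le_abs_self _)
        have := Real.pi_pos
        gcongr
        exact norm_sq_le_sqNorm η
      have h5 : (‖η‖ ^ 2 / Real.pi) ^ n * ‖F‖ ≤ ‖η‖ ^ n * (2 ^ n * (C₁ * Λ)) := by
        calc _ ≤ |symplecticForm d (I • η) η| ^ n * ‖F‖ := by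
              have := Real.pi_pos
              gcongr
          _ ≤ _ := h1
          _ ≤ _ := by
              have h2 := hsum n hn
              simp only [pow_zero, mul_one, zero_add, Finset.range_one, Nat.cast_zero, mul_zero,
                one_mul, Finset.singleton_product, Finset.sum_map, Function.Embedding.coeFn_mk,
                norm_smul, Complex.norm_I]
              rw [mul_assoc]
              gcongr
      have hpi := Real.pi_pos
      rw [div_pow, pow_two, mul_pow, div_mul_eq_mul_div, div_le_iff₀ (by positivity)] at h5
      have h6 : ‖η‖ ^ n * (‖η‖ ^ n * ‖F‖) ≤ ‖η‖ ^ n * ((2 * Real.pi) ^ n * (C₁ * Λ)) := by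
        rw [mul_pow]
        linarith
      exact le_of_mul_le_mul_left h6 (by positivity)
  have h0 := hmain 0 (Nat.zero_le _)
  have hN := hmain N le_rfl
  rw [← div_eq_mul_inv, le_div_iff₀ (by positivity)]
  have h7 : (1 + ‖η‖) ^ N ≤ 2 ^ (N - 1) * (1 ^ N + ‖η‖ ^ N) :=
    add_pow_le zero_le_one (norm_nonneg η) N
  calc ‖F‖ * (1 + ‖η‖) ^ N ≤ ‖F‖ * (2 ^ (N - 1) * (1 ^ N + ‖η‖ ^ N)) := by gcongr
    _ = 2 ^ (N - 1) * (‖η‖ ^ 0 * ‖F‖ + ‖η‖ ^ N * ‖F‖) := by simp; ring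
    _ ≤ 2 ^ (N - 1) * ((2 * Real.pi) ^ 0 * (C₁ * Λ) + (2 * Real.pi) ^ N * (C₁ * Λ)) := by gcongr
    _ = 2 ^ (N - 1) * (1 + (2 * Real.pi) ^ N) * C₁ * Λ := by ring
    _ ≤ _ := by nlinarith

/-! ### The kernel of the Weyl quantization -/

/-- The complex Gaussian average `(πh)^{-d} ∫ Q(m) exp (-(m - x)·conj(m - w)/h) dL(m)`. Multiplied
by the coherent state `coherent h x w`, it is the Weyl quantization of `Q` applied to the coherent
state centred at `w`. -/
def weylAverage (h : ℝ) (Q : (Fin d → ℂ) → ℂ) (x w : Fin d → ℂ) : ℂ :=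
  (((Real.pi * h) ^ d)⁻¹ : ℝ) * ∫ m, Q m * Complex.exp (-(1 / h) * herm (m - x) (m - w))

theorem continuous_herm {X : Type*} [TopologicalSpace X] {f g : X → Fin d → ℂ}
    (hf : Continuous f) (hg : Continuous g) : Continuous fun a => herm (f a) (g a) := by
  unfold herm
  fun_prop

theorem differentiable_herm_left (f : (Fin d → ℂ) → Fin d → ℂ) (hf : Differentiable ℂ f)
    (y : Fin d → ℂ) : Differentiable ℂ fun x => herm (f x) y := by
  unfold herm
  fun_prop

theorem conj_herm (x y : Fin d → ℂ) : conj (herm x y) = herm y x := by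
  simp [herm, mul_comm]

/-- The phase of `weylAverage` has its real part centred at the midpoint of `x` and `w`; the
constant `|x - w|² / 4` cancels against the decay of the coherent state. -/
theorem re_herm_eq (m x w : Fin d → ℂ) :
    (herm (m - x) (m - w)).re =
      sqNorm (m - (1 / 2 : ℝ) • (x + w)) - sqNorm (x - w) / 4 := by
  simp only [herm, sqNorm, Complex.re_sum, Finset.sum_div, ← Finset.sum_sub_distrib]
  refine Finset.sum_congr rfl fun j _ => ?_
  rw [← Complex.normSq_eq_norm_sq, ← Complex.normSq_eq_norm_sq, Complex.normSq_apply,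
    Complex.normSq_apply]
  simp
  ring

theorem norm_exp_herm_le {h : ℝ} (hh : 0 < h) (m x w : Fin d → ℂ) :
    ‖Complex.exp (-(1 / h) * herm (m - x) (m - w))‖ ≤
      Real.exp ((1 / (2 * h)) * sqNorm (x - w)) * Real.exp (-(1 / (2 * h)) * sqNorm (m - w)) := by
  rw [Complex.norm_exp, ← Real.exp_add, Real.exp_le_exp]
  have e : (-(1 / (h : ℂ))) = ((-(1 / h) : ℝ) : ℂ) := by push_cast; ring
  have e2 : ∀ a b c : ℝ, 1 / (2 * h) * a + -(1 / (2 * h)) * b - (-(1 / h) * c) =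
      (1 / (2 * h)) * (a - b + 2 * c) := by
    intro a b c; field_simp; ring
  rw [e, Complex.re_ofReal_mul, ← sub_nonneg, e2]
  refine mul_nonneg (by positivity) ?_
  have : sqNorm (x - w) - sqNorm (m - w) + 2 * (herm (m - x) (m - w)).re =
      sqNorm (m - w - (x - w)) := by
    simp only [herm, sqNorm, Complex.re_sum, Finset.mul_sum, ← Finset.sum_sub_distrib,
      ← Finset.sum_add_distrib]
    refine Finset.sum_congr rfl fun j _ => ?_
    simp only [← Complex.normSq_eq_norm_sq, Complex.normSq_apply]
    simp
    ring
  rw [this]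
  exact sqNorm_nonneg _

theorem integrable_one_add_norm_pow_mul_gaussian (k : ℕ) {a : ℝ} (ha : 0 < a) (c : Fin d → ℂ) :
    Integrable fun m : Fin d → ℂ => (1 + ‖m‖) ^ k * Real.exp (-a * sqNorm (m - c)) := by
  obtain ⟨C, hC, hb⟩ := exists_one_add_norm_pow_mul_exp_neg_sqNorm_le (d := d) k (half_pos ha)
  have h1 : Integrable fun m : Fin d → ℂ => (1 + ‖c‖) ^ k * C *
      Real.exp (-(a / 2) * sqNorm (m - c)) :=
    ((integrable_exp_neg_sqNorm (half_pos ha)).comp_sub_right c).const_mul _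
  refine h1.mono' ?_ (Eventually.of_forall fun m => ?_)
  · have := continuous_sqNorm (d := d)
    exact (by fun_prop : Continuous fun m : Fin d → ℂ =>
      (1 + ‖m‖) ^ k * Real.exp (-a * sqNorm (m - c))).aestronglyMeasurable
  · rw [Real.norm_of_nonneg (by positivity)]
    have h2 : 1 + ‖m‖ ≤ (1 + ‖c‖) * (1 + ‖m - c‖) := by
      have : ‖m‖ ≤ ‖m - c‖ + ‖c‖ := by simpa using norm_add_le (m - c) c
      nlinarith [norm_nonneg (m - c), norm_nonneg c]
    have h3 : Real.exp (-a * sqNorm (m - c)) =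
        Real.exp (-(a / 2) * sqNorm (m - c)) * Real.exp (-(a / 2) * sqNorm (m - c)) := by
      rw [← Real.exp_add]; ring_nf
    calc (1 + ‖m‖) ^ k * Real.exp (-a * sqNorm (m - c))
        ≤ ((1 + ‖c‖) * (1 + ‖m - c‖)) ^ k * Real.exp (-a * sqNorm (m - c)) := by gcongr
      _ = (1 + ‖c‖) ^ k * ((1 + ‖m - c‖) ^ k * Real.exp (-(a / 2) * sqNorm (m - c))) *
          Real.exp (-(a / 2) * sqNorm (m - c)) := by rw [h3, mul_pow]; ring
      _ ≤ (1 + ‖c‖) ^ k * C * Real.exp (-(a / 2) * sqNorm (m - c)) := by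
          have := hb (m - c)
          gcongr

theorem integrable_mul_exp_herm {h : ℝ} (hh : 0 < h) {Q : (Fin d → ℂ) → ℂ} (hQ : Continuous Q)
    {C : ℝ} {k : ℕ} (hQb : ∀ m, ‖Q m‖ ≤ C * (1 + ‖m‖) ^ k) (x w : Fin d → ℂ) :
    Integrable fun m => Q m * Complex.exp (-(1 / h) * herm (m - x) (m - w)) := by
  have h1 := (integrable_one_add_norm_pow_mul_gaussian k (a := 1 / (2 * h)) (by positivity)
    w).const_mul (C * Real.exp ((1 / (2 * h)) * sqNorm (x - w)))
  refine h1.mono' ?_ (Eventually.of_forall fun m => ?_)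
  · have := continuous_herm (d := d) (f := fun m => m - x) (g := fun m => m - w)
      (by fun_prop) (by fun_prop)
    exact (by fun_prop : Continuous fun m => Q m * Complex.exp
      (-(1 / h) * herm (m - x) (m - w))).aestronglyMeasurable
  · rw [norm_mul]
    calc _ ≤ (C * (1 + ‖m‖) ^ k) * (Real.exp ((1 / (2 * h)) * sqNorm (x - w)) *
          Real.exp (-(1 / (2 * h)) * sqNorm (m - w))) :=
          mul_le_mul (hQb m) (norm_exp_herm_le hh m x w) (norm_nonneg _)
            ((norm_nonneg _).trans (hQb m))
      _ = _ := by ring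

theorem weylAverage_const {h : ℝ} (hh : 0 < h) (c : ℂ) (x w : Fin d → ℂ) :
    weylAverage h (fun _ => c) x w = c := by
  have e : ∀ m : Fin d → ℂ, c * Complex.exp (-(1 / h) * herm (m - x) (m - w)) =
      (c * Complex.exp (-(1 / h) * herm (m - x) (x - w))) *
        (Real.exp (-(1 / h) * sqNorm (m - x)) : ℂ) := by
    intro m
    rw [mul_assoc, Complex.ofReal_exp, ← Complex.exp_add, Complex.ofReal_mul, ← herm_self]
    congr 2
    push_cast
    rw [← mul_add]
    congr 1
    simp only [herm, ← Finset.sum_add_distrib]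
    refine Finset.sum_congr rfl fun j _ => ?_
    simp
    ring
  have hint := integrable_mul_exp_herm hh (Q := fun _ => c) continuous_const (C := ‖c‖) (k := 0)
    (fun m => by simp) x w
  simp_rw [weylAverage]
  simp_rw [e] at hint ⊢
  rw [integral_mul_gaussian (by positivity) _ x hint]
  · have : (Real.pi * h) ^ d ≠ 0 := by have := Real.pi_pos; positivity
    have e2 : Real.pi / (1 / h) = Real.pi * h := by field_simp
    rw [e2, sub_self]
    simp only [herm, Pi.zero_apply, zero_mul, Finset.sum_const_zero, mul_zero, Complex.exp_zero,
      mul_one]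
    rw [← mul_assoc, ← Complex.ofReal_pow, ← Complex.ofReal_mul, inv_mul_cancel₀ this]
    simp
  · have := differentiable_herm_left (d := d) (fun m => m - x) (by fun_prop) (x - w)
    fun_prop

/-- Seen from `x`, the weight is a centred Gaussian times a holomorphic function of `m`, so that a
holomorphic factor vanishing at `x` averages to zero. -/
theorem weylAverage_coord {h : ℝ} (hh : 0 < h) (j : Fin d) (x w : Fin d → ℂ) :
    weylAverage h (fun m => m j - x j) x w = 0 := by
  have e : ∀ m : Fin d → ℂ, (m j - x j) * Complex.exp (-(1 / h) * herm (m - x) (m - w)) =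
      ((m j - x j) * Complex.exp (-(1 / h) * herm (m - x) (x - w))) *
        (Real.exp (-(1 / h) * sqNorm (m - x)) : ℂ) := by
    intro m
    rw [mul_assoc, Complex.ofReal_exp, ← Complex.exp_add, Complex.ofReal_mul, ← herm_self]
    congr 2
    push_cast
    rw [← mul_add]
    congr 1
    simp only [herm, ← Finset.sum_add_distrib]
    refine Finset.sum_congr rfl fun j _ => ?_
    simp
    ring
  have hint := integrable_mul_exp_herm hh (Q := fun m => m j - x j) (by fun_prop)
    (C := 1 + ‖x j‖) (k := 1) (fun m => by
      have h1 := norm_sub_le (m j) (x j)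
      have h2 := norm_le_pi_norm m j
      nlinarith [norm_nonneg (x j), norm_nonneg m]) x w
  simp_rw [weylAverage]
  simp_rw [e] at hint ⊢
  rw [integral_mul_gaussian (by positivity) _ x hint]
  · simp
  · have := differentiable_herm_left (d := d) (fun m => m - x) (by fun_prop) (x - w)
    fun_prop

/-- Seen from `w`, the weight is a centred Gaussian times an antiholomorphic function of `m`, so
that an antiholomorphic factor is replaced by its value at `w`. -/
theorem weylAverage_conj_coord {h : ℝ} (hh : 0 < h) (j : Fin d) (x w : Fin d → ℂ) :
    weylAverage h (fun m => conj (m j - x j)) x w = conj (w j - x j) := by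
  have e : ∀ m : Fin d → ℂ, conj (m j - x j) * Complex.exp (-(1 / h) * herm (m - x) (m - w)) =
      conj ((m j - x j) * Complex.exp (-(1 / h) * herm (m - w) (w - x))) *
        (Real.exp (-(1 / h) * sqNorm (m - w)) : ℂ) := by
    intro m
    rw [map_mul, mul_assoc, Complex.ofReal_exp, ← Complex.exp_conj, ← Complex.exp_add,
      Complex.ofReal_mul, ← herm_self, map_mul, conj_herm]
    congr 2
    simp only [map_neg, map_div₀, map_one, Complex.conj_ofReal]
    push_cast
    rw [← mul_add]
    congr 1
    simp only [herm, ← Finset.sum_add_distrib]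
    refine Finset.sum_congr rfl fun j _ => ?_
    simp
    ring
  have hint := integrable_mul_exp_herm hh (Q := fun m => conj (m j - x j)) (by fun_prop)
    (C := 1 + ‖x j‖) (k := 1) (fun m => by
      rw [RCLike.norm_conj]
      have h1 := norm_sub_le (m j) (x j)
      have h2 := norm_le_pi_norm m j
      nlinarith [norm_nonneg (x j), norm_nonneg m]) x w
  simp_rw [weylAverage]
  simp_rw [e] at hint ⊢
  rw [integral_conj_mul_gaussian (by positivity) _ w hint]
  · have : (Real.pi * h) ^ d ≠ 0 := by have := Real.pi_pos; positivity
    have e2 : Real.pi / (1 / h) = Real.pi * h := by field_simp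
    rw [e2, sub_self]
    simp only [herm, Pi.zero_apply, zero_mul, Finset.sum_const_zero, mul_zero, Complex.exp_zero,
      mul_one]
    rw [← mul_assoc, ← Complex.ofReal_pow, ← Complex.ofReal_mul, inv_mul_cancel₀ this]
    simp
  · have := differentiable_herm_left (d := d) (fun m => m - w) (by fun_prop) (w - x)
    fun_prop

theorem measurable_weylAverage (h : ℝ) {Q : (Fin d → ℂ) → ℂ} (hQ : Continuous Q) :
    StronglyMeasurable fun a : (Fin d → ℂ) × (Fin d → ℂ) => weylAverage h Q a.1 a.2 := by
  have h1 : StronglyMeasurable fun b : ((Fin d → ℂ) × (Fin d → ℂ)) × (Fin d → ℂ) =>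
      Q b.2 * Complex.exp (-(1 / h) * herm (b.2 - b.1.1) (b.2 - b.1.2)) := by
    refine Continuous.stronglyMeasurable ?_
    have := continuous_herm (d := d)
      (f := fun b : ((Fin d → ℂ) × (Fin d → ℂ)) × (Fin d → ℂ) => b.2 - b.1.1)
      (g := fun b => b.2 - b.1.2) (by fun_prop) (by fun_prop)
    fun_prop
  exact h1.integral_prod_right'.const_mul _

theorem differentiable_weylAverage {h : ℝ} (hh : 0 < h) {Q : (Fin d → ℂ) → ℂ} (hQ : Continuous Q)
    {M : ℝ} (hQb : ∀ m, ‖Q m‖ ≤ M) (w : Fin d → ℂ) :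
    Differentiable ℂ fun x => weylAverage h Q x w := by
  refine Differentiable.const_mul ?_ _
  refine differentiable_integral_of_dominated (fun x => ?_) (fun m => ?_) fun x₀ => ?_
  · exact (integrable_mul_exp_herm hh hQ (C := M) (k := 0) (fun m => by simpa using hQb m)
      x w).aestronglyMeasurable
  · have := differentiable_herm_left (d := d) (fun x => m - x) (by fun_prop) (m - w)
    fun_prop
  · have hM : 0 ≤ M := (norm_nonneg _).trans (hQb 0)
    refine ⟨fun m => M * Real.exp ((1 / (2 * h)) * (d * (‖x₀ - w‖ + 3) ^ 2)) *
      Real.exp (-(1 / (2 * h)) * sqNorm (m - w)), ?_, fun x hx m => ?_⟩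
    · exact ((integrable_exp_neg_sqNorm (by positivity)).comp_sub_right w).const_mul _
    · beta_reduce
      rw [norm_mul, mul_assoc]
      refine mul_le_mul (hQb m) ((norm_exp_herm_le hh m x w).trans ?_) (norm_nonneg _) hM
      gcongr
      refine (sqNorm_le _).trans ?_
      gcongr
      rw [mem_ball_iff_norm] at hx
      have : x - w = (x - x₀) + (x₀ - w) := by abel
      rw [this]
      linarith [norm_add_le (x - x₀) (x₀ - w)]

theorem integral_comp_affine {h : ℝ} (hh : 0 < h) (c : Fin d → ℂ) (f : (Fin d → ℂ) → ℂ) :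
    ∫ m, f m = (h : ℂ) ^ d * ∫ t, f (c + Real.sqrt h • t) := by
  have h1 := Measure.integral_comp_smul_of_nonneg (volume : Measure (Fin d → ℂ))
    (fun t => f (c + t)) (Real.sqrt h) (hR := Real.sqrt_nonneg h)
  rw [h1, finrank_real_pi_complex, pow_mul, Real.sq_sqrt hh.le, integral_add_left_eq_self f c,
    Complex.real_smul, ← mul_assoc]
  have : (h : ℂ) ^ d ≠ 0 := pow_ne_zero _ (by exact_mod_cast hh.ne')
  push_cast
  rw [mul_inv_cancel₀ this, one_mul]

/-- Centred at the midpoint of `x` and `w` and rescaled by `√h`, the average is a Fourier integral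
against a Gaussian, at the frequency `(x - w) / (2√h)`. -/
theorem weylAverage_eq_fourier {h : ℝ} (hh : 0 < h) (Q : (Fin d → ℂ) → ℂ) (x w : Fin d → ℂ) :
    weylAverage h Q x w = ((Real.pi ^ d)⁻¹ * Real.exp ((1 / (4 * h)) * sqNorm (x - w)) : ℝ) *
      ∫ t, Complex.exp (-2 * I * (herm t ((2 * Real.sqrt h)⁻¹ • (x - w))).im) *
        ((Real.exp (-sqNorm t) : ℂ) * Q ((1 / 2 : ℝ) • (x + w) + Real.sqrt h • t)) := by
  have hs : Real.sqrt h ≠ 0 := (Real.sqrt_pos.2 hh).ne'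
  have hs2 : (Real.sqrt h) * Real.sqrt h = h := Real.mul_self_sqrt hh.le
  have hs2' : ((Real.sqrt h : ℝ) : ℂ) ^ 2 = h := by rw [pow_two]; exact_mod_cast hs2
  rw [weylAverage, integral_comp_affine hh ((1 / 2 : ℝ) • (x + w))]
  have hh' : (h : ℂ) ≠ 0 := by exact_mod_cast hh.ne'
  have e : ∀ t : Fin d → ℂ, Q ((1 / 2 : ℝ) • (x + w) + Real.sqrt h • t) *
      Complex.exp (-(1 / h) * herm ((1 / 2 : ℝ) • (x + w) + Real.sqrt h • t - x)
        ((1 / 2 : ℝ) • (x + w) + Real.sqrt h • t - w)) =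
      (Real.exp ((1 / (4 * h)) * sqNorm (x - w)) : ℂ) *
      (Complex.exp (-2 * I * (herm t ((2 * Real.sqrt h)⁻¹ • (x - w))).im) *
        ((Real.exp (-sqNorm t) : ℂ) * Q ((1 / 2 : ℝ) • (x + w) + Real.sqrt h • t))) := by
    intro t
    rw [mul_comm (Q _), ← mul_assoc, ← mul_assoc]
    congr 1
    rw [Complex.ofReal_exp, Complex.ofReal_exp, ← Complex.exp_add, ← Complex.exp_add]
    congr 1
    have h1 : -2 * I * ((herm t ((2 * Real.sqrt h)⁻¹ • (x - w))).im : ℂ) =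
        herm ((2 * Real.sqrt h)⁻¹ • (x - w)) t - herm t ((2 * Real.sqrt h)⁻¹ • (x - w)) := by
      have h2 := Complex.sub_conj (herm t ((2 * Real.sqrt h)⁻¹ • (x - w)))
      rw [← conj_herm t]
      push_cast at h2
      linear_combination h2
    rw [h1]
    push_cast
    rw [← herm_self, ← herm_self]
    simp only [herm, Finset.mul_sum, ← Finset.sum_sub_distrib, ← Finset.sum_neg_distrib,
      ← Finset.sum_add_distrib]
    refine Finset.sum_congr rfl fun j _ => ?_
    simp only [Pi.add_apply, Pi.sub_apply, Pi.smul_apply, Complex.real_smul, map_sub, map_add,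
      map_mul, Complex.conj_ofReal]
    have hsc : ((Real.sqrt h : ℝ) : ℂ) ≠ 0 := by exact_mod_cast hs
    rw [← hs2']
    push_cast
    field_simp
    ring
  simp_rw [e]
  rw [integral_const_mul]
  push_cast
  rw [mul_pow, mul_inv]
  have hh2 : (h : ℂ) ^ d ≠ 0 := pow_ne_zero _ hh'
  field_simp

/-- Off-diagonal decay of the kernel. -/
theorem exists_norm_kernel_le (N : ℕ) : ∃ C : ℝ, 0 < C ∧ ∀ h : ℝ, 0 < h →
    ∀ (x w : Fin d → ℂ) (Λ : ℝ) (Q : (Fin d → ℂ) → ℂ), ContDiff ℝ ∞ Q →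
    (∀ q ≤ N, ∀ t, ‖iteratedFDeriv ℝ q
      (fun t => Q ((1 / 2 : ℝ) • (x + w) + Real.sqrt h • t)) t‖ ≤ Λ * (1 + ‖t‖) ^ 2) →
    ‖coherent h x w * weylAverage h Q x w‖ *
      (Real.exp (-(1 / h) * Phi0 x) * Real.exp (-(1 / h) * Phi0 w)) ≤
      C * Λ * ((1 + ‖(Real.sqrt h)⁻¹ • (x - w)‖) ^ N)⁻¹ := by
  obtain ⟨C, hC, hF⟩ := exists_fourier_gaussian_le (d := d) N
  refine ⟨(Real.pi ^ d)⁻¹ * C * 2 ^ N, by have := Real.pi_pos; positivity, ?_⟩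
  intro h hh x w Λ Q hQ hΛ
  have hs : 0 < Real.sqrt h := Real.sqrt_pos.2 hh
  have hΛ0 : 0 ≤ Λ := by
    have := (norm_nonneg _).trans (hΛ 0 (Nat.zero_le _) 0)
    simpa using this
  have h1 := hF Λ (fun t => Q ((1 / 2 : ℝ) • (x + w) + Real.sqrt h • t))
    (hQ.comp (by fun_prop)) hΛ ((2 * Real.sqrt h)⁻¹ • (x - w))
  rw [norm_mul, weylAverage_eq_fourier hh, norm_mul, Complex.norm_real,
    Real.norm_of_nonneg (by have := Real.pi_pos; positivity)]
  set J := ‖∫ t, Complex.exp (-2 * I * (herm t ((2 * Real.sqrt h)⁻¹ • (x - w))).im) *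
        ((Real.exp (-sqNorm t) : ℂ) * Q ((1 / 2 : ℝ) • (x + w) + Real.sqrt h • t))‖ with hJ
  have h2 := norm_coherent h x w
  have h3 : Real.exp (-(1 / (4 * h)) * sqNorm (x - w)) *
      Real.exp ((1 / (4 * h)) * sqNorm (x - w)) = 1 := by
    rw [← Real.exp_add]; simp
  have hpi := Real.pi_pos
  have h4 : ((1 + ‖(2 * Real.sqrt h)⁻¹ • (x - w)‖) ^ N)⁻¹ ≤
      2 ^ N * ((1 + ‖(Real.sqrt h)⁻¹ • (x - w)‖) ^ N)⁻¹ := by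
    rw [← inv_pow, ← inv_pow, ← mul_pow]
    refine pow_le_pow_left₀ (by positivity) ?_ N
    rw [← div_eq_mul_inv, inv_eq_one_div, div_le_div_iff₀ (by positivity) (by positivity)]
    have h5 : ‖(2 * Real.sqrt h)⁻¹ • (x - w)‖ = 1 / 2 * ‖(Real.sqrt h)⁻¹ • (x - w)‖ := by
      rw [mul_inv, mul_smul, norm_smul]
      norm_num
    rw [h5]
    linarith
  calc _ = (‖coherent h x w‖ *
          (Real.exp (-(1 / h) * Phi0 x) * Real.exp (-(1 / h) * Phi0 w))) *
          Real.exp ((1 / (4 * h)) * sqNorm (x - w)) * ((Real.pi ^ d)⁻¹ * J) := by ring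
    _ = (Real.pi ^ d)⁻¹ * J := by rw [h2, h3, one_mul]
    _ ≤ (Real.pi ^ d)⁻¹ * (C * Λ * (2 ^ N * ((1 + ‖(Real.sqrt h)⁻¹ • (x - w)‖) ^ N)⁻¹)) := by
        refine mul_le_mul_of_nonneg_left (h1.trans ?_) (by positivity)
        gcongr
    _ = _ := by ring

/-! ### Symbols and their Taylor expansion -/

/-- The symbol class `S(1)` on `ℂ^d ≅ ℝ^{2d}`. -/
structure IsBoundedSymbol (P : (Fin d → ℂ) → ℂ) : Prop where
  smooth : ContDiff ℝ ∞ P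
  bounded : ∀ k : ℕ, ∃ M : ℝ, ∀ x, ‖iteratedFDeriv ℝ k P x‖ ≤ M

/-- The projection `x ↦ (Re x, - Im x)` of `Λ_{Φ₀}`, parametrized by `x ∈ ℂ^d`, to phase space. -/
def toPhase (d : ℕ) : (Fin d → ℂ) →L[ℝ] PhaseSpace d :=
  LinearMap.toContinuousLinearMap
    { toFun := fun x => (fun j => (x j).re, fun j => -(x j).im)
      map_add' := fun x y => by
        refine Prod.ext ?_ ?_ <;> funext j <;> simp
        ring
      map_smul' := fun r x => by
        refine Prod.ext ?_ ?_ <;> funext j <;> simp }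

theorem toPhase_apply (x : Fin d → ℂ) :
    toPhase d x = (fun j => (x j).re, fun j => -(x j).im) := rfl

theorem frakSymbol_xi0 (p : PhaseSpace d → ℂ) (x : Fin d → ℂ) :
    frakSymbol p x (xi0 x) = p (toPhase d x) := by
  rw [frakSymbol, toPhase_apply, kappaTInv]
  congr 1
  refine Prod.ext ?_ ?_ <;> funext j <;> simp [xi0]

theorem norm_toPhase_le (x : Fin d → ℂ) : ‖toPhase d x‖ ≤ ‖x‖ := by
  rw [toPhase_apply, Prod.norm_def]
  refine max_le ?_ ?_ <;> refine (pi_norm_le_iff_of_nonneg (norm_nonneg x)).2 fun j => ?_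
  · exact (Complex.abs_re_le_norm (x j)).trans (norm_le_pi_norm x j)
  · rw [norm_neg]
    exact (Complex.abs_im_le_norm (x j)).trans (norm_le_pi_norm x j)

theorem norm_le_norm_toPhase (x : Fin d → ℂ) : ‖x‖ ≤ 2 * ‖toPhase d x‖ := by
  refine (pi_norm_le_iff_of_nonneg (by positivity)).2 fun j => ?_
  have h1 : |(x j).re| ≤ ‖toPhase d x‖ :=
    (norm_le_pi_norm (toPhase d x).1 j).trans (norm_fst_le _)
  have h2 : |(x j).im| ≤ ‖toPhase d x‖ := by
    have := (norm_le_pi_norm (toPhase d x).2 j).trans (norm_snd_le _)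
    rwa [toPhase_apply, norm_neg, Real.norm_eq_abs] at this
  linarith [Complex.norm_le_abs_re_add_abs_im (x j)]

theorem SymbolHypotheses.isBoundedSymbol {p : PhaseSpace d → ℂ} (hp : SymbolHypotheses p) :
    IsBoundedSymbol fun x => p (toPhase d x) where
  smooth := hp.smooth.comp (toPhase d).contDiff
  bounded k := by
    obtain ⟨M, hM⟩ := hp.bounded k
    have hM0 : 0 ≤ M := (norm_nonneg _).trans (hM 0)
    have h1 : ‖toPhase d‖ ≤ 1 :=
      ContinuousLinearMap.opNorm_le_bound _ zero_le_one fun x => by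
        simpa using norm_toPhase_le x
    refine ⟨M, fun x => ?_⟩
    have h2 := (toPhase d).iteratedFDeriv_comp_right hp.smooth x (i := k) (mod_cast le_top)
    change ‖iteratedFDeriv ℝ k (p ∘ toPhase d) x‖ ≤ M
    rw [h2]
    refine (ContinuousMultilinearMap.norm_compContinuousLinearMap_le _ _).trans ?_
    rw [Finset.prod_const]
    calc _ ≤ M * 1 := by
          gcongr
          · exact hM _
          · exact pow_le_one₀ (norm_nonneg _) h1
      _ = M := mul_one M

theorem norm_iteratedFDeriv_comp_affine {Q : (Fin d → ℂ) → ℂ} (hQ : ContDiff ℝ ∞ Q) (q : ℕ)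
    (c : Fin d → ℂ) {r : ℝ} (hr : 0 ≤ r) (t : Fin d → ℂ) :
    ‖iteratedFDeriv ℝ q (fun t => Q (c + r • t)) t‖ = r ^ q * ‖iteratedFDeriv ℝ q Q (c + r • t)‖ := by
  have h1 : ContDiff ℝ q fun z => Q (c + z) :=
    (hQ.comp (contDiff_const.add contDiff_id)).of_le (mod_cast le_top)
  have h2 := congrFun (iteratedFDeriv_comp_const_smul (f := fun z => Q (c + z)) r h1) t
  rw [h2, norm_smul, iteratedFDeriv_comp_add_left, Real.norm_of_nonneg (by positivity)]

/-- The remainder in the first order Taylor expansion of `P` at `x`. -/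
def taylorRem (P : (Fin d → ℂ) → ℂ) (x m : Fin d → ℂ) : ℂ := P m - P x - fderiv ℝ P x (m - x)

namespace IsBoundedSymbol

variable {P : (Fin d → ℂ) → ℂ} (hP : IsBoundedSymbol P)
include hP

theorem exists_bound (N : ℕ) : ∃ M : ℝ, 0 < M ∧ ∀ k ≤ N, ∀ x, ‖iteratedFDeriv ℝ k P x‖ ≤ M := by
  choose M hM using hP.bounded
  have hM0 : ∀ k, 0 ≤ M k := fun k => (norm_nonneg _).trans (hM k 0)
  refine ⟨∑ k ∈ Finset.range (N + 1), M k + 1, ?_, fun k hk x => (hM k x).trans ?_⟩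
  · have := Finset.sum_nonneg (s := Finset.range (N + 1)) fun k _ => hM0 k
    linarith
  · have := Finset.single_le_sum (f := M) (fun k _ => hM0 k) (Finset.mem_range_succ_iff.2 hk)
    linarith

theorem differentiable : Differentiable ℝ P := hP.smooth.differentiable (by simp)

theorem exists_norm_le : ∃ M : ℝ, 0 < M ∧ ∀ x, ‖P x‖ ≤ M := by
  obtain ⟨M, hM0, hM⟩ := hP.exists_bound 0
  exact ⟨M, hM0, fun x => by simpa using hM 0 le_rfl x⟩

theorem contDiff_fderiv : ContDiff ℝ ∞ (fderiv ℝ P) := hP.smooth.fderiv_right (by simp)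

theorem norm_fderiv_sub_le {M : ℝ} (hM : ∀ x, ‖iteratedFDeriv ℝ 2 P x‖ ≤ M) (x y : Fin d → ℂ) :
    ‖fderiv ℝ P x - fderiv ℝ P y‖ ≤ M * ‖x - y‖ := by
  refine Convex.norm_image_sub_le_of_norm_fderiv_le (𝕜 := ℝ)
    (fun z _ => hP.contDiff_fderiv.differentiable (by simp) z) (fun z _ => ?_) convex_univ
    (Set.mem_univ y) (Set.mem_univ x)
  rw [← norm_iteratedFDeriv_one, norm_iteratedFDeriv_fderiv]
  exact hM z

theorem norm_taylorRem_le {M : ℝ} (hM : ∀ x, ‖iteratedFDeriv ℝ 2 P x‖ ≤ M) (x m : Fin d → ℂ) :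
    ‖taylorRem P x m‖ ≤ M * ‖m - x‖ ^ 2 := by
  have hM0 : 0 ≤ M := (norm_nonneg _).trans (hM x)
  have h1 := Convex.norm_image_sub_le_of_norm_fderiv_le' (𝕜 := ℝ) (f := P)
    (s := Metric.closedBall x ‖m - x‖) (C := M * ‖m - x‖) (φ := fderiv ℝ P x)
    (fun z _ => hP.differentiable z) (fun z hz => ?_) (convex_closedBall x _)
    (Metric.mem_closedBall_self (norm_nonneg _)) (y := m) (by simp [dist_eq_norm])
  · rw [taylorRem]
    refine h1.trans_eq (by ring)
  · refine (hP.norm_fderiv_sub_le hM z x).trans ?_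
    rw [mem_closedBall_iff_norm] at hz
    gcongr

theorem contDiff_taylorRem (x : Fin d → ℂ) : ContDiff ℝ ∞ (taylorRem P x) := by
  unfold taylorRem
  have := hP.smooth
  exact (this.sub contDiff_const).sub
    ((fderiv ℝ P x).contDiff.comp (contDiff_id.sub contDiff_const))

theorem fderiv_taylorRem (x : Fin d → ℂ) :
    fderiv ℝ (taylorRem P x) = fderiv ℝ P - fun _ => fderiv ℝ P x := by
  funext m
  have h1 : HasFDerivAt (taylorRem P x) (fderiv ℝ P m - (fderiv ℝ P x).comp
      (ContinuousLinearMap.id ℝ _)) m :=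
    ((hP.differentiable m).hasFDerivAt.sub_const _).sub
      ((fderiv ℝ P x).hasFDerivAt.comp m ((hasFDerivAt_id m).sub_const x))
  rw [h1.fderiv]
  rfl

theorem norm_iteratedFDeriv_taylorRem_le {M : ℝ} {N : ℕ}
    (hM : ∀ k ≤ N, ∀ x, ‖iteratedFDeriv ℝ k P x‖ ≤ M) (x m : Fin d → ℂ) {q : ℕ} (hq : q + 2 ≤ N) :
    ‖iteratedFDeriv ℝ (q + 2) (taylorRem P x) m‖ ≤ M := by
  rw [← norm_iteratedFDeriv_fderiv, hP.fderiv_taylorRem, iteratedFDeriv_sub_apply,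
    iteratedFDeriv_const_of_ne (Nat.succ_ne_zero q), Pi.zero_apply, sub_zero,
    norm_iteratedFDeriv_fderiv]
  · exact hM _ hq m
  · exact (hP.contDiff_fderiv.of_le (mod_cast le_top)).contDiffAt
  · exact contDiff_const.contDiffAt

/-- The kernel of the Weyl quantization is dominated by `decay`. -/
theorem exists_norm_weyl_kernel_le : ∃ C : ℝ, 0 < C ∧ ∀ h : ℝ, 0 < h → h ≤ 1 →
    ∀ x w : Fin d → ℂ, ‖coherent h x w * weylAverage h P x w‖ *
      (Real.exp (-(1 / h) * Phi0 x) * Real.exp (-(1 / h) * Phi0 w)) ≤ C * decay h (x - w) := by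
  obtain ⟨C, hC, hk⟩ := exists_norm_kernel_le (d := d) (2 * d + 1)
  obtain ⟨M, hM0, hM⟩ := hP.exists_bound (2 * d + 1)
  refine ⟨C * M, by positivity, fun h hh hh1 x w => ?_⟩
  refine hk h hh x w M P hP.smooth fun q hq t => ?_
  rw [norm_iteratedFDeriv_comp_affine hP.smooth q _ (Real.sqrt_nonneg h)]
  have h1 : Real.sqrt h ^ q ≤ 1 := pow_le_one₀ (Real.sqrt_nonneg h) (Real.sqrt_le_one.2 hh1)
  have h2 : (1 : ℝ) ≤ (1 + ‖t‖) ^ 2 := one_le_pow₀ (by linarith [norm_nonneg t])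
  calc _ ≤ 1 * M := by
        gcongr
        exact hM q hq _
    _ ≤ M * (1 + ‖t‖) ^ 2 := by nlinarith

/-- Subtracting the first order Taylor polynomial at `x` gains a factor `h`: the remainder is
quadratic in `m - x`, which is of size `√h` on the support of the Gaussian. -/
theorem exists_norm_remainder_kernel_le : ∃ C : ℝ, 0 < C ∧ ∀ h : ℝ, 0 < h → h ≤ 1 →
    ∀ x w : Fin d → ℂ, ‖coherent h x w * weylAverage h (taylorRem P x) x w‖ *
      (Real.exp (-(1 / h) * Phi0 x) * Real.exp (-(1 / h) * Phi0 w)) ≤ C * h * decay h (x - w) := by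
  obtain ⟨C, hC, hk⟩ := exists_norm_kernel_le (d := d) (2 * d + 1 + 2)
  obtain ⟨M, hM0, hM⟩ := hP.exists_bound (2 * d + 1 + 2)
  have hM2 : ∀ x, ‖iteratedFDeriv ℝ 2 P x‖ ≤ M := hM 2 (by omega)
  refine ⟨C * M, by positivity, fun h hh hh1 x w => ?_⟩
  set s := ‖(Real.sqrt h)⁻¹ • (x - w)‖ with hs
  have hs0 : 0 ≤ s := norm_nonneg _
  have hr : 0 < Real.sqrt h := Real.sqrt_pos.2 hh
  have hr2 : Real.sqrt h ^ 2 = h := Real.sq_sqrt hh.le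
  have h1 := hk h hh x w (M * h * (1 + s) ^ 2) (taylorRem P x) (hP.contDiff_taylorRem x) ?_
  · refine h1.trans_eq ?_
    rw [decay, ← hs, pow_add _ (2 * d + 1) 2]
    field_simp
  · intro q hq t
    rw [norm_iteratedFDeriv_comp_affine (hP.contDiff_taylorRem x) q _ hr.le]
    set m := (1 / 2 : ℝ) • (x + w) + Real.sqrt h • t with hm
    have hmx : ‖m - x‖ ≤ Real.sqrt h * ((1 + s) * (1 + ‖t‖)) := by
      have e : m - x = Real.sqrt h • (t - (1 / 2 : ℝ) • ((Real.sqrt h)⁻¹ • (x - w))) := by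
        rw [smul_sub, smul_comm (Real.sqrt h) (1 / 2 : ℝ), smul_inv_smul₀ hr.ne', hm]
        module
      rw [e, norm_smul, Real.norm_of_nonneg hr.le]
      gcongr
      refine (norm_sub_le _ _).trans ?_
      rw [norm_smul, ← hs]
      norm_num
      nlinarith [norm_nonneg t]
    have hst : 1 ≤ (1 + s) * (1 + ‖t‖) := by nlinarith [norm_nonneg t]
    match q, hq with
    | 0, _ =>
      rw [pow_zero, one_mul, norm_iteratedFDeriv_zero]
      calc _ ≤ M * ‖m - x‖ ^ 2 := hP.norm_taylorRem_le hM2 x m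
        _ ≤ M * (Real.sqrt h * ((1 + s) * (1 + ‖t‖))) ^ 2 := by gcongr
        _ = _ := by rw [mul_pow, hr2]; ring
    | 1, _ =>
      rw [pow_one, norm_iteratedFDeriv_one, hP.fderiv_taylorRem]
      calc _ ≤ Real.sqrt h * (M * ‖m - x‖) := by
            gcongr
            exact hP.norm_fderiv_sub_le hM2 m x
        _ ≤ Real.sqrt h * (M * (Real.sqrt h * ((1 + s) * (1 + ‖t‖)))) := by gcongr
        _ = M * (Real.sqrt h ^ 2) * ((1 + s) * (1 + ‖t‖)) := by ring
        _ ≤ M * h * ((1 + s) * (1 + ‖t‖)) ^ 2 := by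
            rw [hr2]
            gcongr
            exact le_self_pow₀ hst two_ne_zero
        _ = _ := by ring
    | q + 2, hq =>
      have h3 : Real.sqrt h ^ q ≤ 1 := pow_le_one₀ hr.le (Real.sqrt_le_one.2 hh1)
      calc _ ≤ Real.sqrt h ^ (q + 2) * M := by
            gcongr
            exact hP.norm_iteratedFDeriv_taylorRem_le hM x m hq
        _ = Real.sqrt h ^ q * (M * h) := by rw [pow_add, hr2]; ring
        _ ≤ 1 * (M * h) := by gcongr
        _ ≤ M * h * ((1 + s) * (1 + ‖t‖)) ^ 2 := by
            rw [one_mul]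
            exact le_mul_of_one_le_right (by positivity) (one_le_pow₀ hst)
        _ = _ := by ring

end IsBoundedSymbol

/-- The holomorphic derivative `∂P/∂xⱼ`. -/
def dHol (P : (Fin d → ℂ) → ℂ) (j : Fin d) (x : Fin d → ℂ) : ℂ :=
  (1 / 2) * (fderiv ℝ P x (Pi.single j 1) - I * fderiv ℝ P x (Pi.single j I))

/-- The antiholomorphic derivative `∂P/∂x̄ⱼ`. -/
def dBar (P : (Fin d → ℂ) → ℂ) (j : Fin d) (x : Fin d → ℂ) : ℂ :=
  (1 / 2) * (fderiv ℝ P x (Pi.single j 1) + I * fderiv ℝ P x (Pi.single j I))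

theorem fderiv_eq_sum_dHol_add_dBar (P : (Fin d → ℂ) → ℂ) (x s : Fin d → ℂ) :
    fderiv ℝ P x s = ∑ j, (dHol P j x * s j + dBar P j x * conj (s j)) := by
  have h1 : s = ∑ j, ((s j).re • (Pi.single j 1 : Fin d → ℂ) +
      (s j).im • (Pi.single j I : Fin d → ℂ)) := by
    funext i
    rw [Finset.sum_apply, Finset.sum_eq_single i]
    · simp
    · intro j _ hj
      simp [hj.symm]
    · simp
  conv_lhs => rw [h1]
  rw [map_sum]
  refine Finset.sum_congr rfl fun j _ => ?_
  rw [map_add, map_smul, map_smul, dHol, dBar]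
  conv_rhs => rw [← Complex.re_add_im (s j)]
  simp only [Complex.real_smul, map_add, map_mul, Complex.conj_ofReal, Complex.conj_I]
  linear_combination (((s j).im : ℂ) * fderiv ℝ P x (Pi.single j I)) * Complex.I_sq

namespace IsBoundedSymbol

variable {P : (Fin d → ℂ) → ℂ} (hP : IsBoundedSymbol P)
include hP

theorem norm_dBar_sub_le {M : ℝ} (hM : ∀ x, ‖iteratedFDeriv ℝ 2 P x‖ ≤ M) (j : Fin d)
    (x y : Fin d → ℂ) : ‖dBar P j x - dBar P j y‖ ≤ M * ‖x - y‖ := by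
  have h1 := hP.norm_fderiv_sub_le hM x y
  have e : dBar P j x - dBar P j y = (1 / 2) * ((fderiv ℝ P x - fderiv ℝ P y) (Pi.single j 1) +
      I * (fderiv ℝ P x - fderiv ℝ P y) (Pi.single j I)) := by
    simp only [dBar, sub_apply]
    ring
  have h2 := (fderiv ℝ P x - fderiv ℝ P y).le_opNorm (Pi.single j 1)
  have h3 := (fderiv ℝ P x - fderiv ℝ P y).le_opNorm (Pi.single j I)
  rw [Pi.norm_single, norm_one, mul_one] at h2
  rw [Pi.norm_single, Complex.norm_I, mul_one] at h3
  rw [e, norm_mul]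
  have h4 := norm_add_le ((fderiv ℝ P x - fderiv ℝ P y) (Pi.single j 1))
    (I * (fderiv ℝ P x - fderiv ℝ P y) (Pi.single j I))
  rw [norm_mul, Complex.norm_I, one_mul] at h4
  rw [show ‖(1 / 2 : ℂ)‖ = 1 / 2 by norm_num]
  linarith

theorem continuous_dBar (j : Fin d) : Continuous (dBar P j) := by
  have := hP.contDiff_fderiv.continuous
  unfold dBar
  fun_prop

theorem weylAverage_eq {h : ℝ} (hh : 0 < h) (x w : Fin d → ℂ) :
    weylAverage h P x w = P x + ∑ j, dBar P j x * conj (w j - x j) +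
      weylAverage h (taylorRem P x) x w := by
  obtain ⟨M, hM0, hM⟩ := hP.exists_norm_le
  have hPc : Continuous P := hP.smooth.continuous
  have hi0 := integrable_mul_exp_herm hh (Q := fun _ => P x) continuous_const (C := M) (k := 0)
    (fun m => by simpa using hM x) x w
  have hi1 : ∀ j, Integrable fun m => (m j - x j) *
      Complex.exp (-(1 / h) * herm (m - x) (m - w)) := fun j =>
    integrable_mul_exp_herm hh (Q := fun m => m j - x j) (by fun_prop)
    (C := 1 + ‖x j‖) (k := 1) (fun m => by
      have h1 := norm_sub_le (m j) (x j)
      have h2 := norm_le_pi_norm m j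
      nlinarith [norm_nonneg (x j), norm_nonneg m]) x w
  have hi2 : ∀ j, Integrable fun m => conj (m j - x j) *
      Complex.exp (-(1 / h) * herm (m - x) (m - w)) := fun j =>
    integrable_mul_exp_herm hh (Q := fun m => conj (m j - x j)) (by fun_prop)
    (C := 1 + ‖x j‖) (k := 1) (fun m => by
      rw [RCLike.norm_conj]
      have h1 := norm_sub_le (m j) (x j)
      have h2 := norm_le_pi_norm m j
      nlinarith [norm_nonneg (x j), norm_nonneg m]) x w
  have hiP := integrable_mul_exp_herm hh hPc (C := M) (k := 0) (fun m => by simpa using hM m) x w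
  have hi12 : ∀ j, Integrable fun m => dHol P j x * ((m j - x j) *
      Complex.exp (-(1 / h) * herm (m - x) (m - w))) + dBar P j x * (conj (m j - x j) *
      Complex.exp (-(1 / h) * herm (m - x) (m - w))) := fun j =>
    ((hi1 j).const_mul _).add ((hi2 j).const_mul _)
  have hsum : Integrable fun m => ∑ j, (dHol P j x * ((m j - x j) *
      Complex.exp (-(1 / h) * herm (m - x) (m - w))) + dBar P j x * (conj (m j - x j) *
      Complex.exp (-(1 / h) * herm (m - x) (m - w)))) :=
    integrable_finsetSum _ fun j _ => hi12 j
  have e : weylAverage h (taylorRem P x) x w = weylAverage h P x w -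
      weylAverage h (fun _ => P x) x w - ∑ j, (dHol P j x * weylAverage h (fun m => m j - x j) x w +
        dBar P j x * weylAverage h (fun m => conj (m j - x j)) x w) := by
    have e1 : ∀ m, taylorRem P x m * Complex.exp (-(1 / h) * herm (m - x) (m - w)) =
        P m * Complex.exp (-(1 / h) * herm (m - x) (m - w)) -
        P x * Complex.exp (-(1 / h) * herm (m - x) (m - w)) -
        ∑ j, (dHol P j x * ((m j - x j) *
          Complex.exp (-(1 / h) * herm (m - x) (m - w))) + dBar P j x * (conj (m j - x j) *
          Complex.exp (-(1 / h) * herm (m - x) (m - w)))) := by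
      intro m
      rw [taylorRem, fderiv_eq_sum_dHol_add_dBar, sub_mul, sub_mul, Finset.sum_mul]
      congr 1
      refine Finset.sum_congr rfl fun j _ => ?_
      simp only [Pi.sub_apply]
      ring
    have hiPP : Integrable fun m => P m * Complex.exp (-(1 / h) * herm (m - x) (m - w)) -
        P x * Complex.exp (-(1 / h) * herm (m - x) (m - w)) := hiP.sub hi0
    simp only [weylAverage]
    simp_rw [e1]
    rw [integral_sub hiPP hsum, integral_sub hiP hi0, integral_finsetSum _ fun j _ => hi12 j,
      mul_sub, mul_sub, Finset.mul_sum]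
    congr 1
    refine Finset.sum_congr rfl fun j _ => ?_
    rw [integral_add ((hi1 j).const_mul _) ((hi2 j).const_mul _), integral_const_mul,
      integral_const_mul]
    ring
  rw [e, weylAverage_const hh]
  simp_rw [weylAverage_coord hh, weylAverage_conj_coord hh]
  simp

end IsBoundedSymbol

/-! ### Integral operators on weighted spaces -/

/-- The square root `e^{-Φ₀/h}` of the weight. -/
def wt (h : ℝ) (x : Fin d → ℂ) : ℝ := Real.exp (-(1 / h) * Phi0 x)

theorem wt_pos (h : ℝ) (x : Fin d → ℂ) : 0 < wt h x := Real.exp_pos _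

theorem continuous_wt (h : ℝ) : Continuous (wt (d := d) h) := by
  have := continuous_Phi0 (d := d)
  unfold wt
  fun_prop

theorem exp_eq_wt_mul_wt (h : ℝ) (x : Fin d → ℂ) :
    Real.exp (-(2 / h) * Phi0 x) = wt h x * wt h x := by
  rw [wt, ← Real.exp_add]
  ring_nf

/-- The function `u e^{-Φ₀/h}`, which lies in the unweighted space `L²` when `u ∈ L²_{Φ₀}`. -/
def weighted (h : ℝ) (u : (Fin d → ℂ) → ℂ) (x : Fin d → ℂ) : ℂ := u x * (wt h x : ℂ)

theorem norm_weighted (h : ℝ) (u : (Fin d → ℂ) → ℂ) (x : Fin d → ℂ) :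
    ‖weighted h u x‖ = ‖u x‖ * wt h x := by
  rw [weighted, norm_mul, Complex.norm_real, Real.norm_of_nonneg (wt_pos h x).le]

theorem norm_weighted_sq (h : ℝ) (u : (Fin d → ℂ) → ℂ) (x : Fin d → ℂ) :
    ‖weighted h u x‖ ^ 2 = ‖u x‖ ^ 2 * Real.exp (-(2 / h) * Phi0 x) := by
  rw [norm_weighted, exp_eq_wt_mul_wt]
  ring

theorem normPhi_sq (h : ℝ) (u : (Fin d → ℂ) → ℂ) :
    normPhi d h u ^ 2 = ∫ x, ‖weighted h u x‖ ^ 2 := by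
  simp_rw [norm_weighted_sq]
  rw [normPhi, Real.sq_sqrt]
  exact integral_nonneg fun x => by positivity

theorem normPhi_nonneg (h : ℝ) (u : (Fin d → ℂ) → ℂ) : 0 ≤ normPhi d h u := Real.sqrt_nonneg _

theorem aestronglyMeasurable_weighted (h : ℝ) {u : (Fin d → ℂ) → ℂ}
    (hu : AEStronglyMeasurable u) : AEStronglyMeasurable (weighted h u) := by
  have : Continuous fun x : Fin d → ℂ => (wt h x : ℂ) :=
    Complex.continuous_ofReal.comp (continuous_wt h)
  exact hu.mul this.aestronglyMeasurable

theorem mem_HPhi {h : ℝ} {u : (Fin d → ℂ) → ℂ} : u ∈ HPhi d h ↔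
    Differentiable ℂ u ∧ Integrable fun x => ‖weighted h u x‖ ^ 2 := by
  simp_rw [norm_weighted_sq]
  exact Iff.rfl

/-- The integral operator with kernel `T` against the weight `e^{-2Φ₀/h}`, with the normalization of
the Bergman projection. -/
def kernelOp (h : ℝ) (T : (Fin d → ℂ) → (Fin d → ℂ) → ℂ) (u : (Fin d → ℂ) → ℂ)
    (x : Fin d → ℂ) : ℂ :=
  (((2 * Real.pi * h) ^ d)⁻¹ : ℝ) * ∫ w, T x w * (u w * (Real.exp (-(2 / h) * Phi0 w) : ℂ))

/-- The kernel `T` is measurable, and in the weighted spaces it is dominated by `c * decay`. -/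
structure DominatedKernel (h c : ℝ) (T : (Fin d → ℂ) → (Fin d → ℂ) → ℂ) : Prop where
  measurable : StronglyMeasurable fun a : (Fin d → ℂ) × (Fin d → ℂ) => T a.1 a.2
  bound : ∀ x w, ‖T x w‖ * (wt h x * wt h w) ≤ c * decay h (x - w)

/-- The norm of `kernelOp` for the kernel `decay`; it does not depend on `h`. -/
def schurConst (d : ℕ) : ℝ := ((2 * Real.pi) ^ d)⁻¹ * ∫ t, decay (d := d) 1 t

theorem schurConst_pos (d : ℕ) : 0 < schurConst d := by
  have := Real.pi_pos
  have := integral_decay_one_pos (d := d)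
  unfold schurConst
  positivity

theorem mul_integral_decay {h : ℝ} (hh : 0 < h) :
    ((2 * Real.pi * h) ^ d)⁻¹ * ∫ t, decay (d := d) h t = schurConst d := by
  have := Real.pi_pos
  rw [integral_decay hh, schurConst, mul_pow _ h]
  field_simp

namespace DominatedKernel

variable {h c : ℝ} {T : (Fin d → ℂ) → (Fin d → ℂ) → ℂ} (hT : DominatedKernel h c T)
  {u : (Fin d → ℂ) → ℂ}
include hT

theorem norm_mul_le (x w : Fin d → ℂ) :
    ‖T x w * (u w * (Real.exp (-(2 / h) * Phi0 w) : ℂ))‖ ≤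
      (wt h x)⁻¹ * (c * (decay h (x - w) * ‖weighted h u w‖)) := by
  have h1 := hT.bound x w
  have h2 := wt_pos h x
  have h3 := wt_pos h w
  rw [norm_mul, norm_mul, Complex.norm_real, Real.norm_of_nonneg (Real.exp_pos _).le,
    exp_eq_wt_mul_wt, norm_weighted, inv_mul_eq_div, le_div_iff₀ h2]
  calc _ = (‖T x w‖ * (wt h x * wt h w)) * (‖u w‖ * wt h w) := by ring
    _ ≤ (c * decay h (x - w)) * (‖u w‖ * wt h w) := by gcongr
    _ = _ := by ring

theorem integrable (hh : 0 < h) (hu : AEStronglyMeasurable u)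
    (hu2 : Integrable fun x => ‖weighted h u x‖ ^ 2) (x : Fin d → ℂ) :
    Integrable fun w => T x w * (u w * (Real.exp (-(2 / h) * Phi0 w) : ℂ)) := by
  have h1 := integrable_schur (continuous_decay (d := d) h) (integrable_decay hh)
    (abs_decay_le h) (aestronglyMeasurable_weighted h hu) hu2 x
  refine ((h1.const_mul c).const_mul (wt h x)⁻¹).mono' ?_
    (Eventually.of_forall fun w => hT.norm_mul_le x w)
  have h2 : AEStronglyMeasurable (T x) :=
    (hT.measurable.comp_measurable measurable_prodMk_left).aestronglyMeasurable
  refine h2.mul (hu.mul ?_)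
  have := continuous_Phi0 (d := d)
  exact (by fun_prop : Continuous fun w : Fin d → ℂ =>
    (Real.exp (-(2 / h) * Phi0 w) : ℂ)).aestronglyMeasurable

theorem norm_weighted_kernelOp_le (hh : 0 < h) (hu : AEStronglyMeasurable u)
    (hu2 : Integrable fun x => ‖weighted h u x‖ ^ 2) (x : Fin d → ℂ) :
    ‖weighted h (kernelOp h T u) x‖ ≤
      (((2 * Real.pi * h) ^ d)⁻¹ * c) * ∫ w, decay h (x - w) * ‖weighted h u w‖ := by
  have h1 := integrable_schur (continuous_decay (d := d) h) (integrable_decay hh)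
    (abs_decay_le h) (aestronglyMeasurable_weighted h hu) hu2 x
  have h2 := norm_integral_le_of_norm_le ((h1.const_mul c).const_mul (wt h x)⁻¹)
    (Eventually.of_forall fun w => hT.norm_mul_le (u := u) x w)
  rw [integral_const_mul, integral_const_mul, inv_mul_eq_div, le_div_iff₀ (wt_pos h x)] at h2
  have hpi := Real.pi_pos
  rw [norm_weighted, kernelOp, norm_mul, Complex.norm_real, Real.norm_of_nonneg (by positivity),
    mul_assoc _ _ (wt h x), mul_assoc _ c]
  exact mul_le_mul_of_nonneg_left h2 (by positivity)

theorem integrable_kernelOp (hh : 0 < h) (hu : AEStronglyMeasurable u)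
    (hu2 : Integrable fun x => ‖weighted h u x‖ ^ 2)
    (hm : AEStronglyMeasurable (kernelOp h T u)) :
    (Integrable fun x => ‖weighted h (kernelOp h T u) x‖ ^ 2) ∧
      ∫ x, ‖weighted h (kernelOp h T u) x‖ ^ 2 ≤
        (c * schurConst d) ^ 2 * ∫ x, ‖weighted h u x‖ ^ 2 := by
  have h1 := schur_bound (fun t => (decay_pos h t).le) (continuous_decay (d := d) h)
    (integrable_decay hh) (abs_decay_le h) (aestronglyMeasurable_weighted h hu) hu2
    (aestronglyMeasurable_weighted h hm)
    (hT.norm_weighted_kernelOp_le hh hu hu2)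
  rwa [mul_assoc, mul_left_comm, mul_integral_decay hh] at h1

theorem differentiable_kernelOp (hh : 0 < h) (hTd : ∀ w, Differentiable ℂ fun x => T x w)
    (hu : AEStronglyMeasurable u) (hu2 : Integrable fun x => ‖weighted h u x‖ ^ 2) :
    Differentiable ℂ (kernelOp h T u) := by
  refine Differentiable.const_mul ?_ _
  refine differentiable_integral_of_dominated (fun x => ?_) (fun w => ?_) fun x₀ => ?_
  · exact (hT.integrable hh hu hu2 x).aestronglyMeasurable
  · exact (hTd w).mul_const _
  · have hs : 0 < Real.sqrt h := Real.sqrt_pos.2 hh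
    have hc : 0 ≤ c := by
      have h1 := hT.bound x₀ x₀
      have h2 := decay_pos h (x₀ - x₀)
      have h3 : 0 ≤ ‖T x₀ x₀‖ * (wt h x₀ * wt h x₀) := by
        have := wt_pos h x₀
        positivity
      by_contra! hneg
      nlinarith
    obtain ⟨K, hK⟩ := (isCompact_closedBall x₀ 3).exists_bound_of_continuousOn
      (f := fun x => (wt h x)⁻¹)
      ((continuous_wt h).inv₀ fun x => (wt_pos h x).ne').continuousOn
    have hK0 : 0 ≤ K := (norm_nonneg _).trans (hK x₀ (Metric.mem_closedBall_self (by norm_num)))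
    set D := (1 + (Real.sqrt h)⁻¹ * 3) ^ (2 * d + 1) with hD
    refine ⟨fun w => K * (c * D) * (decay h (x₀ - w) * ‖weighted h u w‖), ?_, fun x hx w => ?_⟩
    · exact (integrable_schur (continuous_decay (d := d) h) (integrable_decay hh)
        (abs_decay_le h) (aestronglyMeasurable_weighted h hu) hu2 x₀).const_mul _
    · refine (hT.norm_mul_le x w).trans ?_
      have h1 : (wt h x)⁻¹ ≤ K :=
        (le_abs_self _).trans (hK x (Metric.ball_subset_closedBall hx))
      have h2 : decay h (x - w) ≤ D * decay h (x₀ - w) := by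
        rw [decay, decay, ← div_eq_mul_inv, inv_eq_one_div, div_le_div_iff₀ (by positivity)
          (by positivity), one_mul, hD, ← mul_pow]
        refine pow_le_pow_left₀ (by positivity) ?_ _
        rw [mem_ball_iff_norm] at hx
        have e : (Real.sqrt h)⁻¹ • (x₀ - w) =
            (Real.sqrt h)⁻¹ • (x - w) - (Real.sqrt h)⁻¹ • (x - x₀) := by module
        have h3 := norm_sub_le ((Real.sqrt h)⁻¹ • (x - w)) ((Real.sqrt h)⁻¹ • (x - x₀))
        rw [← e, norm_smul _ (x - x₀), Real.norm_of_nonneg (inv_nonneg.2 hs.le)] at h3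
        have h4 : (Real.sqrt h)⁻¹ * ‖x - x₀‖ ≤ (Real.sqrt h)⁻¹ * 3 := by gcongr
        have h5 : 0 ≤ (Real.sqrt h)⁻¹ * 3 * ‖(Real.sqrt h)⁻¹ • (x - w)‖ := by positivity
        nlinarith
      have h3 := (decay_pos h (x - w)).le
      calc _ ≤ K * (c * ((D * decay h (x₀ - w)) * ‖weighted h u w‖)) := by gcongr
        _ = _ := by ring

end DominatedKernel

/-! ### The Bergman projection and the density of rapidly decreasing functions -/

/-- The coherent states decay like Gaussians off the diagonal, uniformly in `h` after scaling. -/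
theorem exists_gaussian_le_decay (k : ℕ) : ∃ C : ℝ, 0 < C ∧ ∀ (h : ℝ) (_ : 0 < h) (t : Fin d → ℂ),
    (1 + ‖(Real.sqrt h)⁻¹ • t‖) ^ k * Real.exp (-(1 / (4 * h)) * sqNorm t) ≤ C * decay h t := by
  obtain ⟨C, hC, hb⟩ := exists_one_add_norm_pow_mul_exp_neg_sqNorm_le (d := d) (k + (2 * d + 1))
    (a := 1 / 4) (by norm_num)
  refine ⟨C, hC, fun h hh t => ?_⟩
  have h1 := hb ((Real.sqrt h)⁻¹ • t)
  rw [sqNorm_real_smul, inv_pow, Real.sq_sqrt hh.le, pow_add] at h1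
  rw [decay, ← div_eq_mul_inv, le_div_iff₀ (by positivity)]
  have e : -(1 / (4 * h)) * sqNorm t = -(1 / 4) * (h⁻¹ * sqNorm t) := by field_simp
  rw [e]
  linarith

theorem continuous_coherent (h : ℝ) :
    Continuous fun a : (Fin d → ℂ) × (Fin d → ℂ) => coherent h a.1 a.2 := by
  unfold coherent
  fun_prop

theorem differentiable_coherent (h : ℝ) (w : Fin d → ℂ) :
    Differentiable ℂ fun x => coherent h x w := by
  unfold coherent
  fun_prop

theorem norm_coherent_mul_wt (h : ℝ) (x w : Fin d → ℂ) :
    ‖coherent h x w‖ * (wt h x * wt h w) = Real.exp (-(1 / (4 * h)) * sqNorm (x - w)) :=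
  norm_coherent h x w

theorem exists_dominatedKernel_coherent (d : ℕ) : ∃ c : ℝ, 0 < c ∧ ∀ h : ℝ, 0 < h →
    DominatedKernel h c (coherent (d := d) h) := by
  obtain ⟨C, hC, hb⟩ := exists_gaussian_le_decay (d := d) 0
  refine ⟨C, hC, fun h hh => ⟨(continuous_coherent h).stronglyMeasurable, fun x w => ?_⟩⟩
  rw [norm_coherent_mul_wt]
  simpa using hb h hh (x - w)

theorem kernelOp_coherent {h : ℝ} (hh : 0 < h) {u : (Fin d → ℂ) → ℂ} (hu : u ∈ HPhi d h) :
    kernelOp h (coherent h) u = u := by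
  obtain ⟨hud, hu2⟩ := mem_HPhi.1 hu
  obtain ⟨c, _, hc⟩ := exists_dominatedKernel_coherent d
  funext x
  have h1 := (hc h hh).integrable hh hud.continuous.aestronglyMeasurable hu2 x
  rw [kernelOp, integral_coherent_mul hh hud x h1]
  have : (2 * Real.pi * h) ^ d ≠ 0 := by have := Real.pi_pos; positivity
  rw [← mul_assoc, ← Complex.ofReal_pow, ← Complex.ofReal_mul, inv_mul_cancel₀ this]
  simp

theorem kernelOp_coherent_mem {h : ℝ} (hh : 0 < h) {u : (Fin d → ℂ) → ℂ}
    (hu : AEStronglyMeasurable u) (hu2 : Integrable fun x => ‖weighted h u x‖ ^ 2) :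
    kernelOp h (coherent h) u ∈ HPhi d h := by
  obtain ⟨c, _, hc⟩ := exists_dominatedKernel_coherent d
  have h1 := (hc h hh).differentiable_kernelOp hh (differentiable_coherent h) hu hu2
  exact mem_HPhi.2 ⟨h1, ((hc h hh).integrable_kernelOp hh hu hu2
    h1.continuous.aestronglyMeasurable).1⟩

theorem norm_weighted_indicator_le (h : ℝ) (u : (Fin d → ℂ) → ℂ) (s : Set (Fin d → ℂ))
    (x : Fin d → ℂ) : ‖weighted h (s.indicator u) x‖ ≤ ‖weighted h u x‖ := by
  rw [norm_weighted, norm_weighted]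
  have := wt_pos h x
  gcongr
  exact norm_indicator_le_norm_self u x

theorem integrable_weighted_indicator {h : ℝ} {u : (Fin d → ℂ) → ℂ}
    (hu : AEStronglyMeasurable u) (hu2 : Integrable fun x => ‖weighted h u x‖ ^ 2)
    {s : Set (Fin d → ℂ)} (hs : MeasurableSet s) :
    Integrable fun x => ‖weighted h (s.indicator u) x‖ ^ 2 := by
  refine hu2.mono' ((aestronglyMeasurable_weighted h (hu.indicator hs)).norm.pow 2)
    (Eventually.of_forall fun x => ?_)
  rw [Real.norm_of_nonneg (by positivity)]
  have := norm_weighted_indicator_le h u s x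
  gcongr

/-- The Bergman projection of a function supported in a ball decreases rapidly. -/
theorem rapidlyDecreasing_kernelOp_indicator {h : ℝ} (hh : 0 < h) {u : (Fin d → ℂ) → ℂ}
    (hu : AEStronglyMeasurable u) (hu2 : Integrable fun x => ‖weighted h u x‖ ^ 2) (R : ℝ) :
    RapidlyDecreasing h (kernelOp h (coherent h) ((Metric.closedBall 0 R).indicator u)) := by
  intro N
  set v := (Metric.closedBall (0 : Fin d → ℂ) R).indicator u with hv
  have hvm : AEStronglyMeasurable v := hu.indicator Metric.isClosed_closedBall.measurableSet
  have hv2 : Integrable fun x => ‖weighted h v x‖ ^ 2 :=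
    integrable_weighted_indicator hu hu2 Metric.isClosed_closedBall.measurableSet
  have hmem := mem_HPhi.1 (kernelOp_coherent_mem hh hvm hv2)
  obtain ⟨C, hC, hb⟩ := exists_gaussian_le_decay (d := d) N
  set E := (1 + Real.sqrt h) ^ N * (1 + |R|) ^ N with hE
  -- The weight `(1 + |x|)^N` is absorbed by the Gaussian, as `|w| ≤ R` on the support of `v`.
  have key : ∀ x w, (1 + ‖x‖) ^ N * ‖coherent h x w * (v w * (Real.exp (-(2 / h) * Phi0 w) : ℂ))‖
      ≤ (wt h x)⁻¹ * (E * C * (decay h (x - w) * ‖weighted h v w‖)) := by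
    intro x w
    have h2 := wt_pos h x
    have h3 := wt_pos h w
    by_cases hw : w ∈ Metric.closedBall (0 : Fin d → ℂ) R
    · have hwR : ‖w‖ ≤ |R| := by
        rw [mem_closedBall_zero_iff] at hw
        exact hw.trans (le_abs_self R)
      have hs := Real.sqrt_pos.2 hh
      have h4 : 1 + ‖x‖ ≤ (1 + Real.sqrt h) * (1 + |R|) * (1 + ‖(Real.sqrt h)⁻¹ • (x - w)‖) := by
        have h5 : ‖x‖ ≤ ‖x - w‖ + ‖w‖ := by simpa using norm_add_le (x - w) w
        have h6 : ‖x - w‖ = Real.sqrt h * ‖(Real.sqrt h)⁻¹ • (x - w)‖ := by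
          rw [norm_smul, Real.norm_of_nonneg (inv_nonneg.2 hs.le), mul_inv_cancel_left₀ hs.ne']
        set s := ‖(Real.sqrt h)⁻¹ • (x - w)‖ with hs_def
        have h7 : 0 ≤ s := norm_nonneg _
        have h8 := abs_nonneg R
        calc 1 + ‖x‖ ≤ 1 + (Real.sqrt h * s + |R|) := by linarith
          _ ≤ 1 + (Real.sqrt h * s + |R|) + (s + Real.sqrt h + Real.sqrt h * |R| + |R| * s +
              Real.sqrt h * |R| * s) := le_add_of_nonneg_right (by positivity)
          _ = _ := by ring
      have h5 : (1 + ‖x‖) ^ N * (‖coherent h x w‖ * (wt h x * wt h w)) ≤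
          E * C * decay h (x - w) := by
        rw [norm_coherent_mul_wt]
        calc _ ≤ ((1 + Real.sqrt h) * (1 + |R|) * (1 + ‖(Real.sqrt h)⁻¹ • (x - w)‖)) ^ N *
              Real.exp (-(1 / (4 * h)) * sqNorm (x - w)) := by gcongr
          _ = E * ((1 + ‖(Real.sqrt h)⁻¹ • (x - w)‖) ^ N *
              Real.exp (-(1 / (4 * h)) * sqNorm (x - w))) := by rw [mul_pow, mul_pow]; ring
          _ ≤ E * (C * decay h (x - w)) :=
              mul_le_mul_of_nonneg_left (hb h hh (x - w)) (by positivity)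
          _ = _ := by ring
      rw [norm_mul, norm_mul, Complex.norm_real, Real.norm_of_nonneg (Real.exp_pos _).le,
        exp_eq_wt_mul_wt, norm_weighted, inv_mul_eq_div, le_div_iff₀ h2]
      calc _ = ((1 + ‖x‖) ^ N * (‖coherent h x w‖ * (wt h x * wt h w))) *
            (‖v w‖ * wt h w) := by ring
        _ ≤ (E * C * decay h (x - w)) * (‖v w‖ * wt h w) := by gcongr
        _ = _ := by ring
    · have hv0 : v w = 0 := Set.indicator_of_notMem hw u
      simp [weighted, hv0]
  set g : (Fin d → ℂ) → ℂ := fun x =>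
    ((1 + ‖x‖) ^ N : ℝ) * weighted h (kernelOp h (coherent h) v) x with hg
  have hgm : AEStronglyMeasurable g := by
    refine AEStronglyMeasurable.mul ?_
      (aestronglyMeasurable_weighted h hmem.1.continuous.aestronglyMeasurable)
    exact (by fun_prop : Continuous fun x : Fin d → ℂ =>
      (((1 + ‖x‖) ^ N : ℝ) : ℂ)).aestronglyMeasurable
  have hgb : ∀ x, ‖g x‖ ≤ (((2 * Real.pi * h) ^ d)⁻¹ * (E * C)) *
      ∫ w, decay h (x - w) * ‖weighted h v w‖ := by
    intro x
    have h1 := integrable_schur (continuous_decay (d := d) h) (integrable_decay hh)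
      (abs_decay_le h) (aestronglyMeasurable_weighted h hvm) hv2 x
    have h2 := norm_integral_le_of_norm_le ((h1.const_mul (E * C)).const_mul (wt h x)⁻¹)
      (f := fun w => (((1 + ‖x‖) ^ N : ℝ) : ℂ) *
        (coherent h x w * (v w * (Real.exp (-(2 / h) * Phi0 w) : ℂ))))
      (Eventually.of_forall fun w => by
        rw [norm_mul, Complex.norm_real, Real.norm_of_nonneg (by positivity)]
        exact key x w)
    rw [integral_const_mul, integral_const_mul, integral_const_mul, inv_mul_eq_div,
      le_div_iff₀ (wt_pos h x), norm_mul, Complex.norm_real,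
      Real.norm_of_nonneg (by positivity)] at h2
    have hpi := Real.pi_pos
    rw [hg]
    beta_reduce
    rw [norm_mul, Complex.norm_real, Real.norm_of_nonneg (by positivity), norm_weighted, kernelOp,
      norm_mul, Complex.norm_real, Real.norm_of_nonneg (by positivity)]
    calc _ = ((2 * Real.pi * h) ^ d)⁻¹ * ((1 + ‖x‖) ^ N *
          ‖∫ w, coherent h x w * (v w * (Real.exp (-(2 / h) * Phi0 w) : ℂ))‖ * wt h x) := by ring
      _ ≤ ((2 * Real.pi * h) ^ d)⁻¹ * (E * C *
          ∫ w, decay h (x - w) * ‖weighted h v w‖) := by gcongr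
      _ = _ := by ring
  have hfin := (schur_bound (fun t => (decay_pos h t).le) (continuous_decay (d := d) h)
    (integrable_decay hh) (abs_decay_le h) (aestronglyMeasurable_weighted h hvm) hv2 hgm hgb).1
  refine hfin.mono' ?_ (Eventually.of_forall fun x => ?_)
  · have h1 : Continuous fun x => ‖kernelOp h (coherent h) v x‖ := hmem.1.continuous.norm
    have := continuous_Phi0 (d := d)
    exact (by fun_prop : Continuous fun x => (1 + ‖x‖) ^ N *
      (‖kernelOp h (coherent h) v x‖ ^ 2 * Real.exp (-(2 / h) * Phi0 x))).aestronglyMeasurable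
  · rw [Real.norm_of_nonneg (by positivity), ← norm_weighted_sq, hg]
    beta_reduce
    rw [norm_mul, Complex.norm_real, Real.norm_of_nonneg (by positivity), mul_pow]
    gcongr
    exact le_self_pow₀ (one_le_pow₀ (by linarith [norm_nonneg x])) two_ne_zero

theorem kernelOp_sub {h c : ℝ} (hh : 0 < h) {T : (Fin d → ℂ) → (Fin d → ℂ) → ℂ}
    (hT : DominatedKernel h c T) {u v : (Fin d → ℂ) → ℂ}
    (hu : AEStronglyMeasurable u) (hu2 : Integrable fun x => ‖weighted h u x‖ ^ 2)
    (hv : AEStronglyMeasurable v) (hv2 : Integrable fun x => ‖weighted h v x‖ ^ 2) :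
    kernelOp h T (u - v) = kernelOp h T u - kernelOp h T v := by
  funext x
  simp only [kernelOp, Pi.sub_apply, sub_mul, mul_sub]
  rw [integral_sub (hT.integrable hh hu hu2 x) (hT.integrable hh hv hv2 x), mul_sub]

/-- Rapidly decreasing functions are dense in `H_{Φ₀}`: the Bergman projections of the truncations
of `u` converge to `u`. -/
theorem exists_rapidlyDecreasing_approx {h : ℝ} (hh : 0 < h) {u : (Fin d → ℂ) → ℂ}
    (hu : u ∈ HPhi d h) {ε : ℝ} (hε : 0 < ε) :
    ∃ v ∈ HPhi d h, RapidlyDecreasing h v ∧ normPhi d h (u - v) ^ 2 ≤ ε := by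
  obtain ⟨hud, hu2⟩ := mem_HPhi.1 hu
  have hum : AEStronglyMeasurable u := hud.continuous.aestronglyMeasurable
  obtain ⟨c, hc0, hc⟩ := exists_dominatedKernel_coherent d
  have hT := hc h hh
  have hmeas : ∀ n : ℕ, MeasurableSet (Metric.closedBall (0 : Fin d → ℂ) n) := fun n =>
    Metric.isClosed_closedBall.measurableSet
  have hlim : Tendsto (fun n : ℕ => ∫ x, ‖weighted h
      ((Metric.closedBall (0 : Fin d → ℂ) n)ᶜ.indicator u) x‖ ^ 2) atTop (𝓝 0) := by
    have h0 : (0 : ℝ) = ∫ _x : Fin d → ℂ, (0 : ℝ) := by simp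
    rw [h0]
    refine tendsto_integral_of_dominated_convergence (fun x => ‖weighted h u x‖ ^ 2)
      (fun n => (integrable_weighted_indicator hum hu2 (hmeas n).compl).aestronglyMeasurable) hu2
      (fun n => Eventually.of_forall fun x => ?_) (Eventually.of_forall fun x => ?_)
    · rw [Real.norm_of_nonneg (by positivity)]
      have := norm_weighted_indicator_le h u (Metric.closedBall (0 : Fin d → ℂ) n)ᶜ x
      gcongr
    · obtain ⟨n₀, hn₀⟩ := exists_nat_ge ‖x‖
      refine tendsto_const_nhds.congr' ?_
      filter_upwards [eventually_ge_atTop n₀] with n hn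
      have : x ∉ (Metric.closedBall (0 : Fin d → ℂ) n)ᶜ := by
        simp only [Set.mem_compl_iff, mem_closedBall_zero_iff, not_not]
        exact hn₀.trans (by exact_mod_cast hn)
      simp [weighted, Set.indicator_of_notMem this]
  have hk : 0 < (c * schurConst d) ^ 2 := by
    have := schurConst_pos d
    positivity
  obtain ⟨n, hn⟩ := (hlim.eventually (gt_mem_nhds (div_pos hε hk))).exists
  set v := (Metric.closedBall (0 : Fin d → ℂ) n).indicator u with hv
  set v' := (Metric.closedBall (0 : Fin d → ℂ) n)ᶜ.indicator u with hv'
  have hvm : AEStronglyMeasurable v := hum.indicator (hmeas n)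
  have hv2 := integrable_weighted_indicator hum hu2 (hmeas n)
  have hvm' : AEStronglyMeasurable v' := hum.indicator (hmeas n).compl
  have hv2' := integrable_weighted_indicator hum hu2 (hmeas n).compl
  refine ⟨kernelOp h (coherent h) v, kernelOp_coherent_mem hh hvm hv2,
    rapidlyDecreasing_kernelOp_indicator hh hum hu2 n, ?_⟩
  have e : u - kernelOp h (coherent h) v = kernelOp h (coherent h) v' := by
    have e1 : v' = u - v := by
      rw [hv', hv, Set.indicator_compl]
    rw [e1, kernelOp_sub hh hT hum hu2 hvm hv2, kernelOp_coherent hh hu]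
  rw [e, normPhi_sq]
  have h1 := (hT.integrable_kernelOp hh hvm' hv2' (mem_HPhi.1
    (kernelOp_coherent_mem hh hvm' hv2')).1.continuous.aestronglyMeasurable).2
  refine h1.trans ?_
  rw [lt_div_iff₀ hk] at hn
  linarith

/-! ### Existence and uniqueness of the Weyl quantization -/

/-- The kernel of the Weyl quantization of `P` with respect to the weight `e^{-2Φ₀/h}`. -/
def weylKernel (h : ℝ) (P : (Fin d → ℂ) → ℂ) (x w : Fin d → ℂ) : ℂ :=
  coherent h x w * weylAverage h P x w

theorem IsBoundedSymbol.exists_dominatedKernel {P : (Fin d → ℂ) → ℂ} (hP : IsBoundedSymbol P) :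
    ∃ c : ℝ, 0 < c ∧ ∀ h : ℝ, 0 < h → h ≤ 1 → DominatedKernel h c (weylKernel h P) := by
  obtain ⟨c, hc, hb⟩ := hP.exists_norm_weyl_kernel_le
  refine ⟨c, hc, fun h hh hh1 => ⟨?_, fun x w => hb h hh hh1 x w⟩⟩
  exact (continuous_coherent h).stronglyMeasurable.mul
    (measurable_weylAverage h hP.smooth.continuous)

theorem IsBoundedSymbol.differentiable_weylKernel {P : (Fin d → ℂ) → ℂ} (hP : IsBoundedSymbol P)
    {h : ℝ} (hh : 0 < h) (w : Fin d → ℂ) : Differentiable ℂ fun x => weylKernel h P x w := by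
  obtain ⟨M, _, hM⟩ := hP.exists_norm_le
  exact (differentiable_coherent h w).mul
    (differentiable_weylAverage hh hP.smooth.continuous hM w)

theorem IsBoundedSymbol.kernelOp_mem {P : (Fin d → ℂ) → ℂ} (hP : IsBoundedSymbol P)
    {h : ℝ} (hh : 0 < h) (hh1 : h ≤ 1) {u : (Fin d → ℂ) → ℂ} (hu : u ∈ HPhi d h) :
    kernelOp h (weylKernel h P) u ∈ HPhi d h := by
  obtain ⟨c, _, hc⟩ := hP.exists_dominatedKernel
  obtain ⟨hud, hu2⟩ := mem_HPhi.1 hu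
  have hum := hud.continuous.aestronglyMeasurable (μ := volume)
  have h1 := (hc h hh hh1).differentiable_kernelOp hh (hP.differentiable_weylKernel hh) hum hu2
  exact mem_HPhi.2 ⟨h1, ((hc h hh hh1).integrable_kernelOp hh hum hu2
    h1.continuous.aestronglyMeasurable).1⟩

/-- The Weyl quantization of `P` on `H_{Φ₀}(ℂ^d; h)`, given by its integral kernel. -/
def weylOp {h : ℝ} (hh : 0 < h) (hh1 : h ≤ 1) {P : (Fin d → ℂ) → ℂ} (hP : IsBoundedSymbol P) :
    HPhi d h →ₗ[ℂ] HPhi d h where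
  toFun u := ⟨kernelOp h (weylKernel h P) u, hP.kernelOp_mem hh hh1 u.2⟩
  map_add' u v := by
    obtain ⟨c, _, hc⟩ := hP.exists_dominatedKernel
    obtain ⟨hud, hu2⟩ := mem_HPhi.1 u.2
    obtain ⟨hvd, hv2⟩ := mem_HPhi.1 v.2
    refine Subtype.ext (funext fun x => ?_)
    simp only [Submodule.coe_add, Pi.add_apply, kernelOp, add_mul, mul_add]
    rw [integral_add ((hc h hh hh1).integrable hh hud.continuous.aestronglyMeasurable hu2 x)
      ((hc h hh hh1).integrable hh hvd.continuous.aestronglyMeasurable hv2 x), mul_add]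
  map_smul' a u := by
    refine Subtype.ext (funext fun x => ?_)
    simp only [Submodule.coe_smul, Pi.smul_apply, smul_eq_mul, kernelOp, RingHom.id_apply]
    rw [mul_left_comm a, ← integral_const_mul a]
    congr 2
    funext w
    ring

theorem exists_normPhi_weylOp_le {P : (Fin d → ℂ) → ℂ} (hP : IsBoundedSymbol P) :
    ∃ M : ℝ, 0 < M ∧ ∀ (h : ℝ) (hh : 0 < h) (hh1 : h ≤ 1) (u : HPhi d h),
      normPhi d h (weylOp hh hh1 hP u) ≤ M * normPhi d h u := by
  obtain ⟨c, hc0, hc⟩ := hP.exists_dominatedKernel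
  refine ⟨c * schurConst d, mul_pos hc0 (schurConst_pos d), fun h hh hh1 u => ?_⟩
  obtain ⟨hud, hu2⟩ := mem_HPhi.1 u.2
  have h1 := ((hc h hh hh1).integrable_kernelOp hh hud.continuous.aestronglyMeasurable hu2
    (mem_HPhi.1 (hP.kernelOp_mem hh hh1 u.2)).1.continuous.aestronglyMeasurable).2
  rw [← normPhi_sq, ← normPhi_sq, ← mul_pow] at h1
  exact (pow_le_pow_iff_left₀ (normPhi_nonneg _ _) (mul_nonneg
    (mul_pos hc0 (schurConst_pos d)).le (normPhi_nonneg _ _)) two_ne_zero).1 h1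

theorem integrable_weighted_of_rapidlyDecreasing {h : ℝ} {u : (Fin d → ℂ) → ℂ}
    (hu : AEStronglyMeasurable u) (hr : RapidlyDecreasing h u) : Integrable (weighted h u) := by
  have h1 := (integrable_inv_one_add_norm_pow (d := d)).add (hr (2 * d + 1))
  refine h1.mono' (aestronglyMeasurable_weighted h hu) (Eventually.of_forall fun x => ?_)
  simp only [Pi.add_apply]
  rw [← norm_weighted_sq]
  set a := (1 + ‖x‖) ^ (2 * d + 1) with ha
  have ha0 : 0 < a := by positivity
  have h2 : a⁻¹ + a * ‖weighted h u x‖ ^ 2 - ‖weighted h u x‖ =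
      a⁻¹ * ((a * ‖weighted h u x‖ - 1 / 2) ^ 2 + 3 / 4) := by field_simp; ring
  have h3 : 0 ≤ a⁻¹ * ((a * ‖weighted h u x‖ - 1 / 2) ^ 2 + 3 / 4) := by positivity
  linarith

/-- The Weyl quantization as a superposition of phase space reflections: the change of variables
`y = 2m - x` in its defining integral. -/
theorem weylIntegral_eq {h : ℝ} (hh : 0 < h) (a : (Fin d → ℂ) → (Fin d → ℂ) → ℂ)
    (u : (Fin d → ℂ) → ℂ) (x : Fin d → ℂ) :
    weylIntegral h a u x = (((Real.pi * h) ^ d)⁻¹ : ℝ) *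
      ∫ m, a m (xi0 m) * (reflFactor h x m * u (2 * m - x)) := by
  set f : (Fin d → ℂ) → ℂ := fun y =>
    Complex.exp (I / h * ∑ j, (x j - y j) * xi0 ((2 : ℂ)⁻¹ • (x + y)) j) *
        a ((2 : ℂ)⁻¹ • (x + y)) (xi0 ((2 : ℂ)⁻¹ • (x + y))) * u y with hf
  have h1 := Measure.integral_comp_smul_of_nonneg (volume : Measure (Fin d → ℂ))
    (fun t => f (t - x)) 2 (hR := zero_le_two)
  rw [finrank_real_pi_complex, integral_sub_right_eq_self f x, Complex.real_smul] at h1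
  have h2 : ∀ m : Fin d → ℂ, f ((2 : ℝ) • m - x) =
      a m (xi0 m) * (reflFactor h x m * u (2 * m - x)) := by
    intro m
    have e1 : (2 : ℂ)⁻¹ • (x + ((2 : ℝ) • m - x)) = m := by
      funext j
      simp
    have e2 : (2 : ℝ) • m - x = 2 * m - x := by
      funext j
      simp
    rw [hf]
    beta_reduce
    rw [e1, e2, reflFactor]
    have e3 : I / h * ∑ j, (x j - (2 * m - x) j) * xi0 m j =
        2 * I / h * ∑ j, (x j - m j) * xi0 m j := by
      rw [Finset.mul_sum, Finset.mul_sum]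
      refine Finset.sum_congr rfl fun j _ => ?_
      simp only [Pi.sub_apply, Pi.mul_apply, Pi.ofNat_apply]
      ring
    rw [e3]
    ring
  simp_rw [h2] at h1
  rw [h1, weylIntegral, ← mul_assoc, ← Complex.ofReal_mul]
  congr 2
  have := Real.pi_pos
  rw [pow_mul, show (2 : ℝ) ^ 2 = 2 * 2 by norm_num, mul_pow, mul_pow, mul_pow, mul_pow]
  field_simp

/-- The integrand of the double integral that represents the Weyl quantization of `P` applied to
the reproducing formula for `u`. -/
def doubleIntegrand (h : ℝ) (P u : (Fin d → ℂ) → ℂ) (x w m : Fin d → ℂ) : ℂ :=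
  P m * Complex.exp (-(1 / h) * herm (m - x) (m - w)) *
    (coherent h x w * (u w * (Real.exp (-(2 / h) * Phi0 w) : ℂ)))

theorem norm_doubleIntegrand_le (h : ℝ) {P : (Fin d → ℂ) → ℂ} {M : ℝ} (hM : ∀ m, ‖P m‖ ≤ M)
    (u : (Fin d → ℂ) → ℂ) (x w m : Fin d → ℂ) :
    ‖doubleIntegrand h P u x w m‖ ≤ M * (wt h x)⁻¹ * (‖weighted h u w‖ *
      Real.exp (-(1 / h) * sqNorm (m - (1 / 2 : ℝ) • (x + w)))) := by
  have h1 : ‖Complex.exp (-(1 / h) * herm (m - x) (m - w))‖ *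
      (‖coherent h x w‖ * (wt h x * wt h w)) =
      Real.exp (-(1 / h) * sqNorm (m - (1 / 2 : ℝ) • (x + w))) := by
    have e : (-(1 / (h : ℂ))) = ((-(1 / h) : ℝ) : ℂ) := by push_cast; ring
    have e2 : 1 / (4 * h) = 1 / h / 4 := by rw [mul_comm, div_div]
    rw [norm_coherent_mul_wt, Complex.norm_exp, e, Complex.re_ofReal_mul, re_herm_eq,
      ← Real.exp_add, e2]
    congr 1
    ring
  have h2 := wt_pos h x
  have h3 := wt_pos h w
  rw [← h1, doubleIntegrand, norm_mul, norm_mul, norm_mul, norm_mul, Complex.norm_real,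
    Real.norm_of_nonneg (Real.exp_pos _).le, exp_eq_wt_mul_wt, norm_weighted]
  calc _ ≤ M * ‖Complex.exp (-(1 / h) * herm (m - x) (m - w))‖ *
        (‖coherent h x w‖ * (‖u w‖ * (wt h w * wt h w))) := by
        gcongr
        exact hM m
    _ = _ := by field_simp

theorem continuous_doubleIntegrand (h : ℝ) {P u : (Fin d → ℂ) → ℂ} (hP : Continuous P)
    (hu : Continuous u) (x : Fin d → ℂ) :
    Continuous (Function.uncurry (doubleIntegrand h P u x)) := by
  have h1 : Continuous fun b : (Fin d → ℂ) × (Fin d → ℂ) => herm (b.2 - x) (b.2 - b.1) :=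
    continuous_herm (by fun_prop) (by fun_prop)
  have h2 : Continuous fun b : (Fin d → ℂ) × (Fin d → ℂ) => coherent h x b.1 := by
    unfold coherent
    fun_prop
  have h3 : Continuous fun w : Fin d → ℂ => (Real.exp (-(2 / h) * Phi0 w) : ℂ) := by
    have := continuous_Phi0 (d := d)
    fun_prop
  have h4 : Continuous fun b : (Fin d → ℂ) × (Fin d → ℂ) =>
      P b.2 * Complex.exp (-(1 / h) * herm (b.2 - x) (b.2 - b.1)) :=
    (hP.comp continuous_snd).mul (Complex.continuous_exp.comp (continuous_const.mul h1))
  have h5 : Continuous fun b : (Fin d → ℂ) × (Fin d → ℂ) =>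
      coherent h x b.1 * (u b.1 * (Real.exp (-(2 / h) * Phi0 b.1) : ℂ)) :=
    h2.mul ((hu.comp continuous_fst).mul (h3.comp continuous_fst))
  change Continuous fun b : (Fin d → ℂ) × (Fin d → ℂ) => doubleIntegrand h P u x b.1 b.2
  simp only [doubleIntegrand]
  exact h4.mul h5

theorem integrable_mul_gaussian_prod {b : ℝ} (hb : 0 < b) {f : (Fin d → ℂ) → ℝ}
    (hf : Integrable f) (x : Fin d → ℂ) :
    Integrable (fun a : (Fin d → ℂ) × (Fin d → ℂ) => f a.1 *
        Real.exp (-b * sqNorm (a.2 - (1 / 2 : ℝ) • (x + a.1)))) (volume.prod volume) := by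
  have hc := continuous_sqNorm (d := d)
  have hcont : Continuous fun a : (Fin d → ℂ) × (Fin d → ℂ) =>
      Real.exp (-b * sqNorm (a.2 - (1 / 2 : ℝ) • (x + a.1))) := by fun_prop
  refine (integrable_prod_iff
    (hf.aestronglyMeasurable.comp_fst.mul hcont.aestronglyMeasurable)).2
    ⟨Eventually.of_forall fun w => ?_, ?_⟩
  · exact ((integrable_exp_neg_sqNorm hb).comp_sub_right ((1 / 2 : ℝ) • (x + w))).const_mul (f w)
  · have e : ∀ w : Fin d → ℂ, ∫ m, ‖f w *
        Real.exp (-b * sqNorm (m - (1 / 2 : ℝ) • (x + w)))‖ = ‖f w‖ * (Real.pi / b) ^ d := by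
      intro w
      have e1 : ∀ m : Fin d → ℂ, ‖f w * Real.exp (-b * sqNorm (m - (1 / 2 : ℝ) • (x + w)))‖ =
          ‖f w‖ * Real.exp (-b * sqNorm (m - (1 / 2 : ℝ) • (x + w))) := by
        intro m
        rw [norm_mul, Real.norm_of_nonneg (Real.exp_pos _).le]
      simp_rw [e1]
      rw [integral_const_mul, integral_sub_right_eq_self
        (fun m : Fin d → ℂ => Real.exp (-b * sqNorm m)), integral_exp_neg_sqNorm hb]
    exact (hf.norm.mul_const _).congr (Eventually.of_forall fun w => (e w).symm)

/-- On rapidly decreasing functions, the kernel operator is given by the Weyl formula. -/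
theorem IsBoundedSymbol.kernelOp_eq_weylIntegral {P : (Fin d → ℂ) → ℂ} (hP : IsBoundedSymbol P)
    {h : ℝ} (hh : 0 < h) {a : (Fin d → ℂ) → (Fin d → ℂ) → ℂ} (ha : ∀ m, a m (xi0 m) = P m)
    {u : (Fin d → ℂ) → ℂ} (hu : u ∈ HPhi d h) (hr : RapidlyDecreasing h u) (x : Fin d → ℂ) :
    kernelOp h (weylKernel h P) u x = weylIntegral h a u x := by
  have huc := (mem_HPhi.1 hu).1.continuous
  obtain ⟨M, hM0, hM⟩ := hP.exists_norm_le
  have hFint : Integrable (Function.uncurry (doubleIntegrand h P u x)) (volume.prod volume) :=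
    ((integrable_mul_gaussian_prod (b := 1 / h) (by positivity)
      (integrable_weighted_of_rapidlyDecreasing huc.aestronglyMeasurable hr).norm x).const_mul
        (M * (wt h x)⁻¹)).mono'
      (continuous_doubleIntegrand h hP.smooth.continuous huc x).aestronglyMeasurable
      (Eventually.of_forall fun b => norm_doubleIntegrand_le h hM u x b.1 b.2)
  have hlhs : kernelOp h (weylKernel h P) u x = (((2 * Real.pi * h) ^ d)⁻¹ : ℝ) *
      ((((Real.pi * h) ^ d)⁻¹ : ℝ) * ∫ w, ∫ m, doubleIntegrand h P u x w m) := by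
    rw [kernelOp]
    congr 1
    rw [← integral_const_mul]
    congr 1
    funext w
    simp only [doubleIntegrand]
    rw [integral_mul_const, weylKernel, weylAverage]
    ring
  rw [hlhs, integral_integral_swap hFint, weylIntegral_eq hh, mul_left_comm, ← integral_const_mul]
  congr 2
  funext m
  have e : ∀ w, doubleIntegrand h P u x w m = P m * reflFactor h x m *
      (coherent h (2 * m - x) w * (u w * (Real.exp (-(2 / h) * Phi0 w) : ℂ))) := by
    intro w
    have h1 := reflFactor_mul_coherent h x m w
    rw [doubleIntegrand]
    linear_combination (-(P m * (u w * (Real.exp (-(2 / h) * Phi0 w) : ℂ)))) * h1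
  simp_rw [e]
  have h2 := congrFun (kernelOp_coherent hh hu) (2 * m - x)
  rw [kernelOp] at h2
  rw [integral_const_mul, mul_left_comm, h2, ha]
  ring

theorem isWeylQuantization_weylOp {h : ℝ} (hh : 0 < h) (hh1 : h ≤ 1) {P : (Fin d → ℂ) → ℂ}
    (hP : IsBoundedSymbol P) {a : (Fin d → ℂ) → (Fin d → ℂ) → ℂ} (ha : ∀ m, a m (xi0 m) = P m) :
    IsWeylQuantization h a (weylOp hh hh1 hP) where
  bounded := by
    obtain ⟨M, _, hM⟩ := exists_normPhi_weylOp_le hP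
    exact ⟨M, hM h hh hh1⟩
  formula u hr x := hP.kernelOp_eq_weylIntegral hh ha u.2 hr x

theorem normPhi_sub_sq_le {h : ℝ} {u v : (Fin d → ℂ) → ℂ} (hu : u ∈ HPhi d h) (hv : v ∈ HPhi d h) :
    normPhi d h (u - v) ^ 2 ≤ 2 * normPhi d h u ^ 2 + 2 * normPhi d h v ^ 2 := by
  simp_rw [normPhi_sq]
  rw [← integral_const_mul, ← integral_const_mul, ← integral_add
    ((mem_HPhi.1 hu).2.const_mul 2) ((mem_HPhi.1 hv).2.const_mul 2)]
  refine integral_mono (mem_HPhi.1 ((HPhi d h).sub_mem hu hv)).2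
    (((mem_HPhi.1 hu).2.const_mul 2).add ((mem_HPhi.1 hv).2.const_mul 2)) fun x => ?_
  have e : weighted h (u - v) x = weighted h u x - weighted h v x := by simp [weighted, sub_mul]
  have h1 := norm_sub_le (weighted h u x) (weighted h v x)
  simp only [e]
  nlinarith [norm_nonneg (weighted h u x - weighted h v x),
    sq_nonneg (‖weighted h u x‖ - ‖weighted h v x‖)]

theorem eq_zero_of_normPhi_eq_zero {h : ℝ} {u : (Fin d → ℂ) → ℂ} (hu : u ∈ HPhi d h)
    (h0 : normPhi d h u ^ 2 = 0) : u = 0 := by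
  obtain ⟨hud, hu2⟩ := mem_HPhi.1 hu
  have hc : Continuous fun x => ‖weighted h u x‖ ^ 2 := by
    have := hud.continuous
    have := continuous_wt (d := d) h
    unfold weighted
    fun_prop
  rw [normPhi_sq, integral_eq_zero_iff_of_nonneg (fun x => by positivity) hu2] at h0
  have h1 := Continuous.ae_eq_iff_eq (μ := (volume : Measure (Fin d → ℂ))) hc continuous_zero |>.1 h0
  funext x
  have h2 : ‖weighted h u x‖ ^ 2 = 0 := congrFun h1 x
  rw [pow_eq_zero_iff two_ne_zero, norm_weighted, mul_eq_zero, norm_eq_zero] at h2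
  exact h2.resolve_right (wt_pos h x).ne'

/-- A bounded operator is determined by the Weyl formula on the dense subspace of rapidly
decreasing functions. -/
theorem IsWeylQuantization.unique {h : ℝ} (hh : 0 < h) {a : (Fin d → ℂ) → (Fin d → ℂ) → ℂ}
    {A B : HPhi d h →ₗ[ℂ] HPhi d h} (hA : IsWeylQuantization h a A)
    (hB : IsWeylQuantization h a B) : A = B := by
  obtain ⟨M, hM⟩ := hA.bounded
  obtain ⟨M', hM'⟩ := hB.bounded
  refine LinearMap.ext fun u => ?_
  have key : ∀ ε : ℝ, 0 < ε →
      normPhi d h ((A u : (Fin d → ℂ) → ℂ) - B u) ^ 2 ≤ (2 * M ^ 2 + 2 * M' ^ 2) * ε := by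
    intro ε hε
    obtain ⟨v, hv, hvr, hvε⟩ := exists_rapidlyDecreasing_approx hh u.2 hε
    set v' : HPhi d h := ⟨v, hv⟩
    have hAB : A v' = B v' := Subtype.ext (funext fun x => by
      rw [hA.formula v' hvr x, hB.formula v' hvr x])
    have e : (A u : (Fin d → ℂ) → ℂ) - B u = (A (u - v') : (Fin d → ℂ) → ℂ) - B (u - v') := by
      rw [map_sub, map_sub, hAB]
      simp
    rw [e]
    refine (normPhi_sub_sq_le (A (u - v')).2 (B (u - v')).2).trans ?_
    have h1 : normPhi d h (A (u - v')) ^ 2 ≤ M ^ 2 * ε := by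
      calc _ ≤ (M * normPhi d h (u - v' : HPhi d h)) ^ 2 :=
            pow_le_pow_left₀ (normPhi_nonneg _ _) (hM _) 2
        _ = M ^ 2 * normPhi d h (u - v' : HPhi d h) ^ 2 := by ring
        _ ≤ M ^ 2 * ε := mul_le_mul_of_nonneg_left hvε (sq_nonneg M)
    have h2 : normPhi d h (B (u - v')) ^ 2 ≤ M' ^ 2 * ε := by
      calc _ ≤ (M' * normPhi d h (u - v' : HPhi d h)) ^ 2 :=
            pow_le_pow_left₀ (normPhi_nonneg _ _) (hM' _) 2
        _ = M' ^ 2 * normPhi d h (u - v' : HPhi d h) ^ 2 := by ring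
        _ ≤ M' ^ 2 * ε := mul_le_mul_of_nonneg_left hvε (sq_nonneg M')
    linarith
  have h0 : normPhi d h ((A u : (Fin d → ℂ) → ℂ) - B u) ^ 2 = 0 := by
    refine le_antisymm (le_of_forall_pos_le_add fun ε hε => ?_) (sq_nonneg _)
    have hK : 0 < 2 * M ^ 2 + 2 * M' ^ 2 + 1 := by positivity
    have h1 := key (ε / (2 * M ^ 2 + 2 * M' ^ 2 + 1)) (by positivity)
    have h2 : (2 * M ^ 2 + 2 * M' ^ 2) * (ε / (2 * M ^ 2 + 2 * M' ^ 2 + 1)) ≤ ε := by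
      rw [mul_div_assoc', div_le_iff₀ hK]
      nlinarith
    linarith
  have h1 := eq_zero_of_normPhi_eq_zero ((HPhi d h).sub_mem (A u).2 (B u).2) h0
  exact Subtype.ext (sub_eq_zero.1 h1)

/-! ### Quantization versus multiplication -/

/-- The Cauchy-Schwarz inequality. -/
theorem sq_integral_norm_mul_norm_le {α : Type*} [MeasurableSpace α] {μ : Measure α} {f g : α → ℂ}
    (hf : AEStronglyMeasurable f μ) (hg : AEStronglyMeasurable g μ)
    (hf2 : Integrable (fun a => ‖f a‖ ^ 2) μ) (hg2 : Integrable (fun a => ‖g a‖ ^ 2) μ) :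
    Integrable (fun a => ‖f a‖ * ‖g a‖) μ ∧
      (∫ a, ‖f a‖ * ‖g a‖ ∂μ) ^ 2 ≤ (∫ a, ‖f a‖ ^ 2 ∂μ) * ∫ a, ‖g a‖ ^ 2 ∂μ := by
  have hfg : Integrable (fun a => ‖f a‖ * ‖g a‖) μ := by
    refine (hf2.add hg2).mono' (hf.norm.mul hg.norm) (Eventually.of_forall fun a => ?_)
    rw [Real.norm_of_nonneg (by positivity)]
    simp only [Pi.add_apply]
    nlinarith [sq_nonneg (‖f a‖ - ‖g a‖), sq_nonneg (‖f a‖), sq_nonneg (‖g a‖)]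
  refine ⟨hfg, ?_⟩
  have h1 : ∀ s : ℝ, 0 ≤ (∫ a, ‖g a‖ ^ 2 ∂μ) * (s * s) + (-2 * ∫ a, ‖f a‖ * ‖g a‖ ∂μ) * s +
      ∫ a, ‖f a‖ ^ 2 ∂μ := by
    intro s
    have h2 : 0 ≤ ∫ a, (‖f a‖ - s * ‖g a‖) ^ 2 ∂μ := integral_nonneg fun a => sq_nonneg _
    have h3 : ∀ a, (‖f a‖ - s * ‖g a‖) ^ 2 =
        ‖g a‖ ^ 2 * (s * s) + (‖f a‖ * ‖g a‖) * (-2 * s) + ‖f a‖ ^ 2 := fun a => by ring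
    simp_rw [h3] at h2
    have e1 : Integrable (fun a => ‖g a‖ ^ 2 * (s * s) + (‖f a‖ * ‖g a‖) * (-2 * s)) μ :=
      (hg2.mul_const _).add (hfg.mul_const _)
    rw [integral_add e1 hf2, integral_add (hg2.mul_const _) (hfg.mul_const _), integral_mul_const,
      integral_mul_const] at h2
    linarith
  have h2 := discrim_le_zero h1
  rw [discrim] at h2
  nlinarith

theorem integrable_bdd_mul_mul_conj {φ f g : (Fin d → ℂ) → ℂ} {M : ℝ} (hφ : Continuous φ)
    (hφM : ∀ x, ‖φ x‖ ≤ M) (hf : AEStronglyMeasurable f) (hg : AEStronglyMeasurable g)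
    (hf2 : Integrable fun a => ‖f a‖ ^ 2) (hg2 : Integrable fun a => ‖g a‖ ^ 2) :
    Integrable fun x => φ x * (f x * conj (g x)) := by
  have h1 : Integrable fun x => f x * conj (g x) := by
    have hgc : AEStronglyMeasurable fun x => conj (g x) :=
      Complex.continuous_conj.comp_aestronglyMeasurable hg
    refine (sq_integral_norm_mul_norm_le hf hg hf2 hg2).1.mono' (hf.mul hgc)
      (Eventually.of_forall fun x => ?_)
    rw [norm_mul, RCLike.norm_conj]
  exact h1.bdd_mul (c := M) hφ.aestronglyMeasurable (Eventually.of_forall hφM)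

theorem norm_integral_mul_conj_le {φ f g : (Fin d → ℂ) → ℂ} (hφM : ∀ x, ‖φ x‖ ≤ 1)
    (hf : AEStronglyMeasurable f) (hg : AEStronglyMeasurable g)
    (hf2 : Integrable fun a => ‖f a‖ ^ 2) (hg2 : Integrable fun a => ‖g a‖ ^ 2) :
    ‖∫ x, φ x * (f x * conj (g x))‖ ≤
      Real.sqrt (∫ x, ‖f x‖ ^ 2) * Real.sqrt (∫ x, ‖g x‖ ^ 2) := by
  obtain ⟨h1, h2⟩ := sq_integral_norm_mul_norm_le hf hg hf2 hg2
  have h3 : ‖∫ x, φ x * (f x * conj (g x))‖ ≤ ∫ x, ‖f x‖ * ‖g x‖ := by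
    refine norm_integral_le_of_norm_le h1 (Eventually.of_forall fun x => ?_)
    rw [norm_mul, norm_mul, RCLike.norm_conj]
    exact mul_le_of_le_one_left (by positivity) (hφM x)
  refine h3.trans ?_
  rw [← Real.sqrt_mul (integral_nonneg fun x => by positivity)]
  exact Real.le_sqrt_of_sq_le h2

theorem sqrt_integral_weighted (h : ℝ) (u : (Fin d → ℂ) → ℂ) :
    Real.sqrt (∫ x, ‖weighted h u x‖ ^ 2) = normPhi d h u := by
  rw [← normPhi_sq, Real.sqrt_sq (normPhi_nonneg h u)]

theorem DominatedKernel.measurable_kernelOp {h c : ℝ} {T : (Fin d → ℂ) → (Fin d → ℂ) → ℂ}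
    (hT : DominatedKernel h c T) {u : (Fin d → ℂ) → ℂ} (hu : Continuous u) :
    AEStronglyMeasurable (kernelOp h T u) := by
  have h1 : Continuous fun w : Fin d → ℂ => u w * (Real.exp (-(2 / h) * Phi0 w) : ℂ) := by
    have := continuous_Phi0 (d := d)
    fun_prop
  have h2 : StronglyMeasurable fun a : (Fin d → ℂ) × (Fin d → ℂ) =>
      T a.1 a.2 * (u a.2 * (Real.exp (-(2 / h) * Phi0 a.2) : ℂ)) :=
    hT.measurable.mul (h1.stronglyMeasurable.comp_measurable measurable_snd)
  exact (h2.integral_prod_right'.const_mul _).aestronglyMeasurable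

/-- The kernel of the antiholomorphic first order term in the Taylor expansion of the symbol. -/
def linearKernel (h : ℝ) (j : Fin d) (x w : Fin d → ℂ) : ℂ := coherent h x w * conj (w j - x j)

/-- The kernel of the remainder in the first order Taylor expansion of the symbol. -/
def remainderKernel (h : ℝ) (P : (Fin d → ℂ) → ℂ) (x w : Fin d → ℂ) : ℂ :=
  coherent h x w * weylAverage h (taylorRem P x) x w

theorem norm_linearKernel_mul_wt (h : ℝ) (j : Fin d) (x w : Fin d → ℂ) :
    ‖linearKernel h j x w‖ * (wt h x * wt h w) ≤
      ‖x - w‖ * Real.exp (-(1 / (4 * h)) * sqNorm (x - w)) := by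
  rw [← norm_coherent_mul_wt, linearKernel, norm_mul, RCLike.norm_conj]
  have h1 : ‖w j - x j‖ ≤ ‖x - w‖ := by
    rw [norm_sub_rev]
    exact norm_le_pi_norm (x - w) j
  have h2 := wt_pos h x
  have h3 := wt_pos h w
  calc _ = ‖w j - x j‖ * (‖coherent h x w‖ * (wt h x * wt h w)) := by ring
    _ ≤ _ := by gcongr

theorem norm_eq_sqrt_mul {h : ℝ} (hh : 0 < h) (t : Fin d → ℂ) :
    ‖t‖ = Real.sqrt h * ‖(Real.sqrt h)⁻¹ • t‖ := by
  have hs := Real.sqrt_pos.2 hh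
  rw [norm_smul, Real.norm_of_nonneg (inv_nonneg.2 hs.le), mul_inv_cancel_left₀ hs.ne']

theorem exists_pow_mul_gaussian_le (k : ℕ) : ∃ C : ℝ, 0 < C ∧ ∀ (h : ℝ) (_ : 0 < h)
    (t : Fin d → ℂ), ‖t‖ ^ k * Real.exp (-(1 / (4 * h)) * sqNorm t) ≤
      C * Real.sqrt h ^ k * decay h t := by
  obtain ⟨C, hC, hb⟩ := exists_gaussian_le_decay (d := d) k
  refine ⟨C, hC, fun h hh t => ?_⟩
  rw [norm_eq_sqrt_mul hh, mul_pow]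
  have hs := Real.sqrt_pos.2 hh
  calc _ ≤ Real.sqrt h ^ k * ((1 + ‖(Real.sqrt h)⁻¹ • t‖) ^ k *
        Real.exp (-(1 / (4 * h)) * sqNorm t)) := by
        rw [mul_assoc]
        gcongr
        linarith
    _ ≤ Real.sqrt h ^ k * (C * decay h t) := mul_le_mul_of_nonneg_left (hb h hh t) (by positivity)
    _ = _ := by ring

theorem exists_dominatedKernel_linear (d : ℕ) : ∃ c : ℝ, 0 < c ∧ ∀ h : ℝ, 0 < h → ∀ j : Fin d,
    DominatedKernel h (c * Real.sqrt h) (linearKernel h j) := by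
  obtain ⟨C, hC, hb⟩ := exists_pow_mul_gaussian_le (d := d) 1
  refine ⟨C, hC, fun h hh j => ⟨?_, fun x w => (norm_linearKernel_mul_wt h j x w).trans ?_⟩⟩
  · refine (continuous_coherent h).stronglyMeasurable.mul (Continuous.stronglyMeasurable ?_)
    fun_prop
  · simpa using hb h hh (x - w)

theorem IsBoundedSymbol.exists_dominatedKernel_remainder {P : (Fin d → ℂ) → ℂ}
    (hP : IsBoundedSymbol P) : ∃ c : ℝ, 0 < c ∧ ∀ h : ℝ, 0 < h → h ≤ 1 →
      DominatedKernel h (c * h) (remainderKernel h P) := by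
  obtain ⟨c, hc, hb⟩ := hP.exists_norm_remainder_kernel_le
  refine ⟨c, hc, fun h hh hh1 => ⟨?_, fun x w => hb h hh hh1 x w⟩⟩
  have hPc := hP.smooth.continuous
  have hD := fun j => hP.continuous_dBar j
  have e : (fun a : (Fin d → ℂ) × (Fin d → ℂ) => remainderKernel h P a.1 a.2) = fun a =>
      coherent h a.1 a.2 * (weylAverage h P a.1 a.2 -
        (P a.1 + ∑ j, dBar P j a.1 * conj (a.2 j - a.1 j))) := by
    funext a
    rw [remainderKernel, hP.weylAverage_eq hh]
    ring
  rw [e]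
  refine (continuous_coherent h).stronglyMeasurable.mul
    ((measurable_weylAverage h hPc).sub (Continuous.stronglyMeasurable ?_))
  fun_prop

/-- The first order Taylor expansion of the symbol at the point where the operator is evaluated.
There is no term with `∂P/∂xⱼ`, because its Gaussian average `weylAverage_coord` is zero. -/
theorem IsBoundedSymbol.kernelOp_weylKernel_eq {P : (Fin d → ℂ) → ℂ}
    (hP : IsBoundedSymbol P) {h : ℝ} (hh : 0 < h) (hh1 : h ≤ 1) {u : (Fin d → ℂ) → ℂ}
    (hu : u ∈ HPhi d h) (x : Fin d → ℂ) :
    kernelOp h (weylKernel h P) u x = P x * u x +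
      ∑ j, dBar P j x * kernelOp h (linearKernel h j) u x +
        kernelOp h (remainderKernel h P) u x := by
  obtain ⟨hud, hu2⟩ := mem_HPhi.1 hu
  have hum := hud.continuous.aestronglyMeasurable (μ := volume)
  obtain ⟨c₀, _, h0⟩ := exists_dominatedKernel_coherent d
  obtain ⟨c₁, _, h1⟩ := exists_dominatedKernel_linear d
  obtain ⟨c₂, _, h2⟩ := hP.exists_dominatedKernel_remainder
  have i0 := (h0 h hh).integrable hh hum hu2 x
  have i1 := fun j => (h1 h hh j).integrable hh hum hu2 x
  have i2 := (h2 h hh hh1).integrable hh hum hu2 x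
  have e0 := congrFun (kernelOp_coherent hh hu) x
  have e : ∀ w, weylKernel h P x w * (u w * (Real.exp (-(2 / h) * Phi0 w) : ℂ)) =
      P x * (coherent h x w * (u w * (Real.exp (-(2 / h) * Phi0 w) : ℂ))) +
      ∑ j, dBar P j x * (linearKernel h j x w * (u w * (Real.exp (-(2 / h) * Phi0 w) : ℂ))) +
      remainderKernel h P x w * (u w * (Real.exp (-(2 / h) * Phi0 w) : ℂ)) := by
    intro w
    have e1 : ∑ j, dBar P j x * (linearKernel h j x w *
        (u w * (Real.exp (-(2 / h) * Phi0 w) : ℂ))) =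
        (∑ j, dBar P j x * conj (w j - x j)) *
          (coherent h x w * (u w * (Real.exp (-(2 / h) * Phi0 w) : ℂ))) := by
      rw [Finset.sum_mul]
      refine Finset.sum_congr rfl fun j _ => ?_
      rw [linearKernel]
      ring
    rw [e1, weylKernel, remainderKernel, hP.weylAverage_eq hh]
    ring
  have is : Integrable fun w => ∑ j, dBar P j x * (linearKernel h j x w *
      (u w * (Real.exp (-(2 / h) * Phi0 w) : ℂ))) :=
    integrable_finsetSum _ fun j _ => (i1 j).const_mul _
  have i01 : Integrable fun w => P x * (coherent h x w * (u w *
      (Real.exp (-(2 / h) * Phi0 w) : ℂ))) + ∑ j, dBar P j x * (linearKernel h j x w *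
      (u w * (Real.exp (-(2 / h) * Phi0 w) : ℂ))) := (i0.const_mul _).add is
  conv_rhs => rw [← e0]
  simp only [kernelOp]
  simp_rw [e]
  rw [integral_add i01 i2, integral_add (i0.const_mul _) is, integral_const_mul,
    integral_finsetSum _ fun j _ => (i1 j).const_mul _, mul_add, mul_add, Finset.mul_sum]
  congr 2
  · ring
  · refine Finset.sum_congr rfl fun j _ => ?_
    rw [integral_const_mul]
    ring

/-- The integrand of the double integral that pairs `linearKernel` with `u`. -/
def linearIntegrand (h : ℝ) (j : Fin d) (u : (Fin d → ℂ) → ℂ) (x w : Fin d → ℂ) : ℂ :=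
  linearKernel h j x w * (wt h x * wt h w : ℝ) * (weighted h u w * conj (weighted h u x))

theorem weighted_kernelOp_mul_conj (h : ℝ) (j : Fin d) (u : (Fin d → ℂ) → ℂ) (x : Fin d → ℂ) :
    weighted h (kernelOp h (linearKernel h j) u) x * conj (weighted h u x) =
      (((2 * Real.pi * h) ^ d)⁻¹ : ℝ) * ∫ w, linearIntegrand h j u x w := by
  have e : ∀ w, linearIntegrand h j u x w =
      (linearKernel h j x w * (u w * (Real.exp (-(2 / h) * Phi0 w) : ℂ))) *
        ((wt h x : ℂ) * conj (weighted h u x)) := by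
    intro w
    rw [linearIntegrand, exp_eq_wt_mul_wt, weighted.eq_1 h u w]
    push_cast
    ring
  simp_rw [e]
  rw [integral_mul_const, weighted.eq_1 h (kernelOp h (linearKernel h j) u) x, kernelOp]
  ring

/-- For fixed `w`, the antiholomorphic function `x ↦ conj ((w - x)ⱼ u(x))` vanishes
at `w`, so its pairing with the reproducing kernel is zero. -/
theorem integral_linearIntegrand_left {h : ℝ} (hh : 0 < h) (j : Fin d) {u : (Fin d → ℂ) → ℂ}
    (hu : u ∈ HPhi d h) (w : Fin d → ℂ) : ∫ x, linearIntegrand h j u x w = 0 := by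
  obtain ⟨hud, hu2⟩ := mem_HPhi.1 hu
  have hum := hud.continuous.aestronglyMeasurable (μ := volume)
  obtain ⟨c₁, _, h1⟩ := exists_dominatedKernel_linear d
  have hT : DominatedKernel h (c₁ * Real.sqrt h)
      (fun w x : Fin d → ℂ => coherent h w x * (w j - x j)) := by
    refine ⟨?_, fun w x => ?_⟩
    · refine (continuous_coherent h).stronglyMeasurable.mul (Continuous.stronglyMeasurable ?_)
      fun_prop
    · have h2 := (h1 h hh j).bound w x
      rwa [linearKernel, norm_mul, RCLike.norm_conj, norm_sub_rev, ← norm_mul] at h2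
  have i1 := hT.integrable hh hum hu2 w
  have e1 : ∀ x, coherent h w x * (w j - x j) * (u x * (Real.exp (-(2 / h) * Phi0 x) : ℂ)) =
      coherent h w x * (((w j - x j) * u x) * (Real.exp (-(2 / h) * Phi0 x) : ℂ)) := fun x => by
    ring
  simp_rw [e1] at i1
  have h2 := integral_coherent_mul hh (F := fun x => (w j - x j) * u x) (by fun_prop) w i1
  rw [sub_self, zero_mul, mul_zero] at h2
  have e2 : ∀ x, linearIntegrand h j u x w = (weighted h u w * (wt h w : ℂ)) *
      conj (coherent h w x * (((w j - x j) * u x) * (Real.exp (-(2 / h) * Phi0 x) : ℂ))) := by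
    intro x
    rw [linearIntegrand, exp_eq_wt_mul_wt, weighted.eq_1 h u x, linearKernel]
    simp only [map_mul, map_sub, Complex.conj_ofReal, conj_coherent]
    push_cast
    ring
  simp_rw [e2]
  rw [integral_const_mul, integral_conj, h2, map_zero, mul_zero]

theorem continuous_linearIntegrand (h : ℝ) (j : Fin d) {u : (Fin d → ℂ) → ℂ} (hu : Continuous u) :
    Continuous fun a : (Fin d → ℂ) × (Fin d → ℂ) => linearIntegrand h j u a.1 a.2 := by
  have h1 := continuous_wt (d := d) h
  have h2 := continuous_coherent (d := d) h
  have h3 : Continuous (weighted h u) := hu.mul (Complex.continuous_ofReal.comp h1)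
  have h4 : Continuous fun a : (Fin d → ℂ) × (Fin d → ℂ) => conj (weighted h u a.1) :=
    Complex.continuous_conj.comp (h3.comp continuous_fst)
  have h5 : Continuous fun a : (Fin d → ℂ) × (Fin d → ℂ) => ((wt h a.1 * wt h a.2 : ℝ) : ℂ) :=
    Complex.continuous_ofReal.comp ((h1.comp continuous_fst).mul (h1.comp continuous_snd))
  have h6 : Continuous fun a : (Fin d → ℂ) × (Fin d → ℂ) => conj (a.2 j - a.1 j) := by fun_prop
  exact ((h2.mul h6).mul h5).mul ((h3.comp continuous_snd).mul h4)

theorem norm_linearIntegrand_le (h : ℝ) (j : Fin d) (u : (Fin d → ℂ) → ℂ) (x w : Fin d → ℂ) :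
    ‖linearIntegrand h j u x w‖ ≤ ‖x - w‖ * Real.exp (-(1 / (4 * h)) * sqNorm (x - w)) *
      (‖weighted h u w‖ * ‖weighted h u x‖) := by
  rw [linearIntegrand, norm_mul, norm_mul, norm_mul, RCLike.norm_conj, Complex.norm_real,
    Real.norm_of_nonneg (mul_nonneg (wt_pos h x).le (wt_pos h w).le)]
  have := norm_linearKernel_mul_wt h j x w
  gcongr

/-- The first order term is `O(h)`: its pairing with a multiplier `b` only sees differences of `b`,
and each of the factors `x - w` is of size `√h`. -/
theorem exists_norm_integral_linear_le (d : ℕ) : ∃ C : ℝ, 0 < C ∧ ∀ h : ℝ, 0 < h → ∀ (j : Fin d)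
    (b : (Fin d → ℂ) → ℂ) (M Λ : ℝ), 0 ≤ Λ → Continuous b → (∀ x, ‖b x‖ ≤ M) →
    (∀ x w, ‖b x - b w‖ ≤ Λ * ‖x - w‖) → ∀ u ∈ HPhi d h,
    ‖∫ x, b x * (weighted h (kernelOp h (linearKernel h j) u) x * conj (weighted h u x))‖ ≤
      C * Λ * h * normPhi d h u ^ 2 := by
  obtain ⟨C₁, hC₁, hb₁⟩ := exists_pow_mul_gaussian_le (d := d) 1
  obtain ⟨C₂, hC₂, hb₂⟩ := exists_pow_mul_gaussian_le (d := d) 2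
  refine ⟨C₂ * schurConst d, mul_pos hC₂ (schurConst_pos d), ?_⟩
  intro h hh j b M Λ hΛ hbc hbM hbΛ u hu
  obtain ⟨hud, hu2⟩ := mem_HPhi.1 hu
  have huc := hud.continuous
  have hwm := aestronglyMeasurable_weighted h huc.aestronglyMeasurable
  obtain ⟨hS1, hS2⟩ := integrable_schur_form (fun t => (decay_pos (d := d) h t).le)
    (integrable_decay hh) (decay_neg h) hwm hu2
  have hHc := continuous_linearIntegrand h j huc
  have hH : Integrable (fun a : (Fin d → ℂ) × (Fin d → ℂ) => linearIntegrand h j u a.1 a.2) := by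
    refine (hS1.const_mul (C₁ * Real.sqrt h)).mono' hHc.aestronglyMeasurable
      (Eventually.of_forall fun a => (norm_linearIntegrand_le h j u a.1 a.2).trans ?_)
    have := hb₁ h hh (a.1 - a.2)
    rw [pow_one, pow_one] at this
    rw [← mul_assoc (C₁ * Real.sqrt h)]
    exact mul_le_mul_of_nonneg_right this (by positivity)
  have hb1 : Integrable (fun a : (Fin d → ℂ) × (Fin d → ℂ) =>
      b a.1 * linearIntegrand h j u a.1 a.2) :=
    hH.bdd_mul (c := M) (hbc.comp continuous_fst).aestronglyMeasurable
      (Eventually.of_forall fun a => hbM a.1)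
  have hb2 : Integrable (fun a : (Fin d → ℂ) × (Fin d → ℂ) =>
      b a.2 * linearIntegrand h j u a.1 a.2) :=
    hH.bdd_mul (c := M) (hbc.comp continuous_snd).aestronglyMeasurable
      (Eventually.of_forall fun a => hbM a.2)
  have hz : ∫ a : (Fin d → ℂ) × (Fin d → ℂ), b a.2 * linearIntegrand h j u a.1 a.2 = 0 := by
    rw [Measure.volume_eq_prod, integral_prod_symm _ hb2]
    simp only [integral_const_mul, integral_linearIntegrand_left hh j hu, mul_zero,
      integral_zero]
  have hL : ∫ x, b x * (weighted h (kernelOp h (linearKernel h j) u) x *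
      conj (weighted h u x)) = (((2 * Real.pi * h) ^ d)⁻¹ : ℝ) *
      ∫ a : (Fin d → ℂ) × (Fin d → ℂ), (b a.1 - b a.2) * linearIntegrand h j u a.1 a.2 := by
    simp_rw [sub_mul]
    rw [integral_sub hb1 hb2, hz, sub_zero, Measure.volume_eq_prod, integral_prod _ hb1,
      ← integral_const_mul]
    congr 1
    funext x
    change _ = _ * ∫ y, b x * linearIntegrand h j u x y
    rw [integral_const_mul, weighted_kernelOp_mul_conj]
    ring
  have hpi := Real.pi_pos
  have hn : ‖∫ a : (Fin d → ℂ) × (Fin d → ℂ), (b a.1 - b a.2) * linearIntegrand h j u a.1 a.2‖ ≤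
      Λ * (C₂ * h) * ((∫ t, decay (d := d) h t) * ∫ w, ‖weighted h u w‖ ^ 2) := by
    have h1 := norm_integral_le_of_norm_le (hS1.const_mul (Λ * (C₂ * h)))
      (f := fun a : (Fin d → ℂ) × (Fin d → ℂ) => (b a.1 - b a.2) * linearIntegrand h j u a.1 a.2)
      (Eventually.of_forall fun a => ?_)
    · rw [integral_const_mul] at h1
      have hΛ0 : 0 ≤ Λ * (C₂ * h) := by positivity
      exact h1.trans (mul_le_mul_of_nonneg_left hS2 hΛ0)
    · rw [norm_mul]
      have h2 := hb₂ h hh (a.1 - a.2)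
      rw [Real.sq_sqrt hh.le] at h2
      have h3 := (norm_nonneg _).trans (hbΛ a.1 a.2)
      have h4 : 0 ≤ ‖weighted h u a.2‖ * ‖weighted h u a.1‖ := by positivity
      calc _ ≤ (Λ * ‖a.1 - a.2‖) * (‖a.1 - a.2‖ * Real.exp (-(1 / (4 * h)) * sqNorm (a.1 - a.2)) *
            (‖weighted h u a.2‖ * ‖weighted h u a.1‖)) :=
            mul_le_mul (hbΛ _ _) (norm_linearIntegrand_le h j u _ _) (norm_nonneg _) h3
        _ = Λ * (‖a.1 - a.2‖ ^ 2 * Real.exp (-(1 / (4 * h)) * sqNorm (a.1 - a.2))) *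
            (‖weighted h u a.2‖ * ‖weighted h u a.1‖) := by ring
        _ ≤ Λ * (C₂ * h * decay h (a.1 - a.2)) *
            (‖weighted h u a.2‖ * ‖weighted h u a.1‖) := by
            gcongr
        _ = _ := by ring
  rw [hL, norm_mul, Complex.norm_real, Real.norm_of_nonneg (by positivity), normPhi_sq]
  calc _ ≤ ((2 * Real.pi * h) ^ d)⁻¹ *
        (Λ * (C₂ * h) * ((∫ t, decay (d := d) h t) * ∫ w, ‖weighted h u w‖ ^ 2)) := by gcongr
    _ = C₂ * (((2 * Real.pi * h) ^ d)⁻¹ * ∫ t, decay (d := d) h t) * Λ * h *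
        ∫ w, ‖weighted h u w‖ ^ 2 := by ring
    _ = _ := by rw [mul_integral_decay hh]

/-! ### The pairing of the Weyl quantization with a cutoff -/

theorem IsBoundedSymbol.exists_norm_dBar_le {P : (Fin d → ℂ) → ℂ} (hP : IsBoundedSymbol P)
    (j : Fin d) : ∃ M : ℝ, ∀ x, ‖dBar P j x‖ ≤ M := by
  obtain ⟨M, hM0, hM⟩ := hP.exists_bound 1
  refine ⟨M, fun x => ?_⟩
  have h1 : ‖fderiv ℝ P x‖ ≤ M := by
    rw [← norm_iteratedFDeriv_one]
    exact hM 1 le_rfl x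
  have h2 : ∀ c : ℂ, ‖c‖ = 1 → ‖fderiv ℝ P x (Pi.single j c)‖ ≤ M := fun c hc =>
    ((fderiv ℝ P x).le_opNorm _).trans (by rw [Pi.norm_single, hc, mul_one]; exact h1)
  have h3 := h2 1 (by simp)
  have h4 := h2 I (by simp)
  rw [dBar, norm_mul]
  have h5 := norm_add_le (fderiv ℝ P x (Pi.single j 1)) (I * fderiv ℝ P x (Pi.single j I))
  rw [norm_mul, Complex.norm_I, one_mul] at h5
  norm_num
  linarith

/-- Up to an error `O(h)`, the Weyl quantization acts in a pairing as the multiplication by its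
symbol, provided that the multiplier `θ` keeps the antiholomorphic derivatives of the symbol
Lipschitz continuous. -/
theorem IsBoundedSymbol.exists_norm_pairing_sub_le {P : (Fin d → ℂ) → ℂ}
    (hP : IsBoundedSymbol P) : ∃ C : ℝ, 0 < C ∧ ∀ h : ℝ, 0 < h → h ≤ 1 →
    ∀ (θ : (Fin d → ℂ) → ℂ) (Λ : ℝ), 0 ≤ Λ → Continuous θ → (∀ x, ‖θ x‖ ≤ 1) →
    (∀ j x w, ‖θ x * dBar P j x - θ w * dBar P j w‖ ≤ Λ * ‖x - w‖) → ∀ u ∈ HPhi d h,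
    ‖(∫ x, θ x * (weighted h (kernelOp h (weylKernel h P) u) x * conj (weighted h u x))) -
      ∫ x, θ x * P x * (weighted h u x * conj (weighted h u x))‖ ≤
      C * (1 + Λ) * h * normPhi d h u ^ 2 := by
  obtain ⟨C₁, hC₁, hlin⟩ := exists_norm_integral_linear_le d
  obtain ⟨c₁, hc₁, hK₁⟩ := exists_dominatedKernel_linear d
  obtain ⟨c₂, hc₂, hK₂⟩ := hP.exists_dominatedKernel_remainder
  obtain ⟨M₀, hM₀, hPM⟩ := hP.exists_norm_le
  choose M₁ hM₁ using hP.exists_norm_dBar_le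
  have hS := schurConst_pos d
  refine ⟨d * C₁ + c₂ * schurConst d, by positivity, ?_⟩
  intro h hh hh1 θ Λ hΛ hθc hθ1 hθΛ u hu
  obtain ⟨hud, hu2⟩ := mem_HPhi.1 hu
  have huc := hud.continuous
  have hum := huc.aestronglyMeasurable (μ := volume)
  have hwm := aestronglyMeasurable_weighted h hum
  have hm₁ := fun j => (hK₁ h hh j).measurable_kernelOp huc
  have hm₂ := (hK₂ h hh hh1).measurable_kernelOp huc
  have hi₁ := fun j => ((hK₁ h hh j).integrable_kernelOp hh hum hu2 (hm₁ j)).1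
  obtain ⟨hi₂, hb₂⟩ := (hK₂ h hh hh1).integrable_kernelOp hh hum hu2 hm₂
  have hPc := hP.smooth.continuous
  have hθdB : ∀ j x, ‖θ x * dBar P j x‖ ≤ M₁ j := fun j x => by
    rw [norm_mul]
    exact (mul_le_of_le_one_left (norm_nonneg _) (hθ1 x)).trans (hM₁ j x)
  have hθP : ∀ x, ‖θ x * P x‖ ≤ M₀ := fun x => by
    rw [norm_mul]
    exact (mul_le_of_le_one_left (norm_nonneg _) (hθ1 x)).trans (hPM x)
  have J₀ : Integrable fun x => θ x * P x * (weighted h u x * conj (weighted h u x)) :=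
    integrable_bdd_mul_mul_conj (hθc.mul hPc) hθP hwm hwm hu2 hu2
  have J₁ : ∀ j, Integrable fun x => θ x * dBar P j x *
      (weighted h (kernelOp h (linearKernel h j) u) x * conj (weighted h u x)) := fun j =>
    integrable_bdd_mul_mul_conj (hθc.mul (hP.continuous_dBar j)) (hθdB j)
      (aestronglyMeasurable_weighted h (hm₁ j)) hwm (hi₁ j) hu2
  have J₂ := integrable_bdd_mul_mul_conj hθc hθ1
    (aestronglyMeasurable_weighted h hm₂) hwm hi₂ hu2
  have e : ∀ x, θ x * (weighted h (kernelOp h (weylKernel h P) u) x * conj (weighted h u x)) =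
      θ x * P x * (weighted h u x * conj (weighted h u x)) +
      ∑ j, θ x * dBar P j x *
        (weighted h (kernelOp h (linearKernel h j) u) x * conj (weighted h u x)) +
      θ x * (weighted h (kernelOp h (remainderKernel h P) u) x * conj (weighted h u x)) := by
    intro x
    have e1 : ∑ j, θ x * dBar P j x *
        (weighted h (kernelOp h (linearKernel h j) u) x * conj (weighted h u x)) =
        θ x * ((∑ j, dBar P j x * kernelOp h (linearKernel h j) u x) * wt h x *
          conj (weighted h u x)) := by
      rw [Finset.sum_mul, Finset.sum_mul, Finset.mul_sum]
      refine Finset.sum_congr rfl fun j _ => ?_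
      rw [weighted.eq_1 h (kernelOp h (linearKernel h j) u)]
      ring
    rw [e1, weighted.eq_1 h (kernelOp h (weylKernel h P) u), hP.kernelOp_weylKernel_eq hh hh1 hu,
      weighted.eq_1 h (kernelOp h (remainderKernel h P) u), weighted]
    ring
  have JS : Integrable fun x => ∑ j, θ x * dBar P j x *
      (weighted h (kernelOp h (linearKernel h j) u) x * conj (weighted h u x)) :=
    integrable_finsetSum _ fun j _ => J₁ j
  have J₀S : Integrable fun x => θ x * P x * (weighted h u x * conj (weighted h u x)) +
      ∑ j, θ x * dBar P j x *
        (weighted h (kernelOp h (linearKernel h j) u) x * conj (weighted h u x)) := J₀.add JS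
  simp_rw [e]
  rw [integral_add J₀S J₂, integral_add J₀ JS, integral_finsetSum _ fun j _ => J₁ j,
    add_assoc, add_sub_cancel_left]
  have hN := normPhi_nonneg h u
  have b₁ : ‖∑ j, ∫ x, θ x * dBar P j x *
      (weighted h (kernelOp h (linearKernel h j) u) x * conj (weighted h u x))‖ ≤
      d * (C₁ * Λ * h * normPhi d h u ^ 2) := by
    refine (norm_sum_le_of_le _ fun j _ => hlin h hh j _ (M₁ j) Λ hΛ
      (hθc.mul (hP.continuous_dBar j)) (hθdB j) (hθΛ j) u hu).trans ?_
    simp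
  have b₂ : ‖∫ x, θ x * (weighted h (kernelOp h (remainderKernel h P) u) x *
      conj (weighted h u x))‖ ≤ c₂ * h * schurConst d * normPhi d h u ^ 2 := by
    refine (norm_integral_mul_conj_le hθ1 (aestronglyMeasurable_weighted h hm₂) hwm hi₂ hu2).trans
      ?_
    have h3 : Real.sqrt (∫ x, ‖weighted h (kernelOp h (remainderKernel h P) u) x‖ ^ 2) ≤
        c₂ * h * schurConst d * normPhi d h u := by
      refine (Real.sqrt_le_sqrt hb₂).trans ?_
      rw [← normPhi_sq, ← mul_pow, Real.sqrt_sq (by positivity)]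
    rw [sqrt_integral_weighted h u]
    calc _ ≤ c₂ * h * schurConst d * normPhi d h u * normPhi d h u := by gcongr
      _ = _ := by ring
  refine (norm_add_le_of_le b₁ b₂).trans ?_
  have h4 : 0 ≤ (d * C₁ + c₂ * schurConst d * Λ) * h * normPhi d h u ^ 2 := by positivity
  linarith

/-! ### Lipschitz bounds for the rescaled cutoff -/

/-- Multiplying a Lipschitz continuous function that vanishes at `0` by a rescaled cutoff leaves
it Lipschitz continuous, uniformly in the scale: the large slope of the cutoff is only felt where
the function is small. -/
theorem norm_rescaled_mul_sub_le {E : Type*} [NormedAddCommGroup E] [NormedSpace ℝ E]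
    {χ : E → ℝ} {K R M l : ℝ} {B : E → ℂ} (hK : 0 ≤ K) (hM : 0 ≤ M) (hl : 0 < l)
    (hχK : ∀ x w, |χ x - χ w| ≤ K * ‖x - w‖) (hχ1 : ∀ x, |χ x| ≤ 1)
    (hχR : ∀ x, R < ‖x‖ → χ x = 1) (hB : ∀ x w, ‖B x - B w‖ ≤ M * ‖x - w‖) (hB0 : B 0 = 0)
    (x w : E) :
    ‖(χ (l • x) : ℂ) * B x - (χ (l • w) : ℂ) * B w‖ ≤ (1 + K * |R|) * M * ‖x - w‖ := by
  have key : ∀ x w : E, ‖l • w‖ ≤ R →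
      ‖(χ (l • x) : ℂ) * B x - (χ (l • w) : ℂ) * B w‖ ≤ (1 + K * |R|) * M * ‖x - w‖ := by
    intro x w hw
    have e : (χ (l • x) : ℂ) * B x - (χ (l • w) : ℂ) * B w =
        (χ (l • x) : ℂ) * (B x - B w) + ((χ (l • x) - χ (l • w) : ℝ) : ℂ) * B w := by
      push_cast
      ring
    have h1 : |χ (l • x) - χ (l • w)| ≤ K * (l * ‖x - w‖) := by
      refine (hχK _ _).trans_eq ?_
      rw [← smul_sub, norm_smul, Real.norm_of_nonneg hl.le]
    have h2 : l * ‖B w‖ ≤ |R| * M := by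
      have := hB w 0
      rw [hB0, sub_zero, sub_zero] at this
      rw [norm_smul, Real.norm_of_nonneg hl.le] at hw
      calc l * ‖B w‖ ≤ l * (M * ‖w‖) := by gcongr
        _ = (l * ‖w‖) * M := by ring
        _ ≤ |R| * M := by gcongr; exact hw.trans (le_abs_self R)
    rw [e]
    refine (norm_add_le _ _).trans ?_
    rw [norm_mul, norm_mul, Complex.norm_real, Complex.norm_real, Real.norm_eq_abs,
      Real.norm_eq_abs]
    calc _ ≤ 1 * (M * ‖x - w‖) + K * (l * ‖x - w‖) * ‖B w‖ := by
          gcongr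
          · exact hχ1 _
          · exact hB x w
      _ = M * ‖x - w‖ + K * ‖x - w‖ * (l * ‖B w‖) := by ring
      _ ≤ M * ‖x - w‖ + K * ‖x - w‖ * (|R| * M) := by gcongr
      _ = _ := by ring
  by_cases hw : ‖l • w‖ ≤ R
  · exact key x w hw
  by_cases hx : ‖l • x‖ ≤ R
  · rw [norm_sub_rev, norm_sub_rev x]
    exact key w x hx
  rw [hχR _ (not_le.1 hw), hχR _ (not_le.1 hx), Complex.ofReal_one, one_mul, one_mul]
  refine (hB x w).trans ?_
  have : 0 ≤ K * |R| * M * ‖x - w‖ := by positivity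
  linarith

theorem exists_lipschitz_of_eq_one_at_infinity {χ : (Fin d → ℂ) → ℝ} (hχ : ContDiff ℝ ∞ χ)
    {R : ℝ} (hR : ∀ x, R < ‖x‖ → χ x = 1) :
    ∃ K : ℝ, 0 ≤ K ∧ ∀ x w, |χ x - χ w| ≤ K * ‖x - w‖ := by
  have h1 : HasCompactSupport fun x => χ x - 1 := by
    refine HasCompactSupport.of_support_subset_isCompact (isCompact_closedBall 0 R) fun x hx => ?_
    by_contra hx'
    refine hx ?_
    simp only [Metric.mem_closedBall, dist_zero_right, not_le] at hx'
    simp [hR x hx']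
  obtain ⟨K, hK⟩ := ContDiff.lipschitzWith_of_hasCompactSupport h1
    (hχ.sub contDiff_const) (n := ∞) (by simp)
  refine ⟨K, K.2, fun x w => ?_⟩
  have := hK.dist_le_mul x w
  rwa [Real.dist_eq, sub_sub_sub_cancel_right, dist_eq_norm] at this

theorem SymbolHypotheses.dBar_zero {p : PhaseSpace d → ℂ} (hp : SymbolHypotheses p) (j : Fin d) :
    dBar (fun x => p (toPhase d x)) j 0 = 0 := by
  have h1 : HasFDerivAt p (0 : PhaseSpace d →L[ℝ] ℂ) (toPhase d 0) := by
    rw [(toPhase d).map_zero, ← hp.fderiv_zero]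
    exact (hp.smooth.differentiable (by simp) 0).hasFDerivAt
  have h2 : fderiv ℝ (fun x => p (toPhase d x)) 0 = 0 := by
    have := (h1.comp (0 : Fin d → ℂ) (toPhase d).hasFDerivAt).fderiv
    rwa [ContinuousLinearMap.zero_comp] at this
  simp [dBar, h2]

/-! ### The lower bound for the real part of the symbol -/

theorem quadPart_smul (p : PhaseSpace d → ℂ) (t : ℝ) (X : PhaseSpace d) :
    quadPart p (t • X) = (t : ℂ) ^ 2 * quadPart p X := by
  rw [quadPart, quadPart, iteratedFDeriv_two_apply, iteratedFDeriv_two_apply]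
  simp
  ring

theorem continuous_quadPart (p : PhaseSpace d → ℂ) : Continuous (quadPart p) := by
  unfold quadPart
  fun_prop

namespace SymbolHypotheses

variable {p : PhaseSpace d → ℂ} (hp : SymbolHypotheses p)
include hp

/-- The Taylor expansion of second order at the origin, integrated along rays from the first order
expansion of `p'`. -/
theorem eventually_norm_sub_quadPart_le {ε : ℝ} (hε : 0 < ε) :
    ∀ᶠ X in 𝓝 (0 : PhaseSpace d), ‖p X - quadPart p X‖ ≤ ε * ‖X‖ ^ 2 := by
  have hd : Differentiable ℝ p := hp.smooth.differentiable (by simp)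
  have h1 : HasFDerivAt (fderiv ℝ p) (fderiv ℝ (fderiv ℝ p) 0) 0 :=
    ((hp.smooth.fderiv_right (m := ∞) (by simp)).differentiable (by simp) 0).hasFDerivAt
  have h2 := h1.isLittleO.def hε
  simp only [hp.fderiv_zero, sub_zero] at h2
  obtain ⟨δ, hδ, hball⟩ := Metric.eventually_nhds_iff_ball.1 h2
  refine Metric.eventually_nhds_iff_ball.2 ⟨δ, hδ, fun X hX => ?_⟩
  rw [mem_ball_zero_iff] at hX
  have hder : ∀ t : ℝ, HasDerivAt
      (fun t : ℝ => p (t • X) - ((t ^ 2 : ℝ) : ℂ) * quadPart p X)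
      (fderiv ℝ p (t • X) X - ((2 * t : ℝ) : ℂ) * quadPart p X) t := by
    intro t
    have h3 : HasDerivAt (fun t : ℝ => t • X) X t := by
      simpa using (hasDerivAt_id t).smul_const X
    have h4 := (hd (t • X)).hasFDerivAt.comp_hasDerivAt t h3
    have h5 : HasDerivAt (fun t : ℝ => ((t ^ 2 : ℝ) : ℂ)) ((2 * t : ℝ) : ℂ) t := by
      have := (hasDerivAt_pow 2 t).ofReal_comp
      simpa using this
    exact h4.sub (h5.mul_const _)
  have h6 := norm_image_sub_le_of_norm_deriv_le_segment_01' (C := ε * ‖X‖ ^ 2)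
    (fun t _ => (hder t).hasDerivWithinAt) fun t ht => ?_
  · simpa [hp.map_zero] using h6
  · have h7 : ‖t • X‖ ≤ ‖X‖ := by
      rw [norm_smul, Real.norm_of_nonneg ht.1]
      exact mul_le_of_le_one_left (norm_nonneg _) ht.2.le
    have h8 := hball (t • X) (mem_ball_zero_iff.2 (h7.trans_lt hX))
    have h9 : fderiv ℝ p (t • X) X - ((2 * t : ℝ) : ℂ) * quadPart p X =
        (fderiv ℝ p (t • X) - fderiv ℝ (fderiv ℝ p) 0 (t • X)) X := by
      rw [quadPart, iteratedFDeriv_two_apply]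
      simp
      ring
    rw [h9]
    calc _ ≤ ‖fderiv ℝ p (t • X) - fderiv ℝ (fderiv ℝ p) 0 (t • X)‖ * ‖X‖ :=
          ContinuousLinearMap.le_opNorm _ _
      _ ≤ ε * ‖X‖ * ‖X‖ := by
          gcongr
          exact h8.trans (by gcongr)
      _ = _ := by ring

/-- A negative value of `Re q` would make `Re p` negative close to the origin. -/
theorem re_quadPart_nonneg (X : PhaseSpace d) : 0 ≤ (quadPart p X).re := by
  by_contra! hX
  have hX0 : 0 < ‖X‖ := by
    refine norm_pos_iff.2 fun h => ?_
    rw [h, (hp.elliptic 0).2 rfl] at hX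
    exact lt_irrefl _ hX
  have hε : 0 < -(quadPart p X).re / (2 * ‖X‖ ^ 2) := div_pos (neg_pos.2 hX) (by positivity)
  have h1 := hp.eventually_norm_sub_quadPart_le hε
  have h2 : Tendsto (fun t : ℝ => t • X) (𝓝[>] 0) (𝓝 0) := by
    have : Continuous fun t : ℝ => t • X := by fun_prop
    have := this.tendsto 0
    rw [zero_smul] at this
    exact this.mono_left nhdsWithin_le_nhds
  obtain ⟨t, ht, ht0⟩ := ((h2.eventually h1).and self_mem_nhdsWithin).exists
  have ht0 : 0 < t := ht0
  have h3 := (Complex.abs_re_le_norm _).trans ht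
  rw [quadPart_smul, norm_smul, Real.norm_of_nonneg ht0.le, Complex.sub_re,
    ← Complex.ofReal_pow, Complex.re_ofReal_mul] at h3
  have h4 := (le_abs_self _).trans h3
  have h5 := hp.re_nonneg (t • X)
  have h6 : -(quadPart p X).re / (2 * ‖X‖ ^ 2) * (t * ‖X‖) ^ 2 =
      -(quadPart p X).re / 2 * t ^ 2 := by
    field_simp
  rw [h6] at h4
  have : 0 < t ^ 2 := by positivity
  nlinarith

theorem exists_le_re_quadPart : ∃ m : ℝ, 0 < m ∧ ∀ X, m * ‖X‖ ^ 2 ≤ (quadPart p X).re := by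
  obtain ⟨m, hm, hmX⟩ := (isCompact_sphere (0 : PhaseSpace d) 1).exists_forall_le' (a := 0)
    (f := fun X => (quadPart p X).re)
    (Complex.continuous_re.comp (continuous_quadPart p)).continuousOn fun X hX => by
      refine lt_of_le_of_ne (hp.re_quadPart_nonneg X) fun h => ?_
      rw [(hp.elliptic X).1 h.symm] at hX
      simp at hX
  refine ⟨m, hm, fun X => ?_⟩
  rcases eq_or_ne X 0 with rfl | hX
  · simpa using hp.re_quadPart_nonneg 0
  have hX0 := norm_pos_iff.2 hX
  have h1 := hmX (‖X‖⁻¹ • X) (by simp [norm_smul, hX0.ne'])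
  rw [quadPart_smul, ← Complex.ofReal_pow, Complex.re_ofReal_mul] at h1
  calc m * ‖X‖ ^ 2 ≤ ‖X‖⁻¹ ^ 2 * (quadPart p X).re * ‖X‖ ^ 2 := by gcongr
    _ = _ := by field_simp

/-- The real part of the symbol is bounded from below by a multiple of `min (|X|², 1)`: near the
origin by ellipticity, and elsewhere by compactness and the positive lower limit at infinity. -/
theorem exists_mul_le_re : ∃ c : ℝ, 0 < c ∧ ∀ X (s : ℝ), s ≤ 1 → s ≤ ‖X‖ ^ 2 →
    c * s ≤ (p X).re := by
  obtain ⟨m, hm, hmX⟩ := hp.exists_le_re_quadPart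
  obtain ⟨δ, hδ, hball⟩ := Metric.eventually_nhds_iff_ball.1
    (hp.eventually_norm_sub_quadPart_le (half_pos hm))
  obtain ⟨c₁, hc₁, hinf⟩ := hp.liminf_pos
  obtain ⟨K, hK, hKc⟩ := mem_cocompact.1 hinf
  obtain ⟨c₂, hc₂, hmid⟩ := (hK.diff (Metric.isOpen_ball (x := 0) (ε := δ))).exists_forall_le'
    (a := 0) (f := fun X => (p X).re)
    (Complex.continuous_re.comp hp.smooth.continuous).continuousOn fun X hX => by
      refine lt_of_le_of_ne (hp.re_nonneg X) fun h => ?_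
      rw [(hp.re_eq_zero_iff X).1 h.symm] at hX
      exact hX.2 (Metric.mem_ball_self hδ)
  set c := min (m / 2) (min c₁ c₂) with hc
  have hc0 : 0 < c := by positivity
  refine ⟨c, hc0, fun X s hs1 hsX => ?_⟩
  by_cases hX : X ∈ Metric.ball 0 δ
  · have h1 := (abs_le.1 ((Complex.abs_re_le_norm _).trans (hball X hX))).1
    rw [Complex.sub_re] at h1
    have h2 := hmX X
    calc c * s ≤ m / 2 * ‖X‖ ^ 2 :=
          (mul_le_mul_of_nonneg_left hsX hc0.le).trans
            (mul_le_mul_of_nonneg_right (min_le_left _ _) (by positivity))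
      _ ≤ _ := by linarith
  · have h1 : c * s ≤ c := mul_le_of_le_one_right hc0.le hs1
    by_cases hXK : X ∈ K
    · exact h1.trans (((min_le_right _ _).trans (min_le_right _ _)).trans (hmid X ⟨hXK, hX⟩))
    · exact h1.trans (((min_le_right _ _).trans (min_le_left _ _)).trans (hKc hXK))

end SymbolHypotheses

/-! ### The spectral parameter -/

/-- The admissible spectral parameters are `o(h^ρ)`. The bound is crude: `f(h)` is at most a
multiple of `log (1/h)`. -/
theorem eventually_mul_growth_le (hd : 1 ≤ d) {Cγ : ℝ} (hCγ : 0 < Cγ) {ρ : ℝ} (hρ : ρ < 1)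
    {c : ℝ} (hc : 0 < c) : ∀ᶠ h in 𝓝[>] (0 : ℝ), h * growth d Cγ h ≤ c * h ^ ρ := by
  have h1 : Tendsto (fun h : ℝ => Real.log (1 / h)) (𝓝[>] 0) atTop := by
    simp only [one_div]
    exact Real.tendsto_log_atTop.comp tendsto_inv_nhdsGT_zero
  have h2 := Real.tendsto_log_atTop.comp h1
  have h3 : Tendsto (fun h : ℝ => Real.log h * h ^ (1 - ρ)) (𝓝[>] 0) (𝓝 0) :=
    tendsto_log_mul_rpow_nhdsGT_zero (by linarith)
  filter_upwards [h2.eventually_ge_atTop 1, h1.eventually_ge_atTop 1, self_mem_nhdsWithin,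
    h3.eventually (lt_mem_nhds (show -(c * Cγ) < 0 by nlinarith [mul_pos hc hCγ]))] with h ha hb hh hs
  have hh : 0 < h := hh
  simp only [Function.comp_apply] at ha
  set L := Real.log (1 / h) with hL
  have hL' : Real.log h = -L := by rw [hL, one_div, Real.log_inv, neg_neg]
  have h4 : growth d Cγ h ≤ 1 / Cγ * L := by
    unfold growth
    rw [← hL]
    refine mul_le_mul_of_nonneg_left ?_ (by positivity)
    have hL0 : 0 ≤ L := by linarith
    have hd1 : (1 : ℝ) ≤ d := by exact_mod_cast hd
    have h5 : 1 / (d : ℝ) ≤ 1 := by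
      rw [div_le_one (by linarith)]
      exact hd1
    calc _ ≤ L ^ (1 / (d : ℝ)) := by
          refine Real.rpow_le_rpow (by positivity) (div_le_self hL0 ha) (by positivity)
      _ ≤ L ^ (1 : ℝ) := Real.rpow_le_rpow_of_exponent_le hb h5
      _ = L := Real.rpow_one L
  have h6 : h = h ^ (1 - ρ) * h ^ ρ := by
    rw [← Real.rpow_add hh, sub_add_cancel, Real.rpow_one]
  rw [hL'] at hs
  have h7 : L * h ^ (1 - ρ) ≤ c * Cγ := by linarith
  have h8 := Real.rpow_pos_of_pos hh ρ
  calc h * growth d Cγ h ≤ h * (1 / Cγ * L) := by gcongr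
    _ = 1 / Cγ * (L * h ^ (1 - ρ)) * h ^ ρ := by
        nth_rewrite 1 [h6]
        ring
    _ ≤ 1 / Cγ * (c * Cγ) * h ^ ρ := by gcongr
    _ = c * h ^ ρ := by field_simp

/-! ### The estimate away from the doubly characteristic point -/

/-- The energy estimate behind the theorem: where the real part of the symbol is at least `2κ` on
the support of the cutoff `θ` and `|z| ≤ κ`, the mass of `u` there is controlled by the real part of
the pairing of `θ u` with `(weylOp - z) u`. -/
theorem integral_cutoff_mul_le {h κ E : ℝ} {P : (Fin d → ℂ) → ℂ}
    {θ : (Fin d → ℂ) → ℝ} (hθc : Continuous θ) (hθ : ∀ x, θ x ∈ Set.Icc (0 : ℝ) 1)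
    (hPc : Continuous P) {M : ℝ} (hPM : ∀ x, ‖P x‖ ≤ M)
    (hPθ : ∀ x, θ x ≠ 0 → 2 * κ ≤ (P x).re) {z : ℂ} (hz : ‖z‖ ≤ κ) {u v : (Fin d → ℂ) → ℂ}
    (hu : u ∈ HPhi d h) (hv : v ∈ HPhi d h)
    (hE : ‖(∫ x, (θ x : ℂ) * (weighted h v x * conj (weighted h u x))) -
      ∫ x, (θ x : ℂ) * P x * (weighted h u x * conj (weighted h u x))‖ ≤ E) :
    κ * ∫ x, θ x * ‖weighted h u x‖ ^ 2 ≤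
      normPhi d h (v - z • u) * normPhi d h u + E := by
  obtain ⟨hud, hu2⟩ := mem_HPhi.1 hu
  obtain ⟨hvd, hv2⟩ := mem_HPhi.1 hv
  obtain ⟨hrd, hr2⟩ := mem_HPhi.1 ((HPhi d h).sub_mem hv ((HPhi d h).smul_mem z hu))
  have hum := aestronglyMeasurable_weighted h (hud.continuous.aestronglyMeasurable (μ := volume))
  have hvm := aestronglyMeasurable_weighted h (hvd.continuous.aestronglyMeasurable (μ := volume))
  have hrm := aestronglyMeasurable_weighted h (hrd.continuous.aestronglyMeasurable (μ := volume))
  have hθc' : Continuous fun x => (θ x : ℂ) := Complex.continuous_ofReal.comp hθc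
  have hθ1 : ∀ x, ‖(θ x : ℂ)‖ ≤ 1 := fun x => by
    rw [Complex.norm_real, Real.norm_of_nonneg (hθ x).1]
    exact (hθ x).2
  have hθP : ∀ x, ‖(θ x : ℂ) * P x‖ ≤ M := fun x => by
    rw [norm_mul]
    exact (mul_le_of_le_one_left (norm_nonneg _) (hθ1 x)).trans (hPM x)
  have Jv := integrable_bdd_mul_mul_conj hθc' hθ1 hvm hum hv2 hu2
  have Ju := integrable_bdd_mul_mul_conj hθc' hθ1 hum hum hu2 hu2
  have JP : Integrable fun x => (θ x : ℂ) * P x * (weighted h u x * conj (weighted h u x)) :=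
    integrable_bdd_mul_mul_conj (hθc'.mul hPc) hθP hum hum hu2 hu2
  have hr := norm_integral_mul_conj_le hθ1 hrm hum hr2 hu2
  rw [sqrt_integral_weighted, sqrt_integral_weighted] at hr
  have hsq : ∀ x, weighted h u x * conj (weighted h u x) = ((‖weighted h u x‖ ^ 2 : ℝ) : ℂ) :=
    fun x => by rw [Complex.mul_conj, Complex.normSq_eq_norm_sq]
  set S := ∫ x, θ x * ‖weighted h u x‖ ^ 2 with hS
  have hS0 : 0 ≤ S := integral_nonneg fun x => mul_nonneg (hθ x).1 (by positivity)
  have eu : ∫ x, (θ x : ℂ) * (weighted h u x * conj (weighted h u x)) = (S : ℂ) := by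
    rw [hS, ← integral_complex_ofReal]
    refine integral_congr_ae (Eventually.of_forall fun x => ?_)
    beta_reduce
    rw [hsq]
    push_cast
    ring
  have er : ∫ x, (θ x : ℂ) * (weighted h (v - z • u) x * conj (weighted h u x)) =
      (∫ x, (θ x : ℂ) * (weighted h v x * conj (weighted h u x))) - z * S := by
    rw [← eu, ← integral_const_mul, ← integral_sub Jv (Ju.const_mul z)]
    refine integral_congr_ae (Eventually.of_forall fun x => ?_)
    simp only [weighted, Pi.sub_apply, Pi.smul_apply, smul_eq_mul]
    ring
  have hSi : Integrable fun x => θ x * ‖weighted h u x‖ ^ 2 := by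
    refine hu2.mono' (hθc.aestronglyMeasurable.mul (hum.norm.pow 2))
      (Eventually.of_forall fun x => ?_)
    rw [Real.norm_of_nonneg (mul_nonneg (hθ x).1 (by positivity))]
    exact mul_le_of_le_one_left (by positivity) (hθ x).2
  have hlow : 2 * κ * S ≤
      (∫ x, (θ x : ℂ) * P x * (weighted h u x * conj (weighted h u x))).re := by
    have h1 := integral_re JP
    simp only [RCLike.re_to_complex] at h1
    rw [← h1, hS, ← integral_const_mul]
    refine integral_mono (hSi.const_mul _) JP.re fun x => ?_
    rw [hsq, mul_comm _ ((_ : ℝ) : ℂ), Complex.re_ofReal_mul, Complex.re_ofReal_mul]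
    rcases eq_or_ne (θ x) 0 with h0 | h0
    · simp [h0]
    · have := mul_le_mul_of_nonneg_left (hPθ x h0)
        (mul_nonneg (hθ x).1 (sq_nonneg ‖weighted h u x‖))
      linarith
  have h2 := (Complex.abs_re_le_norm _).trans hE
  have h3 := (Complex.abs_re_le_norm _).trans hr
  rw [er] at h3
  rw [Complex.sub_re] at h2 h3
  have h4 : |(z * S).re| ≤ κ * S := by
    refine (Complex.abs_re_le_norm _).trans ?_
    rw [norm_mul, Complex.norm_real, Real.norm_of_nonneg hS0]
    gcongr
  have h5 := (abs_le.1 h2).1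
  have h6 := (abs_le.1 h3).2
  have h7 := (abs_le.1 h4).2
  linarith

/-- Polynomial bounds, uniform in the spectral parameter, on the mass of `u` away from an
`h^{ρ/2}`-neighborhood of the origin. -/
theorem SymbolHypotheses.exists_exterior_estimate {p : PhaseSpace d → ℂ}
    (hp : SymbolHypotheses p) (hd : 1 ≤ d) {χ : (Fin d → ℂ) → ℝ} (hχ : ContDiff ℝ ∞ χ)
    (hχ01 : ∀ x, χ x ∈ Set.Icc (0 : ℝ) 1) (hχ0 : ∀ᶠ x in 𝓝 (0 : Fin d → ℂ), χ x = 0)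
    {R : ℝ} (hχR : ∀ x, R < ‖x‖ → χ x = 1) {Cγ : ℝ} (hCγ : 0 < Cγ) {ρ : ℝ} (hρ0 : 0 ≤ ρ)
    (hρ1 : ρ < 1) :
    ∃ C : ℝ, 0 < C ∧ ∃ h₀ : ℝ, 0 < h₀ ∧ h₀ ≤ 1 ∧ ∀ (h : ℝ) (hh : 0 < h) (hh1 : h ≤ 1), h ≤ h₀ →
      ∀ z : ℂ, ‖z‖ ≤ h * growth d Cγ h → ∀ u : HPhi d h,
        ∫ x, χ (h ^ (-ρ / 2) • x) *
            (‖(u : (Fin d → ℂ) → ℂ) x‖ ^ 2 * Real.exp (-(2 / h) * Phi0 x)) ≤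
          C * h ^ (-ρ) * normPhi d h (weylOp hh hh1 hp.isBoundedSymbol u - z • u : HPhi d h) *
              normPhi d h u + C * h ^ (1 - ρ) * normPhi d h u ^ 2 := by
  set P : (Fin d → ℂ) → ℂ := fun x => p (toPhase d x) with hPdef
  have hP : IsBoundedSymbol P := hp.isBoundedSymbol
  obtain ⟨C₁, hC₁, hpair⟩ := hP.exists_norm_pairing_sub_le
  obtain ⟨K, hK, hχK⟩ := exists_lipschitz_of_eq_one_at_infinity hχ hχR
  obtain ⟨M, hM, hPM⟩ := hP.exists_norm_le
  obtain ⟨M₂, hM₂, hPM₂⟩ := hP.exists_bound 2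
  obtain ⟨c, hc, hlow⟩ := hp.exists_mul_le_re
  obtain ⟨r, hr, hball⟩ := Metric.eventually_nhds_iff_ball.1 hχ0
  -- The real part of the symbol is at least `2 κ₀ h ^ ρ` on the support of the cutoff.
  set s₀ := min 1 ((r / 2) ^ 2) with hs₀
  have hs₀0 : 0 < s₀ := by positivity
  set κ₀ := c * s₀ / 2 with hκ₀
  have hκ₀0 : 0 < κ₀ := by positivity
  obtain ⟨h₁, hh₁, hgrow⟩ :=
    (mem_nhdsGT_iff_exists_Ioc_subset).1 (eventually_mul_growth_le hd hCγ hρ1 hκ₀0)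
  have hh₁ : 0 < h₁ := hh₁
  set Λ := (1 + K * |R|) * M₂ with hΛ
  have hΛ0 : 0 ≤ Λ := by positivity
  set C₂ := 1 + C₁ * (1 + Λ) with hC₂
  have hC₂1 : 1 ≤ C₂ := by
    have : 0 ≤ C₁ * (1 + Λ) := by positivity
    linarith
  refine ⟨C₂ / κ₀, by positivity, min h₁ 1, by positivity, min_le_right _ _, ?_⟩
  intro h hh hh1 hh₀ z hz u
  have hl : 0 < h ^ (-ρ / 2) := Real.rpow_pos_of_pos hh _
  have hhρ : 0 < h ^ ρ := Real.rpow_pos_of_pos hh _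
  have hc1 : Continuous fun x : Fin d → ℂ => χ (h ^ (-ρ / 2) • x) :=
    hχ.continuous.comp (continuous_const_smul _)
  have hsupp : ∀ x, χ (h ^ (-ρ / 2) • x) ≠ 0 → 2 * (κ₀ * h ^ ρ) ≤ (P x).re := by
    intro x hx
    have h1 : r ≤ h ^ (-ρ / 2) * ‖x‖ := by
      by_contra! hlt
      refine hx (hball _ ?_)
      rwa [mem_ball_zero_iff, norm_smul, Real.norm_of_nonneg hl.le]
    have h2 : (h ^ (-ρ / 2)) ^ 2 * h ^ ρ = 1 := by
      rw [← Real.rpow_natCast, ← Real.rpow_mul hh.le, ← Real.rpow_add hh]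
      convert Real.rpow_zero h using 2
      push_cast
      ring
    have h3 : (r / 2) ^ 2 * h ^ ρ ≤ ‖toPhase d x‖ ^ 2 := by
      have h4 := norm_le_norm_toPhase x
      calc (r / 2) ^ 2 * h ^ ρ ≤ (h ^ (-ρ / 2) * (2 * ‖toPhase d x‖) / 2) ^ 2 * h ^ ρ := by
            gcongr
            exact h1.trans (by gcongr)
        _ = (h ^ (-ρ / 2)) ^ 2 * h ^ ρ * ‖toPhase d x‖ ^ 2 := by ring
        _ = _ := by rw [h2, one_mul]
    have h5 : h ^ ρ ≤ 1 := Real.rpow_le_one hh.le hh1 hρ0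
    have h6 := hlow (toPhase d x) (s₀ * h ^ ρ)
      (mul_le_one₀ (min_le_left _ _) hhρ.le h5)
      ((mul_le_mul_of_nonneg_right (min_le_right _ _) hhρ.le).trans h3)
    calc 2 * (κ₀ * h ^ ρ) = c * (s₀ * h ^ ρ) := by rw [hκ₀]; ring
      _ ≤ _ := h6
  have hz' : ‖z‖ ≤ κ₀ * h ^ ρ := hz.trans (hgrow ⟨hh, hh₀.trans (min_le_left _ _)⟩)
  have hE := hpair h hh hh1 (fun x => (χ (h ^ (-ρ / 2) • x) : ℂ)) Λ hΛ0
    (Complex.continuous_ofReal.comp hc1)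
    (fun x => by
      rw [Complex.norm_real, Real.norm_of_nonneg (hχ01 _).1]
      exact (hχ01 _).2)
    (fun j x w => norm_rescaled_mul_sub_le hK hM₂.le hl hχK
      (fun x => by
        rw [abs_of_nonneg (hχ01 _).1]
        exact (hχ01 _).2)
      hχR (hP.norm_dBar_sub_le (hPM₂ 2 le_rfl) j) (hp.dBar_zero j) x w) u u.2
  have hmain := integral_cutoff_mul_le hc1 (fun x => hχ01 _) hP.smooth.continuous hPM hsupp hz' u.2
    (hP.kernelOp_mem hh hh1 u.2) hE
  simp_rw [norm_weighted_sq] at hmain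
  set S := ∫ x, χ (h ^ (-ρ / 2) • x) *
    (‖(u : (Fin d → ℂ) → ℂ) x‖ ^ 2 * Real.exp (-(2 / h) * Phi0 x)) with hS
  have hv : normPhi d h (kernelOp h (weylKernel h P) u - z • (u : (Fin d → ℂ) → ℂ)) =
      normPhi d h (weylOp hh hh1 hp.isBoundedSymbol u - z • u : HPhi d h) := rfl
  rw [hv] at hmain
  set a := normPhi d h (weylOp hh hh1 hp.isBoundedSymbol u - z • u : HPhi d h)
  set b := normPhi d h u with hb
  have ha0 : 0 ≤ a := normPhi_nonneg h _
  have hb0 : 0 ≤ b := normPhi_nonneg h _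
  have e1 : h ^ (1 - ρ) = h * h ^ (-ρ) := by
    rw [sub_eq_add_neg, Real.rpow_add hh, Real.rpow_one]
  have e2 : h ^ (-ρ) * h ^ ρ = 1 := by
    rw [← Real.rpow_add hh, neg_add_cancel, Real.rpow_zero]
  have hhρ' : 0 < h ^ (-ρ) := Real.rpow_pos_of_pos hh _
  have h7 : κ₀ * h ^ ρ * S ≤ C₂ * (a * b + h * b ^ 2) := by
    have h8 : 0 ≤ C₁ * (1 + Λ) * (a * b) := by positivity
    have h9 : 0 ≤ h * b ^ 2 := by positivity
    rw [hC₂]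
    linarith
  calc S = h ^ (-ρ) / κ₀ * (κ₀ * h ^ ρ * S) := by
        field_simp
        linear_combination (-S) * e2
    _ ≤ h ^ (-ρ) / κ₀ * (C₂ * (a * b + h * b ^ 2)) := by gcongr
    _ = _ := by
        rw [e1]
        ring

end

end Exterior

theorem proposition5p1 (d : ℕ) (hd : 1 ≤ d)
    (p : Exterior.PhaseSpace d → ℂ) (hp : Exterior.SymbolHypotheses p)
    (χ : (Fin d → ℂ) → ℝ) (hχ_smooth : ContDiff ℝ ∞ χ)
    (hχ_range : ∀ x, χ x ∈ Set.Icc (0 : ℝ) 1)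
    (hχ_zero : ∀ᶠ x in 𝓝 (0 : Fin d → ℂ), χ x = 0)
    (hχ_one : ∃ R : ℝ, ∀ x, R < ‖x‖ → χ x = 1)
    (Cγ : ℝ) (hCγ : 0 < Cγ) (ρ : ℝ) (hρ0 : 0 ≤ ρ) (hρ1 : ρ < 1) :
    ∃ C : ℝ, 0 < C ∧ ∃ h₀ : ℝ, 0 < h₀ ∧ ∀ h : ℝ, 0 < h → h ≤ h₀ →
      (∃! A : Exterior.HPhi d h →ₗ[ℂ] Exterior.HPhi d h,
        Exterior.IsWeylQuantization h (Exterior.frakSymbol p) A) ∧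
      ∀ A : Exterior.HPhi d h →ₗ[ℂ] Exterior.HPhi d h,
        Exterior.IsWeylQuantization h (Exterior.frakSymbol p) A →
        ∀ z : ℂ, ‖z‖ ≤ h * Exterior.growth d Cγ h →
        ∀ u : Exterior.HPhi d h,
          ∫ x, χ (h ^ (-ρ / 2) • x) *
              (‖(u : (Fin d → ℂ) → ℂ) x‖ ^ 2 * Real.exp (-(2 / h) * Exterior.Phi0 x))
            ≤ C * h ^ (-ρ) * Exterior.normPhi d h (A u - z • u : Exterior.HPhi d h) *
                Exterior.normPhi d h u
              + C * h ^ (1 - ρ) * Exterior.normPhi d h u ^ 2 := by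
  obtain ⟨R, hR⟩ := hχ_one
  obtain ⟨C, hC, h₀, hh₀, hh₀1, hest⟩ :=
    hp.exists_exterior_estimate hd hχ_smooth hχ_range hχ_zero hR hCγ hρ0 hρ1
  refine ⟨C, hC, h₀, hh₀, fun h hh hle => ?_⟩
  have hW := Exterior.isWeylQuantization_weylOp hh (hle.trans hh₀1) hp.isBoundedSymbol
    (Exterior.frakSymbol_xi0 p)
  refine ⟨⟨_, hW, fun A hA => hA.unique hh hW⟩, fun A hA z hz u => ?_⟩
  rw [hA.unique hh hW]
  exact hest h hh (hle.trans hh₀1) hle z hz u
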